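/- Let $\mathbb P\subset\mathbb R^3$ be a bounded polyhedral domain: a bounded, connected, nonempty open set with $\partial\mathbb P=\partial\overline{\mathbb P}=\bigcup_{j=1}^N\overline{D}_j$, where the faces $D_j$ are pairwise disjoint polygons (open connected subsets of affine planes, with $\partial D_j=\partial \overline{D}_j$ a finite union of maximally extended segments, the sides, which have at most end points in common, each vertex lying on exactly two sides) and each side of a face is a side of exactly one other face. The edges of $\mathbb P$ are the sides of the $D_j$, the vertices are their end points. **Coordinate functions.** For a vertex $A$ let $\rho_A$ be the distance to $A$. For an edge $e=[AB]$ let $r_e$ be the distance to the line $AB$, let $\phi_{A,e}$ and $\phi_{B,e}$ be the angles at $A$ and $B$ between $e$ and the segment to the given point, and let $\theta_e\in[0,2\pi)$ be a cylindrical angle around $e$ that vanishes on the half-plane bounded by the line $AB$ and containing, near $e$, a chosen one of the two faces adjacent to $e$. If $\mathbb P$ is convex these functions may be used as they are. In general (convex or not) they are modified as follows. Take $\delta,\alpha,\varepsilon\in(0,\pi/2)$ and $\ell>0$ such that all edges have length at least $4\ell$; for each vertex $A$ the sets $\{p\ne A:\phi_{A,e}(p)>\pi-2\delta\}$, $e\ni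 A$, are pairwise disjoint; and no point of $\mathbb P$ with $\phi_{A,e},\phi_{B,e}\le2\alpha$ has $\theta_e=0$, for any edge $e=[AB]$ (this holds for small $\alpha$). Take smooth functions $\psi_1:[0,\pi]\to[0,\pi-\delta]$ nondecreasing, $\psi_1(t)=t$ for $t\le\pi-2\delta$, $\psi_1=\pi-\delta$ on $[\pi-\delta,\pi]$; $\psi_2:[0,\infty)\to[0,1]$ nonincreasing, $\psi_2=1$ on $[0,\ell]$, $\psi_2=0$ on $[2\ell,\infty)$; $\psi_3:[0,\pi]\to[0,1]$ nonincreasing, $\psi_3=1$ on $[0,\alpha]$, $\psi_3=0$ on $[2\alpha,\pi]$; $\psi_4:[0,2\pi]\to[0,2\pi]$, $\psi_4(t)=t$ on $[2\varepsilon,2\pi-2\varepsilon]$, $\psi_4=0$ on $[0,\varepsilon]\cup[2\pi-\varepsilon,2\pi]$. Replace $\phi_{A,e}$ by $\psi_1(\phi_{A,e})\psi_2(\rho_A)$; replace $\theta_e$ by $\psi_3(\phi_{A,e})\psi_3(\phi_{B,e})\psi_2(r_e)\theta_e$ together with the functions $\psi_4(\theta_e)\psi_4(2\phi_{A,e})\psi_4(2\phi_{B,e})$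 for both choices of the face adjacent to $e$; and replace $r_e$ by $\psi_3(\phi_{A,e})\psi_3(\phi_{B,e})r_e+(1-\psi_3(\phi_{A,e}))\rho_A+(1-\psi_3(\phi_{B,e}))\rho_B$. With either the plain functions ($\mathbb P$ convex) or any such modified functions, let $\theta,\phi$ denote the vectors of all the resulting angular functions, and put $$r_{\mathbb P}:=\prod_{e=[AB]}\frac{r_e}{\rho_A\rho_B}\ \prod_{A\ \text{vertex}}\rho_A .$$ **Function spaces and operators.** $\mathcal C^\infty(\Sigma\mathbb P)$ is the set of functions $u:\mathbb P\to\mathbb C$ such that for every $k$ one can write $u(p)=f(p,\theta(p),\phi(p))$ on $\mathbb P$ with $f$ having bounded derivatives up to order $k$. For $m\in\mathbb Z_+$, $\mathrm{Diff}^m(\mathbb P)$ is the linear span of the operators $u\,(r_{\mathbb P}\partial_x)^{\alpha_1}(r_{\mathbb P}\partial_y)^{\alpha_2}(r_{\mathbb P}\partial_z)^{\alpha_3}$ with $u\in\mathcal C^\infty(\Sigma\mathbb P)$, $|\alpha|\le m$. For $k\in\mathbb Z_+$ and $a\in\mathbb R$, $$\mathcal K^k_a(\mathbb P)=\{u:\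 r_{\mathbb P}^{|\alpha|-a}\partial^\alpha u\in L^2(\mathbb P)\ \text{for all } |\alpha|\le k\},\qquad \|u\|^2=\sum_{|\alpha|\le k}\|r_{\mathbb P}^{|\alpha|-a}\partial^\alpha u\|_{L^2(\mathbb P)}^2,$$ with derivatives in the sense of distributions. **Proposition.** Let $k\ge m\ge 0$ be integers and $a\in\mathbb R$. 1. Each $P_0\in\mathrm{Diff}^m(\mathbb P)$ defines a continuous linear map $P_0:\mathcal K^k_a(\mathbb P)\to\mathcal K^{k-m}_a(\mathbb P)$. The operators $r_{\mathbb P}^{-\lambda}P_0\,r_{\mathbb P}^{\lambda}$, $\lambda\in\mathbb R$, are bounded operators $\mathcal K^k_a(\mathbb P)\to\mathcal K^{k-m}_a(\mathbb P)$ depending continuously on $\lambda$ in the operator norm. 2. Let $P=\sum_{|\alpha|\le m}c_\alpha\partial^\alpha$ be a differential operator of order $m$ whose coefficients are smooth on $\mathbb P$ with bounded derivatives of all orders (for instance, smooth up to the boundary). Then $P$ defines a continuous linear map $\mathcal K^k_a(\mathbb P)\to\mathcal K^{k-m}_{a-m}(\mathbb P)$, and the operators $r_{\mathbb P}^{-\lambda}P\,r_{\mathbb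 P}^{\lambda}$, $\lambda\in\mathbb R$, are bounded operators $\mathcal K^k_a(\mathbb P)\to\mathcal K^{k-m}_{a-m}(\mathbb P)$ depending continuously on $\lambda$ in the operator norm. -/

import Mathlib

open Set MeasureTheory Topology
open scoped ContDiff

noncomputable section

namespace Kondratiev

/-- Euclidean three-space. -/
abbrev E3 := EuclideanSpace ℝ (Fin 3)

/-! ### Distributions on an open set and their elementary operations -/

/-- `C_c^∞(Ω)`: smooth complex functions with compact support contained in `Ω`. -/
def TestSpace (Ω : TopologicalSpace.Opens E3) : Submodule ℂ (E3 → ℂ) where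
  carrier := {φ | ContDiff ℝ ∞ φ ∧ HasCompactSupport φ ∧ tsupport φ ⊆ Ω}
  zero_mem' := by
    refine ⟨contDiff_const, HasCompactSupport.zero, ?_⟩
    simp [tsupport]
  add_mem' := by
    rintro φ ψ ⟨h1, h2, h3⟩ ⟨k1, k2, k3⟩
    exact ⟨h1.add k1, h2.add k2, (tsupport_add φ ψ).trans (union_subset h3 k3)⟩
  smul_mem' := by
    rintro c φ ⟨h1, h2, h3⟩
    refine ⟨contDiff_const.smul h1, h2.smul_left (f := fun _ => c), ?_⟩
    exact (tsupport_smul_subset_right (fun _ => c) φ).trans h3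

/-- Linear functionals on `C_c^∞(Ω)`. Only functionals given by locally integrable functions, and
their images under differential operators, are used below, so no continuity is imposed. -/
abbrev Distr (Ω : TopologicalSpace.Opens E3) := Module.Dual ℂ (TestSpace Ω)

/-- The partial derivative `∂_j` on test functions. -/
def pdTest (Ω : TopologicalSpace.Opens E3) (j : Fin 3) : TestSpace Ω →ₗ[ℂ] TestSpace Ω where
  toFun φ := ⟨fun x => fderiv ℝ (φ : E3 → ℂ) x (EuclideanSpace.single j 1), by
    obtain ⟨φ, h1, h2, h3⟩ := φ
    refine ⟨(h1.fderiv_right (m := ∞) (by simp)).clm_apply contDiff_const, ?_, ?_⟩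
    · exact h2.fderiv_apply (𝕜 := ℝ) _
    · exact (tsupport_fderiv_apply_subset ℝ _).trans h3⟩
  map_add' φ ψ := by
    obtain ⟨φ, h1, h2, h3⟩ := φ
    obtain ⟨ψ, k1, k2, k3⟩ := ψ
    ext x
    have := fderiv_add (h1.differentiable (by simp) x) (k1.differentiable (by simp) x)
    simp [this]
  map_smul' c φ := by
    obtain ⟨φ, h1, h2, h3⟩ := φ
    ext x
    have := fderiv_const_smul (h1.differentiable (by simp) x) c
    simp [this]

/-- Multiplication of test functions on `Ω` by a function that is smooth on `Ω`. -/
def mulTest (Ω : TopologicalSpace.Opens E3) (f : E3 → ℂ) (hf : ContDiffOn ℝ ∞ f Ω) :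
    TestSpace Ω →ₗ[ℂ] TestSpace Ω where
  toFun φ := ⟨fun x => f x * (φ : E3 → ℂ) x, by
    obtain ⟨φ, h1, h2, h3⟩ := φ
    refine ⟨?_, h2.mul_left, (tsupport_mul_subset_right (f := f)).trans h3⟩
    refine contDiff_iff_contDiffAt.2 fun x => ?_
    by_cases hx : x ∈ Ω
    · exact (hf.contDiffAt (Ω.isOpen.mem_nhds hx)).mul h1.contDiffAt
    · have hx' : x ∉ tsupport φ := fun h => hx (h3 h)
      have : (fun x => f x * φ x) =ᶠ[𝓝 x] fun _ => 0 := by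
        filter_upwards [notMem_tsupport_iff_eventuallyEq.1 hx'] with y hy
        simp [hy]
      exact contDiffAt_const.congr_of_eventuallyEq this⟩
  map_add' φ ψ := by ext x; simp [mul_add]
  map_smul' c φ := by ext x; simp [mul_left_comm]

/-- The distributional derivative: `(∂_j T)(φ) = -T(∂_j φ)`. -/
def pd (Ω : TopologicalSpace.Opens E3) (j : Fin 3) : Module.End ℂ (Distr Ω) :=
  -(pdTest Ω j).dualMap

open Classical in
/-- Multiplication by a function `f` smooth on `Ω`: `(f T)(φ) = T(f φ)`. -/
def mulOp (Ω : TopologicalSpace.Opens E3) (f : E3 → ℂ) : Module.End ℂ (Distr Ω) :=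
  if hf : ContDiffOn ℝ ∞ f Ω then (mulTest Ω f hf).dualMap else 0

/-- `∂^α = ∂_x^{α₀} ∂_y^{α₁} ∂_z^{α₂}` on distributions. -/
def pdAlpha (Ω : TopologicalSpace.Opens E3) (α : Fin 3 → ℕ) : Module.End ℂ (Distr Ω) :=
  pd Ω 0 ^ α 0 * pd Ω 1 ^ α 1 * pd Ω 2 ^ α 2

/-- The multi-indices `α ∈ ℕ³` with `|α| ≤ k`. -/
def multiIdx (k : ℕ) : Finset (Fin 3 → ℕ) :=
  (Fintype.piFinset fun _ => Finset.range (k + 1)).filter fun α => ∑ i, α i ≤ k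

/-- The distribution `T` is the locally integrable function `g`. -/
def RepBy {Ω : TopologicalSpace.Opens E3} (T : Distr Ω) (g : E3 → ℂ) : Prop :=
  LocallyIntegrableOn g Ω ∧ ∀ φ : TestSpace Ω, T φ = ∫ x in (Ω : Set E3), g x * (φ : E3 → ℂ) x

theorem integrable_mul_test {Ω : TopologicalSpace.Opens E3} {g : E3 → ℂ}
    (hg : LocallyIntegrableOn g Ω) (φ : TestSpace Ω) :
    Integrable (fun x => g x * (φ : E3 → ℂ) x) (volume.restrict (Ω : Set E3)) := by
  obtain ⟨φ, h1, h2, h3⟩ := φ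
  have hK : IntegrableOn g (tsupport φ) := hg.integrableOn_compact_subset h3 h2
  have h4 : IntegrableOn (fun x => g x * φ x) (tsupport φ) :=
    hK.mul_continuousOn h1.continuous.continuousOn h2
  have h5 : Integrable (fun x => g x * φ x) := by
    refine (integrableOn_iff_integrable_of_support_subset ?_).1 h4
    intro x hx
    refine subset_tsupport φ ?_
    intro h
    exact hx (by simp [h])
  exact h5.integrableOn

theorem RepBy.add {Ω : TopologicalSpace.Opens E3} {T S : Distr Ω} {g h : E3 → ℂ}
    (hT : RepBy T g) (hS : RepBy S h) : RepBy (T + S) (fun x => g x + h x) := by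
  refine ⟨hT.1.add hS.1, fun φ => ?_⟩
  simp only [LinearMap.add_apply, hT.2 φ, hS.2 φ, add_mul]
  rw [integral_add (integrable_mul_test hT.1 φ) (integrable_mul_test hS.1 φ)]

theorem RepBy.smul {Ω : TopologicalSpace.Opens E3} {T : Distr Ω} {g : E3 → ℂ} (c : ℂ)
    (hT : RepBy T g) : RepBy (c • T) (fun x => c * g x) := by
  refine ⟨hT.1.smul c, fun φ => ?_⟩
  simp only [LinearMap.smul_apply, hT.2 φ, smul_eq_mul, mul_assoc]
  rw [integral_const_mul]

theorem RepBy.unique {Ω : TopologicalSpace.Opens E3} {T : Distr Ω} {g h : E3 → ℂ}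
    (hg : RepBy T g) (hh : RepBy T h) : g =ᵐ[volume.restrict (Ω : Set E3)] h := by
  have key := Ω.isOpen.ae_eq_zero_of_integral_contDiff_smul_eq_zero (μ := (volume : Measure E3))
    (f := fun x => g x - h x) (hg.1.sub hh.1) ?_
  · rw [Filter.EventuallyEq, ae_restrict_iff' Ω.isOpen.measurableSet]
    filter_upwards [key] with x hx hxΩ
    exact sub_eq_zero.1 (hx hxΩ)
  · intro φ h1 h2 h3
    have hsub : tsupport (fun x => (φ x : ℂ)) ⊆ tsupport φ :=
      closure_mono fun x hx h => hx (by simp [h])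
    let Φ : TestSpace Ω := ⟨fun x => (φ x : ℂ), Complex.ofRealCLM.contDiff.comp h1,
      h2.comp_left (g := fun t : ℝ => (t : ℂ)) (by simp), hsub.trans h3⟩
    have e1 := (hg.2 Φ).symm.trans (hh.2 Φ)
    have e2 : ∫ x in (Ω : Set E3), (g x - h x) * (φ x : ℂ) = 0 := by
      simp only [sub_mul]
      rw [integral_sub (integrable_mul_test hg.1 Φ) (integrable_mul_test hh.1 Φ)]
      exact sub_eq_zero.2 e1
    rw [← e2, setIntegral_eq_integral_of_forall_compl_eq_zero]
    · refine integral_congr_ae (Filter.Eventually.of_forall fun x => ?_)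
      simp [mul_comm]
    · intro x hx
      have : φ x = 0 := image_eq_zero_of_notMem_tsupport fun hh => hx (h3 hh)
      simp [this]

/-! ### Weighted Sobolev spaces -/

/-- The function `w^{|α| - a} g`. -/
def weighted (w : E3 → ℝ) (a : ℝ) (α : Fin 3 → ℕ) (g : E3 → ℂ) : E3 → ℂ :=
  fun x => ((w x ^ (((∑ i, α i : ℕ) : ℝ) - a) : ℝ) : ℂ) * g x

/-- The set `{u : w^{|α|-a} ∂^α u ∈ L²(Ω) for all |α| ≤ k}`, derivatives being taken in the sense of
distributions. -/
def kondSubmodule (Ω : TopologicalSpace.Opens E3) (w : E3 → ℝ) (k : ℕ) (a : ℝ) :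
    Submodule ℂ (Distr Ω) where
  carrier := {u | ∀ α ∈ multiIdx k, ∃ g, RepBy (pdAlpha Ω α u) g ∧
    MemLp (weighted w a α g) 2 (volume.restrict (Ω : Set E3))}
  zero_mem' := by
    intro α _
    have h0 : RepBy (pdAlpha Ω α 0) (fun _ => 0) := by
      refine ⟨(locallyIntegrable_const 0).locallyIntegrableOn _, fun φ => ?_⟩
      simp
    have h1 : weighted w a α (fun _ => 0) = fun _ => 0 := by
      ext x; simp [weighted]
    refine ⟨fun _ => 0, h0, ?_⟩
    rw [h1]
    exact MemLp.zero'
  add_mem' := by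
    intro u v hu hv α hα
    obtain ⟨g, hg, hg'⟩ := hu α hα
    obtain ⟨h, hh, hh'⟩ := hv α hα
    refine ⟨_, by simpa using hg.add hh, ?_⟩
    have : weighted w a α (fun x => g x + h x) = weighted w a α g + weighted w a α h := by
      ext x; simp [weighted, mul_add]
    rw [this]
    exact hg'.add hh'
  smul_mem' := by
    intro c u hu α hα
    obtain ⟨g, hg, hg'⟩ := hu α hα
    refine ⟨_, by simpa using hg.smul c, ?_⟩
    have : weighted w a α (fun x => c * g x) = c • weighted w a α g := by
      ext x; simp [weighted, mul_left_comm]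
    rw [this]
    exact hg'.const_smul c

/-- The Babuška–Kondratiev space `𝒦^k_a(Ω; w)` with weight `w`. -/
def Kond (Ω : TopologicalSpace.Opens E3) (w : E3 → ℝ) (k : ℕ) (a : ℝ) : Type :=
  kondSubmodule Ω w k a

namespace Kond

variable {Ω : TopologicalSpace.Opens E3} {w : E3 → ℝ} {k : ℕ} {a : ℝ}

instance : AddCommGroup (Kond Ω w k a) := inferInstanceAs (AddCommGroup (kondSubmodule Ω w k a))

instance : Module ℂ (Kond Ω w k a) := inferInstanceAs (Module ℂ (kondSubmodule Ω w k a))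

/-- An element of `𝒦^k_a(Ω; w)` as a distribution. -/
def toDistr : Kond Ω w k a →ₗ[ℂ] Distr Ω := (kondSubmodule Ω w k a).subtype

/-- The locally integrable function `∂^α u`, for `|α| ≤ k`. -/
def deriv (u : Kond Ω w k a) (α : multiIdx k) : E3 → ℂ := (u.2 α.1 α.2).choose

theorem deriv_repBy (u : Kond Ω w k a) (α : multiIdx k) :
    RepBy (pdAlpha Ω α (toDistr u)) (deriv u α) := (u.2 α.1 α.2).choose_spec.1

theorem deriv_memLp (u : Kond Ω w k a) (α : multiIdx k) :
    MemLp (weighted w a α (deriv u α)) 2 (volume.restrict (Ω : Set E3)) :=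
  (u.2 α.1 α.2).choose_spec.2

/-- The map `u ↦ (w^{|α|-a} ∂^α u)_{|α| ≤ k}` into a finite `ℓ²`-sum of copies of `L²(Ω)`. -/
def jet : Kond Ω w k a →ₗ[ℂ]
    PiLp 2 (fun _ : multiIdx k => Lp ℂ 2 (volume.restrict (Ω : Set E3))) where
  toFun u := WithLp.toLp 2 fun α => (deriv_memLp u α).toLp _
  map_add' u v := by
    ext1 α
    simp only [PiLp.add_apply]
    rw [← MemLp.toLp_add, MemLp.toLp_eq_toLp_iff]
    have h := RepBy.unique (deriv_repBy (u + v) α)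
      (by simpa using (deriv_repBy u α).add (deriv_repBy v α))
    filter_upwards [h] with x hx
    simp [weighted, hx, mul_add]
  map_smul' c u := by
    ext1 α
    simp only [PiLp.smul_apply, RingHom.id_apply]
    rw [← MemLp.toLp_const_smul, MemLp.toLp_eq_toLp_iff]
    have h := RepBy.unique (deriv_repBy (c • u) α)
      (by simpa using (deriv_repBy u α).smul c)
    filter_upwards [h] with x hx
    simp [weighted, hx, mul_left_comm]

/-- `‖u‖² = ∑_{|α| ≤ k} ‖w^{|α|-a} ∂^α u‖²_{L²(Ω)}`; a norm as soon as `w > 0` on `Ω`. -/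
instance : SeminormedAddCommGroup (Kond Ω w k a) :=
  SeminormedAddCommGroup.induced (Kond Ω w k a)
    (PiLp 2 (fun _ : multiIdx k => Lp ℂ 2 (volume.restrict (Ω : Set E3)))) jet

instance : NormedSpace ℂ (Kond Ω w k a) :=
  NormedSpace.induced ℂ (Kond Ω w k a)
    (PiLp 2 (fun _ : multiIdx k => Lp ℂ 2 (volume.restrict (Ω : Set E3)))) jet

end Kond

/-! ### Polygons and polyhedral domains -/

/-- The closed segment with the given pair of end points. -/
def seg (e : E3 × E3) : Set E3 := segment ℝ e.1 e.2

/-- `D` is a polygon, contained in an affine plane, whose sides are the segments `seg (e i)`,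
`i ∈ s`. Since `D` is relatively open in the closed plane, its relative boundary is
`closure D \ D`. -/
def IsPolygon {ι : Type} (D : Set E3) (s : Finset ι) (e : ι → E3 × E3) : Prop :=
  ∃ Q : AffineSubspace ℝ E3,
    -- `D` is an open connected subset of the plane `Q`
    Module.finrank ℝ Q.direction = 2 ∧ D ⊆ Q ∧ (∃ U : Set E3, IsOpen U ∧ D = U ∩ Q) ∧
    IsConnected D ∧
    -- its boundary is the union of the sides
    closure D \ D = ⋃ i ∈ s, seg (e i) ∧
    -- no boundary point is interior to the closure of `D` in the plane
    (∀ x ∈ closure D \ D, ∀ U : Set E3, IsOpen U → x ∈ U → ∃ y ∈ U ∩ Q, y ∉ closure D) ∧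
    -- distinct sides have at most end points in common
    (∀ i ∈ s, ∀ i' ∈ s, i ≠ i' →
      seg (e i) ∩ seg (e i') ⊆ {(e i).1, (e i).2} ∩ {(e i').1, (e i').2}) ∧
    -- each vertex belongs to exactly two sides
    (∀ i ∈ s, ∀ v, (v = (e i).1 ∨ v = (e i).2) → {i' | i' ∈ s ∧ v ∈ seg (e i')}.ncard = 2) ∧
    -- sides are maximally extended
    (∀ i ∈ s, ∀ x y, segment ℝ x y ⊆ closure D \ D → seg (e i) ⊆ segment ℝ x y →
      segment ℝ x y = seg (e i))

/-- A bounded polyhedral domain in `ℝ³`, with its faces and edges listed. All the edges of a bounded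
domain are compact segments; the order in which the end points of an edge are listed is
immaterial. -/
structure PolyhedralDomain where
  dom : TopologicalSpace.Opens E3
  isBounded : Bornology.IsBounded (dom : Set E3)
  isConnected : IsConnected (dom : Set E3)
  numFaces : ℕ
  numEdges : ℕ
  face : Fin numFaces → Set E3
  edge : Fin numEdges → E3 × E3
  sides : Fin numFaces → Finset (Fin numEdges)
  edge_ne : ∀ i, (edge i).1 ≠ (edge i).2
  seg_injective : Function.Injective fun i => seg (edge i)
  isPolygon : ∀ j, IsPolygon (face j) (sides j) edge
  disjoint_face : Pairwise fun j j' => Disjoint (face j) (face j')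
  frontier_eq : frontier (dom : Set E3) = ⋃ j, closure (face j)
  frontier_closure : frontier (closure (dom : Set E3)) = frontier (dom : Set E3)
  side_of_two : ∀ i, {j | i ∈ sides j}.ncard = 2

namespace PolyhedralDomain

variable (P : PolyhedralDomain)

open Classical in
/-- The vertices, that is, the end points of the edges. -/
def vertices : Finset E3 :=
  Finset.univ.image (fun i => (P.edge i).1) ∪ Finset.univ.image (fun i => (P.edge i).2)

/-- The distance to the line determined by the edge `e = [AB]`. -/
def lineDist (i : Fin P.numEdges) (p : E3) : ℝ :=
  Metric.infDist p (affineSpan ℝ {(P.edge i).1, (P.edge i).2} : AffineSubspace ℝ E3)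

/-- The angle `φ_{A,e}` at the first end point of the edge `e = [AB]`. -/
def phiA (i : Fin P.numEdges) (p : E3) : ℝ :=
  EuclideanGeometry.angle p (P.edge i).1 (P.edge i).2

/-- The angle `φ_{B,e}` at the second end point of the edge `e = [AB]`. -/
def phiB (i : Fin P.numEdges) (p : E3) : ℝ :=
  EuclideanGeometry.angle p (P.edge i).2 (P.edge i).1

/-- Orthonormal frames for the cylindrical coordinates around the edges: for a face `j` with side
`i`, `ν j i` is perpendicular to the edge and points into the face, and `n j i` is a unit
normal of the face. Also, for every edge, one of the two faces containing it is chosen. -/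
structure Frames where
  chosenFace : Fin P.numEdges → Fin P.numFaces
  mem_sides : ∀ i, i ∈ P.sides (chosenFace i)
  ν : Fin P.numFaces → Fin P.numEdges → E3
  n : Fin P.numFaces → Fin P.numEdges → E3
  norm_ν : ∀ j, ∀ i ∈ P.sides j, ‖ν j i‖ = 1
  norm_n : ∀ j, ∀ i ∈ P.sides j, ‖n j i‖ = 1
  inner_ν_n : ∀ j, ∀ i ∈ P.sides j, inner ℝ (ν j i) (n j i) = 0
  inner_edge_ν : ∀ j, ∀ i ∈ P.sides j, inner ℝ ((P.edge i).2 - (P.edge i).1) (ν j i) = 0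
  inner_edge_n : ∀ j, ∀ i ∈ P.sides j, inner ℝ ((P.edge i).2 - (P.edge i).1) (n j i) = 0
  into_face : ∀ j, ∀ i ∈ P.sides j, ∀ x ∈ openSegment ℝ (P.edge i).1 (P.edge i).2,
    ∀ᶠ s in 𝓝[>] (0 : ℝ), x + s • ν j i ∈ P.face j

variable {P}

/-- The cylindrical angle `θ ∈ [0, 2π)` around the edge `i`, with `θ = 0` on the half-plane bounded
by the line of `i` that contains the face `j` near `i`. -/
def Frames.theta (F : P.Frames) (j : Fin P.numFaces) (i : Fin P.numEdges) (p : E3) : ℝ :=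
  let t := Complex.arg ⟨inner ℝ (p - (P.edge i).1) (F.ν j i), inner ℝ (p - (P.edge i).1) (F.n j i)⟩
  if 0 ≤ t then t else t + 2 * Real.pi

/-- The auxiliary cut-off functions and small parameters used to modify `φ`, `θ` and `r_e`. -/
structure Cutoffs (F : P.Frames) where
  (α δ ε ℓ : ℝ)
  (ψ₁ ψ₂ ψ₃ ψ₄ : ℝ → ℝ)
  δ_pos : 0 < δ
  δ_lt : 2 * δ < Real.pi
  /-- at each vertex, the sets `φ_{P,e} > π - 2δ` are pairwise disjoint -/
  δ_small : ∀ i i' A B B', i ≠ i' → (P.edge i = (A, B) ∨ P.edge i = (B, A)) →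
    (P.edge i' = (A, B') ∨ P.edge i' = (B', A)) → ∀ p ≠ A,
    ¬ (Real.pi - 2 * δ < EuclideanGeometry.angle p A B ∧
      Real.pi - 2 * δ < EuclideanGeometry.angle p A B')
  ψ₁_smooth : ContDiff ℝ ∞ ψ₁
  ψ₁_mapsTo : MapsTo ψ₁ (Icc 0 Real.pi) (Icc 0 (Real.pi - δ))
  ψ₁_mono : MonotoneOn ψ₁ (Icc 0 Real.pi)
  ψ₁_eq_id : ∀ x ∈ Icc 0 (Real.pi - 2 * δ), ψ₁ x = x
  ψ₁_eq_const : ∀ x ∈ Icc (Real.pi - δ) Real.pi, ψ₁ x = Real.pi - δ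
  ℓ_pos : 0 < ℓ
  /-- every edge has length at least `4ℓ` -/
  ℓ_le : ∀ i, 4 * ℓ ≤ dist (P.edge i).1 (P.edge i).2
  ψ₂_smooth : ContDiff ℝ ∞ ψ₂
  ψ₂_mapsTo : MapsTo ψ₂ (Ici 0) (Icc 0 1)
  ψ₂_anti : AntitoneOn ψ₂ (Ici 0)
  ψ₂_eq_one : ∀ x ∈ Icc 0 ℓ, ψ₂ x = 1
  ψ₂_eq_zero : ∀ x, 2 * ℓ ≤ x → ψ₂ x = 0
  α_pos : 0 < α
  α_lt : 2 * α < Real.pi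
  /-- `α` is so small that the domain does not meet the half-plane `θ_e = 0` inside the region
  `φ_{A,e}, φ_{B,e} ≤ 2α` around the edge `e = [AB]` -/
  α_small : ∀ i, ∀ p ∈ P.dom, P.phiA i p ≤ 2 * α → P.phiB i p ≤ 2 * α →
    F.theta (F.chosenFace i) i p ≠ 0
  ψ₃_smooth : ContDiff ℝ ∞ ψ₃
  ψ₃_mapsTo : MapsTo ψ₃ (Icc 0 Real.pi) (Icc 0 1)
  ψ₃_anti : AntitoneOn ψ₃ (Icc 0 Real.pi)
  ψ₃_eq_one : ∀ x ∈ Icc 0 α, ψ₃ x = 1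
  ψ₃_eq_zero : ∀ x ∈ Icc (2 * α) Real.pi, ψ₃ x = 0
  ε_pos : 0 < ε
  ε_lt : 2 * ε < Real.pi
  ψ₄_smooth : ContDiff ℝ ∞ ψ₄
  ψ₄_mapsTo : MapsTo ψ₄ (Icc 0 (2 * Real.pi)) (Icc 0 (2 * Real.pi))
  ψ₄_eq_id : ∀ x ∈ Icc (2 * ε) (2 * Real.pi - 2 * ε), ψ₄ x = x
  ψ₄_eq_zero : ∀ x ∈ Icc 0 ε ∪ Icc (2 * Real.pi - ε) (2 * Real.pi), ψ₄ x = 0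

variable (P) in
/-- The functions `r_e` and a finite list of angular functions `θ, φ`. -/
structure Coordinates where
  ι : Type
  [fintype : Fintype ι]
  rad : Fin P.numEdges → E3 → ℝ
  ang : ι → E3 → ℝ

attribute [instance] Coordinates.fintype

/-- The unmodified functions `r_e`, `θ_e`, `φ_{A,e}`, `φ_{B,e}`. -/
def Frames.plain (F : P.Frames) : P.Coordinates where
  ι := Fin P.numEdges ⊕ Fin P.numEdges ⊕ Fin P.numEdges
  rad := P.lineDist
  ang := Sum.elim (fun i => F.theta (F.chosenFace i) i) (Sum.elim P.phiA P.phiB)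

/-- The modified functions: `φ_{A,e}` becomes `ψ₁(φ_{A,e}) ψ₂(ρ_A)`; `θ_e` is replaced by
`ψ₃(φ_{A,e}) ψ₃(φ_{B,e}) ψ₂(r_e) θ_e` and by the functions
`ψ₄(θ_e) ψ₄(2φ_{A,e}) ψ₄(2φ_{B,e})` for both faces through `e`; and `r_e` becomes
`ψ₃(φ_{A,e}) ψ₃(φ_{B,e}) r_e + (1 - ψ₃(φ_{A,e})) ρ_A + (1 - ψ₃(φ_{B,e})) ρ_B`. -/
def Cutoffs.modified {F : P.Frames} (χ : Cutoffs F) : P.Coordinates where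
  ι := Fin P.numEdges ⊕ {x : Fin P.numFaces × Fin P.numEdges // x.2 ∈ P.sides x.1} ⊕
    Fin P.numEdges ⊕ Fin P.numEdges
  rad i p := χ.ψ₃ (P.phiA i p) * χ.ψ₃ (P.phiB i p) * P.lineDist i p +
    (1 - χ.ψ₃ (P.phiA i p)) * dist p (P.edge i).1 + (1 - χ.ψ₃ (P.phiB i p)) * dist p (P.edge i).2
  ang := Sum.elim
    (fun i p => χ.ψ₃ (P.phiA i p) * χ.ψ₃ (P.phiB i p) * χ.ψ₂ (P.lineDist i p) *
      F.theta (F.chosenFace i) i p) <| Sum.elim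
    (fun x p => χ.ψ₄ (F.theta x.1.1 x.1.2 p) * χ.ψ₄ (2 * P.phiA x.1.2 p) *
      χ.ψ₄ (2 * P.phiB x.1.2 p)) <| Sum.elim
    (fun i p => χ.ψ₁ (P.phiA i p) * χ.ψ₂ (dist p (P.edge i).1))
    (fun i p => χ.ψ₁ (P.phiB i p) * χ.ψ₂ (dist p (P.edge i).2))

/-- The coordinate functions used on `P`: the plain ones if `P` is convex, and the modified ones,
for any choice of the auxiliary data, in general. -/
inductive Coordinates.IsAdmissible : P.Coordinates → Prop
  | plain (F : P.Frames) (h : Convex ℝ (P.dom : Set E3)) : IsAdmissible F.plain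
  | modified (F : P.Frames) (χ : Cutoffs F) : IsAdmissible χ.modified

variable (C : P.Coordinates)

/-- The weight `r_P = ∏_e (r_e / (ρ_A ρ_B)) ∏_v ρ_v`. -/
def Coordinates.rP (p : E3) : ℝ :=
  (∏ i, C.rad i p / (dist p (P.edge i).1 * dist p (P.edge i).2)) * ∏ v ∈ P.vertices, dist p v

/-- `C^∞(ΣP)`: the functions `u : P → ℂ` such that, for every `k`, `u(p) = f(p, θ(p), φ(p))` on `P`
where `f` has `k` bounded derivatives. -/
def Coordinates.smoothSigma : Set (E3 → ℂ) :=
  {u | ∀ k : ℕ, ∃ f : E3 × (C.ι → ℝ) → ℂ,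
    ContDiffOn ℝ k f ((P.dom : Set E3) ×ˢ univ) ∧
    (∃ M : ℝ, ∀ i ≤ k, ∀ z ∈ (P.dom : Set E3) ×ˢ (univ : Set (C.ι → ℝ)),
      ‖iteratedFDeriv ℝ i f z‖ ≤ M) ∧
    ∀ p ∈ P.dom, u p = f (p, fun c => C.ang c p)}

/-- The vector field `r_P ∂_j`. -/
def Coordinates.rD (j : Fin 3) : Module.End ℂ (Distr P.dom) :=
  mulOp P.dom (fun p => (C.rP p : ℂ)) * pd P.dom j

/-- `Diff^m(P)`: the linear span of the operators `u (r_P ∂_x)^{α₀} (r_P ∂_y)^{α₁} (r_P ∂_z)^{α₂}`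
with `u ∈ C^∞(ΣP)` and `|α| ≤ m`. -/
def Coordinates.diffOp (m : ℕ) : Submodule ℂ (Module.End ℂ (Distr P.dom)) :=
  Submodule.span ℂ {A | ∃ u ∈ C.smoothSigma, ∃ α ∈ multiIdx m,
    A = mulOp P.dom u * (C.rD 0 ^ α 0 * C.rD 1 ^ α 1 * C.rD 2 ^ α 2)}

/-- The conjugate `r_P^{-lam} A r_P^{lam}`. -/
def Coordinates.conj (A : Module.End ℂ (Distr P.dom)) (lam : ℝ) : Module.End ℂ (Distr P.dom) :=
  mulOp P.dom (fun p => ((C.rP p ^ (-lam) : ℝ) : ℂ)) * A *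
    mulOp P.dom (fun p => ((C.rP p ^ lam : ℝ) : ℂ))

/-- The space `𝒦^k_a(P)`. -/
abbrev Coordinates.K (k : ℕ) (a : ℝ) : Type := Kond P.dom C.rP k a

variable (P) in
/-- `A = ∑_{|α| ≤ m} c_α ∂^α`, where all the `c_α` are smooth on `P` with bounded derivatives of all
orders (for instance, restrictions of functions smooth on a neighbourhood of the closure). -/
def IsSmoothDiffOp (m : ℕ) (A : Module.End ℂ (Distr P.dom)) : Prop :=
  ∃ c : (Fin 3 → ℕ) → E3 → ℂ,
    (∀ α ∈ multiIdx m, ContDiffOn ℝ ∞ (c α) P.dom ∧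
      ∀ i : ℕ, ∃ M : ℝ, ∀ p ∈ P.dom, ‖iteratedFDeriv ℝ i (c α) p‖ ≤ M) ∧
    A = ∑ α ∈ multiIdx m, mulOp P.dom (c α) * pdAlpha P.dom α

end PolyhedralDomain

end Kondratiev

end

namespace Kondratiev

section Symbols

variable {E F G H : Type*} [NormedAddCommGroup E] [NormedSpace ℝ E] [NormedAddCommGroup F]
  [NormedSpace ℝ F] [NormedAddCommGroup G] [NormedSpace ℝ G] [NormedAddCommGroup H]
  [NormedSpace ℝ H]

/-! ### Symbol estimates -/

/-! Write `w` for the weight `r_P`. Everything rests on symbol estimates: a function `f` is a symbol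
of order `b` if `|D^n f| ≤ C_n w^(b-n)` on the domain for all `n`. The analytic half assumes only
that `w` is positive, bounded and a symbol of order 1 (`IsWeight`); the geometric half shows that
`r_P` is such a weight and that all angular functions are symbols of order 0.

Analysis. By Leibniz's rule and induction on `k`, multiplication by a symbol of order `b` maps
`𝒦^k_a` boundedly into `𝒦^k_{a+b}` (`IsSymb.isBddOp`), while `∂_j` maps `𝒦^{k+1}_a` into
`𝒦^k_{a-1}`. Conjugation by powers of `w` is multiplicative, fixes multiplication operators, and
sends `∂_j` to `∂_j + λ w⁻¹ ∂_j w` (`conjBy_pd`). The second term is `λ` times a fixed operator,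
bounded because `w⁻¹ ∂_j w` has order -1, so the family is continuous in norm. Continuous families
are closed under sums and products. Functions in `C^∞(ΣP)` have order 0 by the chain rule, which
covers `Diff^m`. A coefficient `c_α` with bounded derivatives has every order `b ≤ 0`, because `w`
is bounded; taking `b = |α| - m` makes each term of `P` lower the weight by exactly `m`. The value
`λ = 0` gives the operator itself.

Geometry. Distances to vertices and to lines satisfy symbol estimates at their own scale, and angles
about an edge do so at the scale of the distance to its line. Estimates at a scale `d` imply
estimates at any scale bounded by a multiple of `d` (`SymbolOn.rescale`), so it suffices that `r_P`
is bounded by multiples of every `ρ_A` and every `r_e` (`exists_rP_le_dist`, `exists_rP_le_rad`). A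
convex domain meets neither the lines of its edges nor the planes of its faces, hence the plain
functions are smooth. Otherwise the domain may cross the line of an edge beyond its end points,
where the angles are singular but the weight need not be small. The cut-offs make the functions
locally constant there, and where they are not, the modified `r_e` is bounded by a multiple of the
distance to the line (`exists_modRad_le_distLine`). -/

theorem exists_isOpen_contDiffOn {f : E → F} {x : E} {n : ℕ} (hf : ContDiffAt ℝ n f x) :
    ∃ u, IsOpen u ∧ x ∈ u ∧ ContDiffOn ℝ n f u := by
  obtain ⟨u, hu, h⟩ := hf.contDiffOn le_rfl (by simp)
  obtain ⟨v, hvu, hv, hxv⟩ := mem_nhds_iff.1 hu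
  exact ⟨v, hv, hxv, h.mono hvu⟩

/-- Faà di Bruno's bound on open neighbourhoods, where derivatives within the set are ordinary ones;
only estimates at the single point `x` enter. -/
theorem norm_iteratedFDeriv_comp_le_at {g : F → G} {f : E → F} {n : ℕ} {x : E}
    (hg : ContDiffAt ℝ n g (f x)) (hf : ContDiffAt ℝ n f x) {C D : ℝ}
    (hC : ∀ i ≤ n, ‖iteratedFDeriv ℝ i g (f x)‖ ≤ C)
    (hD : ∀ i, 1 ≤ i → i ≤ n → ‖iteratedFDeriv ℝ i f x‖ ≤ D ^ i) :
    ‖iteratedFDeriv ℝ n (fun y => g (f y)) x‖ ≤ n.factorial * C * D ^ n := by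
  obtain ⟨u, hu, hxu, hfu⟩ := exists_isOpen_contDiffOn hf
  obtain ⟨t, ht, hxt, hgt⟩ := exists_isOpen_contDiffOn hg
  have hs : IsOpen (u ∩ f ⁻¹' t) := hfu.continuousOn.isOpen_inter_preimage hu ht
  have hx : x ∈ u ∩ f ⁻¹' t := ⟨hxu, hxt⟩
  have h := norm_iteratedFDerivWithin_comp_le (n := n) hgt (hfu.mono inter_subset_left) le_rfl
    ht.uniqueDiffOn hs.uniqueDiffOn (fun y hy => hy.2) hx (C := C) (D := D)
    (fun i hi => by rw [iteratedFDerivWithin_of_isOpen i ht hxt]; exact hC i hi)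
    (fun i hi hi' => by rw [iteratedFDerivWithin_of_isOpen i hs hx]; exact hD i hi hi')
  rwa [iteratedFDerivWithin_of_isOpen n hs hx] at h

theorem norm_iteratedFDeriv_le_of_bilinear_at (B : F →L[ℝ] G →L[ℝ] H) {f : E → F} {g : E → G}
    {n : ℕ} {x : E} (hf : ContDiffAt ℝ n f x) (hg : ContDiffAt ℝ n g x) :
    ‖iteratedFDeriv ℝ n (fun y => B (f y) (g y)) x‖ ≤ ‖B‖ * ∑ i ∈ Finset.range (n + 1),
      (n.choose i : ℝ) * ‖iteratedFDeriv ℝ i f x‖ * ‖iteratedFDeriv ℝ (n - i) g x‖ := by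
  obtain ⟨u, hu, hxu, hfu⟩ := exists_isOpen_contDiffOn hf
  obtain ⟨t, ht, hxt, hgt⟩ := exists_isOpen_contDiffOn hg
  have hs : IsOpen (u ∩ t) := hu.inter ht
  have hx : x ∈ u ∩ t := ⟨hxu, hxt⟩
  have h := B.norm_iteratedFDerivWithin_le_of_bilinear (n := n) (hfu.mono inter_subset_left)
    (hgt.mono inter_subset_right) hs.uniqueDiffOn hx le_rfl
  rw [iteratedFDerivWithin_of_isOpen n hs hx] at h
  refine h.trans_eq ?_
  congr 1
  refine Finset.sum_congr rfl fun i _ => ?_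
  rw [iteratedFDerivWithin_of_isOpen i hs hx, iteratedFDerivWithin_of_isOpen (n - i) hs hx]

/-- `f` is smooth at the points of `S`, where it satisfies `|D^n f| ≤ M_n m d^{-n}` for all `n`. -/
def SymbolOn (S : Set E) (m d : E → ℝ) (f : E → F) : Prop :=
  (∀ x ∈ S, ContDiffAt ℝ ∞ f x) ∧
    ∀ n : ℕ, ∃ M : ℝ, 0 ≤ M ∧ ∀ x ∈ S, ‖iteratedFDeriv ℝ n f x‖ * d x ^ n ≤ M * m x

namespace SymbolOn

variable {S T : Set E} {m m' d d' : E → ℝ} {f g : E → F}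

theorem mono_set (hf : SymbolOn S m d f) (hT : T ⊆ S) : SymbolOn T m d f :=
  ⟨fun x hx => hf.1 x (hT hx), fun n => by
    obtain ⟨M, hM, h⟩ := hf.2 n
    exact ⟨M, hM, fun x hx => h x (hT hx)⟩⟩

/-- The derivatives are ordinary ones at each point, so the pieces need not be open and the two
constants simply add. This permits cutting a domain into closed and open angular regions and
estimating on each. -/
theorem union (hf : SymbolOn S m d f) (hg : SymbolOn T m d f) (hm : ∀ x ∈ S ∪ T, 0 ≤ m x) :
    SymbolOn (S ∪ T) m d f := by
  refine ⟨fun x hx => hx.elim (hf.1 x) (hg.1 x), fun n => ?_⟩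
  obtain ⟨M, hM, h⟩ := hf.2 n
  obtain ⟨N, hN, h'⟩ := hg.2 n
  refine ⟨M + N, by positivity, fun x hx => ?_⟩
  have := hm x hx
  rcases hx with hx | hx
  · nlinarith [h x hx, mul_nonneg hN this]
  · nlinarith [h' x hx, mul_nonneg hM this]

theorem congr (hf : SymbolOn S m d f) (h : ∀ x ∈ S, g =ᶠ[𝓝 x] f) : SymbolOn S m d g := by
  refine ⟨fun x hx => (hf.1 x hx).congr_of_eventuallyEq (h x hx), fun n => ?_⟩
  obtain ⟨M, hM, h'⟩ := hf.2 n
  refine ⟨M, hM, fun x hx => ?_⟩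
  rw [((h x hx).iteratedFDeriv ℝ n).eq_of_nhds]
  exact h' x hx

theorem const (c : F) {C : ℝ} (hC : 0 ≤ C) (hc : ∀ x ∈ S, ‖c‖ ≤ C * m x) (hm : ∀ x ∈ S, 0 ≤ m x) :
    SymbolOn S m d (fun _ => c) := by
  refine ⟨fun x _ => contDiffAt_const, fun n => ⟨C, hC, fun x hx => ?_⟩⟩
  rcases n with _ | n
  · simpa using hc x hx
  · have := hm x hx
    simp only [iteratedFDeriv_succ_const, Pi.zero_apply, norm_zero, zero_mul]
    positivity

theorem zero_of_eventuallyEq (h : ∀ x ∈ S, f =ᶠ[𝓝 x] fun _ => 0) (hm : ∀ x ∈ S, 0 ≤ m x) :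
    SymbolOn S m d f :=
  (const (0 : F) le_rfl (by simp) hm).congr h

theorem add (hf : SymbolOn S m d f) (hg : SymbolOn S m d g) (hd : ∀ x ∈ S, 0 ≤ d x) :
    SymbolOn S m d (fun x => f x + g x) := by
  refine ⟨fun x hx => (hf.1 x hx).add (hg.1 x hx), fun n => ?_⟩
  obtain ⟨M, hM, h⟩ := hf.2 n
  obtain ⟨N, hN, h'⟩ := hg.2 n
  refine ⟨M + N, by positivity, fun x hx => ?_⟩
  rw [fun_iteratedFDeriv_add_apply ((hf.1 x hx).of_le (by exact_mod_cast le_top))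
    ((hg.1 x hx).of_le (by exact_mod_cast le_top)), add_mul]
  refine le_trans ?_ (add_le_add (h x hx) (h' x hx))
  rw [← add_mul]
  have := hd x hx
  gcongr
  exact norm_add_le _ _

theorem clm_comp (hf : SymbolOn S m d f) (L : F →L[ℝ] G) (hd : ∀ x ∈ S, 0 ≤ d x) :
    SymbolOn S m d (fun x => L (f x)) := by
  refine ⟨fun x hx => L.contDiff.contDiffAt.comp x (hf.1 x hx), fun n => ?_⟩
  obtain ⟨M, hM, h⟩ := hf.2 n
  refine ⟨‖L‖ * M, by positivity, fun x hx => ?_⟩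
  have h1 := L.norm_iteratedFDeriv_comp_left (n := n) (hf.1 x hx) (by exact_mod_cast le_top)
  have := hd x hx
  calc _ ≤ ‖L‖ * ‖iteratedFDeriv ℝ n f x‖ * d x ^ n := by gcongr; exact h1
    _ = ‖L‖ * (‖iteratedFDeriv ℝ n f x‖ * d x ^ n) := by ring
    _ ≤ ‖L‖ * (M * m x) := mul_le_mul_of_nonneg_left (h x hx) (by positivity)
    _ = _ := by ring

theorem bilinear (B : F →L[ℝ] G →L[ℝ] H) {g : E → G} (hf : SymbolOn S m d f)
    (hg : SymbolOn S m' d g) (hd : ∀ x ∈ S, 0 ≤ d x) :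
    SymbolOn S (fun x => m x * m' x) d (fun x => B (f x) (g x)) := by
  refine ⟨fun x hx => ContDiffAt.clm_apply (B.contDiff.contDiffAt.comp x (hf.1 x hx)) (hg.1 x hx),
    fun n => ?_⟩
  choose M hM h using hf.2
  choose N hN h' using hg.2
  refine ⟨‖B‖ * ∑ i ∈ Finset.range (n + 1), (n.choose i : ℝ) * (M i * N (n - i)),
    mul_nonneg B.opNorm_nonneg (Finset.sum_nonneg fun i _ =>
      mul_nonneg (by positivity) (mul_nonneg (hM _) (hN _))), fun x hx => ?_⟩
  have h1 := norm_iteratedFDeriv_le_of_bilinear_at B (n := n)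
    ((hf.1 x hx).of_le (by exact_mod_cast le_top)) ((hg.1 x hx).of_le (by exact_mod_cast le_top))
  have hdx := hd x hx
  refine (mul_le_mul_of_nonneg_right h1 (pow_nonneg hdx n)).trans ?_
  rw [mul_assoc, mul_assoc, Finset.sum_mul, Finset.sum_mul]
  refine mul_le_mul_of_nonneg_left (Finset.sum_le_sum fun i hi => ?_) B.opNorm_nonneg
  have e : d x ^ n = d x ^ i * d x ^ (n - i) := by
    rw [← pow_add, Nat.add_sub_cancel' (Nat.lt_succ_iff.1 (Finset.mem_range.1 hi))]
  calc _ = (n.choose i : ℝ) * ((‖iteratedFDeriv ℝ i f x‖ * d x ^ i) *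
        (‖iteratedFDeriv ℝ (n - i) g x‖ * d x ^ (n - i))) := by rw [e]; ring
    _ ≤ (n.choose i : ℝ) * ((M i * m x) * (N (n - i) * m' x)) := by
        have a1 := h i x hx
        exact mul_le_mul_of_nonneg_left (mul_le_mul a1 (h' _ x hx) (by positivity)
          (le_trans (by positivity) a1)) (by positivity)
    _ = _ := by ring

theorem mul {A : Type*} [NormedRing A] [NormedAlgebra ℝ A] {f g : E → A} (hf : SymbolOn S m d f)
    (hg : SymbolOn S m' d g) (hd : ∀ x ∈ S, 0 ≤ d x) :
    SymbolOn S (fun x => m x * m' x) d (fun x => f x * g x) :=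
  bilinear (ContinuousLinearMap.mul ℝ A) hf hg hd

theorem smul {f : E → ℝ} {g : E → F} (hf : SymbolOn S m d f)
    (hg : SymbolOn S m' d g) (hd : ∀ x ∈ S, 0 ≤ d x) :
    SymbolOn S (fun x => m x * m' x) d (fun x => f x • g x) :=
  bilinear (ContinuousLinearMap.lsmul ℝ ℝ) hf hg hd

theorem weaken {C : ℝ} (hf : SymbolOn S m d f) (hC : 0 ≤ C) (hm : ∀ x ∈ S, m x ≤ C * m' x) :
    SymbolOn S m' d f := by
  refine ⟨hf.1, fun n => ?_⟩
  obtain ⟨M, hM, h⟩ := hf.2 n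
  refine ⟨M * C, by positivity, fun x hx => (h x hx).trans ?_⟩
  rw [mul_assoc]
  exact mul_le_mul_of_nonneg_left (hm x hx) hM

/-- An estimate at scale `d` is the stronger the larger `d` is. Geometric estimates are proved at
the natural scale, the distance to a vertex or line, and transferred to `r_P` by this lemma. -/
theorem rescale {C : ℝ} (hf : SymbolOn S m d f) (hd' : ∀ x ∈ S, 0 ≤ d' x)
    (hd : ∀ x ∈ S, d' x ≤ C * d x) (hd0 : ∀ x ∈ S, 0 ≤ d x) : SymbolOn S m d' f := by
  refine ⟨hf.1, fun n => ?_⟩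
  obtain ⟨M, hM, h⟩ := hf.2 n
  refine ⟨|C| ^ n * M, by positivity, fun x hx => ?_⟩
  have h0 := hd0 x hx
  have h1 : d' x ^ n ≤ |C| ^ n * d x ^ n := by
    rw [← mul_pow]
    refine pow_le_pow_left₀ (hd' x hx) ((hd x hx).trans ?_) n
    exact mul_le_mul_of_nonneg_right (le_abs_self _) h0
  calc _ ≤ ‖iteratedFDeriv ℝ n f x‖ * (|C| ^ n * d x ^ n) := by gcongr
    _ = |C| ^ n * (‖iteratedFDeriv ℝ n f x‖ * d x ^ n) := by ring
    _ ≤ |C| ^ n * (M * m x) := mul_le_mul_of_nonneg_left (h x hx) (by positivity)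
    _ = _ := by ring

theorem fderiv (hf : SymbolOn S m d f) (hd : ∀ x ∈ S, 0 < d x) :
    SymbolOn S (fun x => m x / d x) d (fderiv ℝ f) := by
  refine ⟨fun x hx => (hf.1 x hx).fderiv_right (by simp), fun n => ?_⟩
  obtain ⟨M, hM, h⟩ := hf.2 (n + 1)
  refine ⟨M, hM, fun x hx => ?_⟩
  have := hd x hx
  rw [norm_iteratedFDeriv_fderiv, mul_div_assoc', le_div_iff₀ this, mul_assoc, ← pow_succ]
  exact h x hx

/-- Reduces a symbol estimate to the size of `f` and an estimate for its derivative. It serves the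
angles, which are transcendental but have derivatives that are algebraic in known symbols. -/
theorem of_fderiv {f' : E → E →L[ℝ] F} (hf : ∀ x ∈ S, ContDiffAt ℝ ∞ f x) {C : ℝ} (hC : 0 ≤ C)
    (hfm : ∀ x ∈ S, ‖f x‖ ≤ C * m x) (hd : ∀ x ∈ S, 0 < d x)
    (h : ∀ x ∈ S, _root_.fderiv ℝ f =ᶠ[𝓝 x] f')
    (hf' : SymbolOn S (fun x => m x / d x) d f') : SymbolOn S m d f := by
  refine ⟨hf, fun n => ?_⟩
  rcases n with _ | n
  · exact ⟨C, hC, fun x hx => by simpa using hfm x hx⟩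
  · obtain ⟨M, hM, h'⟩ := (hf'.congr h).2 n
    refine ⟨M, hM, fun x hx => ?_⟩
    have h1 := h' x hx
    have := hd x hx
    rwa [norm_iteratedFDeriv_fderiv, mul_div_assoc', le_div_iff₀ this, mul_assoc, ← pow_succ] at h1

/-- The derivatives of a symbol of order zero, rescaled to a form suitable for compositions. -/
theorem exists_pow_bound {m₀ : ℝ} (hf : SymbolOn S m d f) (hd : ∀ x ∈ S, 0 < d x)
    (hm₀ : 0 ≤ m₀) (hm : ∀ x ∈ S, m x ≤ m₀) (n : ℕ) :
    ∃ M : ℝ, 0 ≤ M ∧ ∀ x ∈ S, ∀ i, 1 ≤ i → i ≤ n →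
      ‖iteratedFDeriv ℝ i f x‖ ≤ (M / d x) ^ i := by
  choose M hM h using hf.2
  have hN : 0 ≤ ∑ i ∈ Finset.range (n + 1), M i * m₀ :=
    Finset.sum_nonneg fun i _ => mul_nonneg (hM i) hm₀
  -- The summand 1 makes the constant at least 1, so that its `i`-th power, `i ≥ 1`, dominates it.
  refine ⟨1 + ∑ i ∈ Finset.range (n + 1), M i * m₀, by positivity, fun x hx i hi hin => ?_⟩
  have hdx := hd x hx
  rw [div_pow, le_div_iff₀ (by positivity)]
  calc _ ≤ M i * m x := h i x hx
    _ ≤ M i * m₀ := mul_le_mul_of_nonneg_left (hm x hx) (hM i)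
    _ ≤ 1 + ∑ i ∈ Finset.range (n + 1), M i * m₀ := by
        have := Finset.single_le_sum (f := fun i => M i * m₀)
          (fun i _ => mul_nonneg (hM i) hm₀) (Finset.mem_range.2 (Nat.lt_succ_of_le hin))
        linarith
    _ ≤ _ := le_self_pow₀ (by linarith) (by omega)

/-- Each term of Faà di Bruno's formula contains derivatives of `f` of total order `n`, giving
`d^(-n)`; the derivatives of `g` are bounded on the compact set of values. -/
theorem comp {g : F → G} {K : Set F} (hf : SymbolOn S (fun _ => 1) d f) (hd : ∀ x ∈ S, 0 < d x)
    (hK : IsCompact K) (hfK : ∀ x ∈ S, f x ∈ K) (hg : ∀ y ∈ K, ContDiffAt ℝ ∞ g y) :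
    SymbolOn S (fun _ => 1) d (fun x => g (f x)) := by
  refine ⟨fun x hx => (hg _ (hfK x hx)).comp x (hf.1 x hx), fun n => ?_⟩
  have hB : ∀ i : ℕ, ∃ B : ℝ, ∀ y ∈ K, ‖iteratedFDeriv ℝ i g y‖ ≤ B := fun i =>
    hK.exists_bound_of_continuousOn fun y hy =>
      ((hg y hy).continuousAt_iteratedFDeriv (by exact_mod_cast le_top)).continuousWithinAt
  choose B hB using hB
  obtain ⟨M, hM, h⟩ := hf.exists_pow_bound hd zero_le_one (fun _ _ => le_rfl) n
  refine ⟨n.factorial * (∑ i ∈ Finset.range (n + 1), |B i|) * M ^ n, by positivity, fun x hx => ?_⟩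
  have hdx := hd x hx
  have h1 := norm_iteratedFDeriv_comp_le_at (n := n) ((hg _ (hfK x hx)).of_le
    (by exact_mod_cast le_top)) ((hf.1 x hx).of_le (by exact_mod_cast le_top))
    (C := ∑ i ∈ Finset.range (n + 1), |B i|) (D := M / d x)
    (fun i hi => ((hB i _ (hfK x hx)).trans (le_abs_self _)).trans
      (Finset.single_le_sum (f := fun i => |B i|) (fun i _ => abs_nonneg _)
        (Finset.mem_range.2 (Nat.lt_succ_of_le hi)))) (h x hx)
  rw [div_pow, mul_div_assoc', le_div_iff₀ (by positivity)] at h1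
  simpa using h1

theorem congr_fun (hf : SymbolOn S m d f) (hm : ∀ x ∈ S, m x = m' x) : SymbolOn S m' d f :=
  hf.weaken zero_le_one fun x hx => by rw [hm x hx, one_mul]

/-- Powers of a positive function that is a symbol with respect to itself. -/
theorem rpow {f : E → ℝ} (hf : SymbolOn S f d f) (hd : ∀ x ∈ S, 0 < d x) (hpos : ∀ x ∈ S, 0 < f x)
    (s : ℝ) : SymbolOn S (fun x => f x ^ s) d (fun x => f x ^ s) := by
  refine ⟨fun x hx => (hf.1 x hx).rpow_const_of_ne (hpos x hx).ne', fun n => ?_⟩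
  choose M hM h using hf.2
  set N := 1 + ∑ i ∈ Finset.range (n + 1), M i with hN
  have hN0 : 0 ≤ ∑ i ∈ Finset.range (n + 1), M i := Finset.sum_nonneg fun i _ => hM i
  set B := ∑ i ∈ Finset.range (n + 1), ‖iteratedFDeriv ℝ i (fun t : ℝ => t ^ s) 1‖
  refine ⟨n.factorial * B * N ^ n, by positivity, fun x hx => ?_⟩
  have hdx := hd x hx
  have hfx := hpos x hx
  have hfn : ContDiffAt ℝ n f x := (hf.1 x hx).of_le (by exact_mod_cast le_top)
  -- Dividing by the value `f x` moves the argument of the power to 1, where the derivatives of `t ^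
  -- s` are fixed numbers; homogeneity restores the factor `f x ^ s`.
  have hfc : ContDiffAt ℝ n (fun y => (f x)⁻¹ • f y) x := hfn.const_smul (f x)⁻¹
  have e1 : (f x)⁻¹ • f x = 1 := by simp [hfx.ne']
  have hgc : ContDiffAt ℝ n (fun t : ℝ => t ^ s) ((f x)⁻¹ • f x) := by
    rw [e1]
    exact Real.contDiffAt_rpow_const_of_ne one_ne_zero
  have h1 := norm_iteratedFDeriv_comp_le_at (f := fun y => (f x)⁻¹ • f y) (x := x) hgc hfc (C := B) (D := N / d x) (fun i hi => by
      rw [e1]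
      exact Finset.single_le_sum (f := fun i => ‖iteratedFDeriv ℝ i (fun t : ℝ => t ^ s) 1‖)
        (fun i _ => norm_nonneg _) (Finset.mem_range.2 (Nat.lt_succ_of_le hi))) (fun i hi hin => by
      rw [iteratedFDeriv_const_smul_apply' (hfn.of_le (by exact_mod_cast hin)),
        norm_smul, div_pow, le_div_iff₀ (by positivity), norm_inv, Real.norm_of_nonneg hfx.le,
        mul_assoc, inv_mul_le_iff₀ hfx]
      refine (h i x hx).trans ?_
      rw [mul_comm]
      refine mul_le_mul_of_nonneg_left ?_ hfx.le
      calc M i ≤ ∑ i ∈ Finset.range (n + 1), M i := Finset.single_le_sum (f := M)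
              (fun i _ => hM i) (Finset.mem_range.2 (Nat.lt_succ_of_le hin))
        _ ≤ N := by linarith
        _ ≤ N ^ i := le_self_pow₀ (by linarith) (by omega))
  have hgf : ContDiffAt ℝ n (fun y => ((f x)⁻¹ • f y) ^ s) x :=
    ContDiffAt.comp (g := fun t : ℝ => t ^ s) x hgc hfc
  have h2 : (fun y => f y ^ s) =ᶠ[𝓝 x] fun y => f x ^ s • ((f x)⁻¹ • f y) ^ s := by
    filter_upwards [(hf.1 x hx).continuousAt.eventually (lt_mem_nhds hfx)] with y hy
    simp only [smul_eq_mul]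
    rw [Real.mul_rpow (by positivity) hy.le, ← mul_assoc, ← Real.mul_rpow hfx.le (by positivity),
      mul_inv_cancel₀ hfx.ne', Real.one_rpow, one_mul]
  rw [(h2.iteratedFDeriv ℝ n).eq_of_nhds, iteratedFDeriv_const_smul_apply' hgf,
    norm_smul, Real.norm_of_nonneg (by positivity)]
  rw [div_pow, mul_div_assoc', le_div_iff₀ (by positivity)] at h1
  rw [mul_assoc, mul_comm]
  exact mul_le_mul_of_nonneg_right h1 (by positivity)

/-- Only the first derivative needs an argument: it is the constant `L`, and `‖L‖ d ≤ ‖L‖ C m`.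
Higher derivatives vanish. -/
theorem affine {L : E →L[ℝ] F} {c : F} {C : ℝ} (hC : 0 ≤ C) (hm : ∀ x ∈ S, 0 ≤ m x)
    (h0 : ∀ x ∈ S, ‖L x + c‖ ≤ C * m x)
    (h1 : ∀ x ∈ S, d x ≤ C * m x) : SymbolOn S m d (fun x => L x + c) := by
  refine ⟨fun x _ => (L.contDiff.add contDiff_const).contDiffAt, fun n => ?_⟩
  have e : _root_.fderiv ℝ (fun x => L x + c) = fun _ => L := by
    ext1 x
    rw [fderiv_add_const]
    exact L.fderiv
  refine ⟨C + ‖L‖ * C, by positivity, fun x hx => ?_⟩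
  have hmx := hm x hx
  rcases n with _ | _ | n
  · simp only [norm_iteratedFDeriv_zero, pow_zero, mul_one]
    have : 0 ≤ ‖L‖ * C * m x := by positivity
    linarith [h0 x hx]
  · rw [← norm_iteratedFDeriv_fderiv, e]
    simp only [norm_iteratedFDeriv_zero, zero_add, pow_one]
    have : 0 ≤ C * m x := by positivity
    nlinarith [mul_le_mul_of_nonneg_left (h1 x hx) (norm_nonneg L)]
  · rw [← norm_iteratedFDeriv_fderiv, e, iteratedFDeriv_succ_const]
    simp only [Pi.zero_apply, norm_zero, zero_mul]
    positivity

/-- The norm of an affine function, away from its zeros. -/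
theorem norm_affine {F : Type*} [NormedAddCommGroup F] [InnerProductSpace ℝ F] (L : E →L[ℝ] F)
    (c : F) (h : ∀ x ∈ S, L x + c ≠ 0) :
    SymbolOn S (fun x => ‖L x + c‖) (fun x => ‖L x + c‖) (fun x => ‖L x + c‖) := by
  have hpos : ∀ x ∈ S, 0 < ‖L x + c‖ := fun x hx => norm_pos_iff.2 (h x hx)
  have h1 : SymbolOn S (fun x => ‖L x + c‖) (fun x => ‖L x + c‖) (fun x => L x + c) :=
    affine zero_le_one (fun x _ => norm_nonneg _) (fun x _ => by rw [one_mul])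
      (fun x _ => by rw [one_mul])
  -- The norm is the power 1/2 of the inner square, which is a symbol with respect to itself.
  have h2 := (bilinear (innerSL ℝ) h1 h1 fun x _ => norm_nonneg _).congr_fun
    (m' := fun x => inner ℝ (L x + c) (L x + c))
    (fun x _ => (real_inner_self_eq_norm_mul_norm _).symm)
  have h3 := rpow h2 hpos (fun x hx => real_inner_self_pos.2 (h x hx)) (1 / 2)
  have e : ∀ v : F, (inner ℝ v v : ℝ) ^ (1 / 2 : ℝ) = ‖v‖ := fun v => by
    rw [← Real.sqrt_eq_rpow, norm_eq_sqrt_real_inner]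
  simpa only [innerSL_apply_apply, e] using h3

theorem prod {ι : Type*} (s : Finset ι) {f m : ι → E → ℝ} (hf : ∀ i ∈ s, SymbolOn S (m i) d (f i))
    (hd : ∀ x ∈ S, 0 ≤ d x) :
    SymbolOn S (fun x => ∏ i ∈ s, m i x) d (fun x => ∏ i ∈ s, f i x) := by
  classical
  induction s using Finset.induction_on with
  | empty =>
    simpa using const (S := S) (d := d) (m := fun _ => 1) (1 : ℝ) zero_le_one (by simp) (by simp)
  | insert i s hi ih =>
    simp only [Finset.prod_insert hi]
    exact mul (hf i (by simp)) (ih fun j hj => hf j (by simp [hj])) hd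

theorem pi {ι : Type*} [Fintype ι] {f : E → ι → ℝ}
    (hf : ∀ i, SymbolOn S m d (fun x => f x i)) (hd : ∀ x ∈ S, 0 ≤ d x) (hm : ∀ x ∈ S, 0 ≤ m x) :
    SymbolOn S m d f := by
  classical
  have e : f = fun x => ∑ i, ContinuousLinearMap.single ℝ (fun _ : ι => ℝ) i (f x i) := by
    ext1 x
    exact (Finset.univ_sum_single (f x)).symm
  rw [e]
  have : ∀ s : Finset ι, SymbolOn S m d
      (fun x => ∑ i ∈ s, ContinuousLinearMap.single ℝ (fun _ : ι => ℝ) i (f x i)) := by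
    intro s
    induction s using Finset.induction_on with
    | empty => simpa using const (S := S) (d := d) (m := m) (0 : ι → ℝ) le_rfl (by simp) hm
    | insert i s hi ih =>
      simp only [Finset.sum_insert hi]
      exact add (clm_comp (hf i) _ hd) ih hd
  exact this Finset.univ

theorem prodMk {g : E → G} (hf : SymbolOn S m d f) (hg : SymbolOn S m d g)
    (hd : ∀ x ∈ S, 0 ≤ d x) : SymbolOn S m d (fun x => (f x, g x)) := by
  have := add (clm_comp hf (ContinuousLinearMap.inl ℝ F G) hd)
    (clm_comp hg (ContinuousLinearMap.inr ℝ F G) hd) hd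
  simpa using this

end SymbolOn

end Symbols

/-! ### Multiplication operators and derivatives of distributions -/

section Distributions

variable {Ω : TopologicalSpace.Opens E3}

theorem mulOp_apply {f : E3 → ℂ} (hf : ContDiffOn ℝ ∞ f Ω) (T : Distr Ω) (φ : TestSpace Ω) :
    mulOp Ω f T φ = T (mulTest Ω f hf φ) := by
  simp [mulOp, hf]

theorem test_eq_zero {φ : TestSpace Ω} {x : E3} (hx : x ∉ Ω) : (φ : E3 → ℂ) x = 0 :=
  image_eq_zero_of_notMem_tsupport fun h => hx (φ.2.2.2 h)

/-- Test functions vanish off `Ω`, so only the values of the multiplier on `Ω` matter. -/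
theorem mulOp_congr {f g : E3 → ℂ} (hf : ContDiffOn ℝ ∞ f Ω) (h : ∀ x ∈ Ω, g x = f x) :
    mulOp Ω g = mulOp Ω f := by
  have hg : ContDiffOn ℝ ∞ g Ω := hf.congr h
  ext T φ
  rw [mulOp_apply hf, mulOp_apply hg]
  congr 1
  ext x
  by_cases hx : x ∈ Ω
  · simp [mulTest, h x hx]
  · simp [mulTest, test_eq_zero hx]

theorem mulOp_mul {f g : E3 → ℂ} (hf : ContDiffOn ℝ ∞ f Ω) (hg : ContDiffOn ℝ ∞ g Ω) :
    mulOp Ω f * mulOp Ω g = mulOp Ω fun x => f x * g x := by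
  ext T φ
  rw [Module.End.mul_apply, mulOp_apply hf, mulOp_apply hg, mulOp_apply (hf.mul hg)]
  congr 1
  ext x
  simp only [mulTest, LinearMap.coe_mk, AddHom.coe_mk]
  ring

theorem mulOp_one : mulOp Ω (fun _ => 1) = 1 := by
  ext T φ
  rw [mulOp_apply contDiffOn_const]
  congr 1
  ext x
  simp [mulTest]

theorem mulOp_const_mul (c : ℂ) {f : E3 → ℂ} (hf : ContDiffOn ℝ ∞ f Ω) :
    mulOp Ω (fun x => c * f x) = c • mulOp Ω f := by
  ext T φ
  rw [mulOp_apply (contDiffOn_const.mul hf), LinearMap.smul_apply, LinearMap.smul_apply,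
    mulOp_apply hf, ← map_smul]
  congr 1
  ext x
  simp [mulTest, mul_assoc]

/-- Smoothness is not needed: multiplication by a function that is not smooth on `Ω` is the zero
operator by convention. -/
theorem mulOp_commute (f g : E3 → ℂ) : Commute (mulOp Ω f) (mulOp Ω g) := by
  by_cases hf : ContDiffOn ℝ ∞ f Ω
  · by_cases hg : ContDiffOn ℝ ∞ g Ω
    · rw [Commute, SemiconjBy, mulOp_mul hf hg, mulOp_mul hg hf]
      simp only [mul_comm]
    · simp [mulOp, hg]
  · simp [mulOp, hf]

/-- By duality this is the symmetry of the second derivative of a test function. -/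
theorem pd_commute (i j : Fin 3) : Commute (pd Ω i) (pd Ω j) := by
  ext T φ
  simp only [Module.End.mul_apply, pd, LinearMap.neg_apply, LinearMap.dualMap_apply, neg_neg,
    map_neg]
  congr 1
  ext x
  obtain ⟨φ, h1, h2, h3⟩ := φ
  have hd : DifferentiableAt ℝ (fderiv ℝ φ) x :=
    (h1.fderiv_right (m := ∞) (by simp)).differentiable (by simp) x
  have key : ∀ v w : E3, fderiv ℝ (fun y => fderiv ℝ φ y v) x w = fderiv ℝ (fderiv ℝ φ) x w v := by
    intro v w
    rw [fderiv_clm_apply hd (differentiableAt_const v)]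
    simp
  simp only [pdTest, LinearMap.coe_mk, AddHom.coe_mk, key]
  exact ((contDiff_infty.1 h1 2).contDiffAt.isSymmSndFDerivAt
    (by simp)) _ _

/-- The partial derivative of a function. -/
noncomputable def pderiv (j : Fin 3) (f : E3 → ℂ) (x : E3) : ℂ := fderiv ℝ f x (EuclideanSpace.single j 1)

theorem contDiffOn_pderiv {f : E3 → ℂ} (hf : ContDiffOn ℝ ∞ f Ω) (j : Fin 3) :
    ContDiffOn ℝ ∞ (pderiv j f) Ω :=
  (hf.fderiv_of_isOpen Ω.isOpen (m := ∞) (by simp)).clm_apply contDiffOn_const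

theorem pd_mul_mulOp {f : E3 → ℂ} (hf : ContDiffOn ℝ ∞ f Ω) (j : Fin 3) :
    pd Ω j * mulOp Ω f = mulOp Ω f * pd Ω j + mulOp Ω (pderiv j f) := by
  ext T φ
  simp only [Module.End.mul_apply, LinearMap.add_apply]
  rw [mulOp_apply hf, mulOp_apply (contDiffOn_pderiv hf j)]
  simp only [pd, LinearMap.neg_apply, LinearMap.dualMap_apply]
  rw [mulOp_apply hf, neg_add_eq_sub, eq_sub_iff_add_eq, neg_add_eq_sub, ← map_sub, eq_comm]
  congr 1
  ext x
  simp only [mulTest, pdTest, LinearMap.coe_mk, AddHom.coe_mk, AddSubgroupClass.coe_sub,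
    Pi.sub_apply, pderiv]
  by_cases hx : x ∈ Ω
  · have h1 := ((hf.contDiffAt (Ω.isOpen.mem_nhds hx)).differentiableAt (by simp)).hasFDerivAt
    have h2 := (φ.2.1.differentiable (by simp) x).hasFDerivAt
    have h3 : HasFDerivAt (fun y => f y * (φ : E3 → ℂ) y) _ x := h1.mul h2
    rw [h3.fderiv]
    simp
    ring
  -- Off `Ω` nothing is known about `f`, but the test function vanishes near such a point.
  · have h0 : (φ : E3 → ℂ) =ᶠ[𝓝 x] fun _ => 0 :=
      notMem_tsupport_iff_eventuallyEq.1 fun h => hx (φ.2.2.2 h)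
    have h1 : (fun y => f y * (φ : E3 → ℂ) y) =ᶠ[𝓝 x] fun _ => 0 := by
      filter_upwards [h0] with y hy
      simp [hy]
    rw [h1.fderiv_eq, h0.fderiv_eq, h0.eq_of_nhds]
    simp

theorem RepBy.mulOp {T : Distr Ω} {f g : E3 → ℂ} (hT : RepBy T g) (hf : ContDiffOn ℝ ∞ f Ω) :
    RepBy (mulOp Ω f T) fun x => f x * g x := by
  refine ⟨hT.1.continuousOn_mul hf.continuousOn Ω.isOpen.isLocallyClosed, fun φ => ?_⟩
  rw [mulOp_apply hf, hT.2]
  refine integral_congr_ae (Filter.Eventually.of_forall fun x => ?_)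
  simp only [mulTest, LinearMap.coe_mk, AddHom.coe_mk]
  ring

/-! ### Multi-indices and iterated derivatives. -/

theorem mem_multiIdx {k : ℕ} {α : Fin 3 → ℕ} : α ∈ multiIdx k ↔ ∑ i, α i ≤ k := by
  simp only [multiIdx, Finset.mem_filter, Fintype.mem_piFinset, Finset.mem_range,
    and_iff_right_iff_imp]
  intro h i
  exact Nat.lt_succ_of_le ((Finset.single_le_sum (fun i _ => Nat.zero_le (α i))
    (Finset.mem_univ i)).trans h)

theorem pdAlpha_zero : pdAlpha Ω 0 = 1 := by simp [pdAlpha]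

/-- The partial derivatives commute, so the new factor can be put on the right, where it acts first;
this is the form used in inductions on the order. -/
theorem pdAlpha_add_single (α : Fin 3 → ℕ) (j : Fin 3) :
    pdAlpha Ω (α + Pi.single j 1) = pdAlpha Ω α * pd Ω j := by
  have c1 : ∀ (i j : Fin 3) (n : ℕ), Commute (pd Ω i) (pd Ω j ^ n) := fun i j n =>
    (pd_commute i j).pow_right n
  fin_cases j
  · simp only [pdAlpha, Pi.add_apply]
    simp only [Fin.zero_eta, Pi.single_eq_same, ne_eq, one_ne_zero, not_false_eq_true,
      Pi.single_eq_of_ne, Fin.reduceEq, add_zero, pow_succ]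
    rw [mul_assoc _ (pd Ω 0), (c1 0 1 _).eq, ← mul_assoc, mul_assoc _ (pd Ω 0), (c1 0 2 _).eq,
      ← mul_assoc]
  · simp only [pdAlpha, Pi.add_apply]
    simp only [Fin.mk_one, Pi.single_eq_same, ne_eq, zero_ne_one, not_false_eq_true,
      Pi.single_eq_of_ne, Fin.reduceEq, add_zero, pow_succ]
    rw [← mul_assoc, mul_assoc _ (pd Ω 1), (c1 1 2 _).eq, ← mul_assoc]
  · simp only [pdAlpha, Pi.add_apply]
    simp only [Fin.reduceFinMk, Pi.single_eq_same, ne_eq, not_false_eq_true,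
      Pi.single_eq_of_ne, Fin.reduceEq, add_zero, pow_succ]
    rw [← mul_assoc]

theorem exists_eq_add_single {α : Fin 3 → ℕ} (h : α ≠ 0) :
    ∃ (β : Fin 3 → ℕ) (j : Fin 3), α = β + Pi.single j 1 := by
  obtain ⟨j, hj⟩ := Function.ne_iff.1 h
  refine ⟨α - Pi.single j 1, j, ?_⟩
  refine (tsub_add_cancel_of_le ?_).symm
  intro i
  rcases eq_or_ne i j with rfl | hij
  · simpa using Nat.one_le_iff_ne_zero.2 hj
  · simp [hij]

theorem sum_add_single (β : Fin 3 → ℕ) (j : Fin 3) :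
    ∑ i, (β + Pi.single j 1 : Fin 3 → ℕ) i = ∑ i, β i + 1 := by
  simp [Finset.sum_add_distrib]

end Distributions

/-! ### Bounded operators between weighted Sobolev spaces -/

section Bounded

variable {Ω : TopologicalSpace.Opens E3} {w : E3 → ℝ}

/-- `T` is given by a function `g` such that `‖w^s g‖ ≤ N` in `L²(Ω)`. -/
def HasBound (w : E3 → ℝ) (s : ℝ) (T : Distr Ω) (N : ℝ) : Prop :=
  ∃ g, RepBy T g ∧ MemLp (fun x => ((w x ^ s : ℝ) : ℂ) * g x) 2 (volume.restrict (Ω : Set E3)) ∧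
    (eLpNorm (fun x => ((w x ^ s : ℝ) : ℂ) * g x) 2 (volume.restrict (Ω : Set E3))).toReal ≤ N

theorem HasBound.nonneg {s : ℝ} {T : Distr Ω} {N : ℝ} (h : HasBound w s T N) : 0 ≤ N := by
  obtain ⟨g, _, _, h⟩ := h
  exact ENNReal.toReal_nonneg.trans h

theorem HasBound.le {s : ℝ} {T : Distr Ω} {N N' : ℝ} (h : HasBound w s T N) (hN : N ≤ N') :
    HasBound w s T N' := by
  obtain ⟨g, h1, h2, h3⟩ := h
  exact ⟨g, h1, h2, h3.trans hN⟩

theorem HasBound.add {s : ℝ} {T T' : Distr Ω} {N N' : ℝ} (h : HasBound w s T N)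
    (h' : HasBound w s T' N') : HasBound w s (T + T') (N + N') := by
  obtain ⟨g, h1, h2, h3⟩ := h
  obtain ⟨g', h1', h2', h3'⟩ := h'
  have e : (fun x => ((w x ^ s : ℝ) : ℂ) * (g x + g' x)) =
      (fun x => ((w x ^ s : ℝ) : ℂ) * g x) + fun x => ((w x ^ s : ℝ) : ℂ) * g' x := by
    ext x; simp [mul_add]
  refine ⟨_, h1.add h1', e ▸ h2.add h2', ?_⟩
  rw [e]
  refine le_trans ?_ (add_le_add h3 h3')
  rw [← ENNReal.toReal_add h2.2.ne h2'.2.ne]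
  exact ENNReal.toReal_mono (ENNReal.add_ne_top.2 ⟨h2.2.ne, h2'.2.ne⟩)
    (eLpNorm_add_le h2.1 h2'.1 (by norm_num))

/-- The pointwise inequality between weights passes to `L²` norms; continuity of `w` is used only
for measurability. -/
theorem HasBound.mulOp {s t : ℝ} {T : Distr Ω} {N M : ℝ} {f : E3 → ℂ} (hM : 0 ≤ M)
    (hf : ContDiffOn ℝ ∞ f Ω) (hw : ContinuousOn w Ω) (hpos : ∀ x ∈ Ω, 0 < w x)
    (hfM : ∀ x ∈ Ω, w x ^ t * ‖f x‖ ≤ M * w x ^ s)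
    (h : HasBound w s T N) : HasBound w t (mulOp Ω f T) (M * N) := by
  obtain ⟨g, h1, h2, h3⟩ := h
  have hle : ∀ᵐ x ∂(volume.restrict (Ω : Set E3)), ‖((w x ^ t : ℝ) : ℂ) * (f x * g x)‖ ≤
      M * ‖((w x ^ s : ℝ) : ℂ) * g x‖ := by
    filter_upwards [ae_restrict_mem Ω.isOpen.measurableSet] with x hx
    have hx0 := hpos x hx
    rw [norm_mul, norm_mul, norm_mul, Complex.norm_of_nonneg (by positivity),
      Complex.norm_of_nonneg (by positivity), ← mul_assoc, ← mul_assoc]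
    exact mul_le_mul_of_nonneg_right (hfM x hx) (norm_nonneg _)
  have h1' := h1.mulOp hf
  have hwm : AEStronglyMeasurable (fun x => ((w x ^ t : ℝ) : ℂ)) (volume.restrict (Ω : Set E3)) := by
    refine ContinuousOn.aestronglyMeasurable ?_ Ω.isOpen.measurableSet
    exact Complex.continuous_ofReal.comp_continuousOn
      (hw.rpow_const fun x hx => Or.inl (hpos x hx).ne')
  have hmeas := hwm.mul h1'.1.aestronglyMeasurable
  have hmem := h2.of_le_mul hmeas hle
  refine ⟨_, h1', hmem, ?_⟩
  have := eLpNorm_le_mul_eLpNorm_of_ae_le_mul hle 2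
  calc _ ≤ (ENNReal.ofReal M * eLpNorm (fun x => ((w x ^ s : ℝ) : ℂ) * g x) 2
        (volume.restrict (Ω : Set E3))).toReal :=
        ENNReal.toReal_mono (ENNReal.mul_ne_top ENNReal.ofReal_ne_top h2.2.ne) this
    _ = M * _ := by rw [ENNReal.toReal_mul, ENNReal.toReal_ofReal hM]
    _ ≤ _ := mul_le_mul_of_nonneg_left h3 hM

/-- All the terms in the definition of the norm of `T` in `𝒦^k_a` are bounded by `N`. -/
def KondBound (w : E3 → ℝ) (k : ℕ) (a : ℝ) (T : Distr Ω) (N : ℝ) : Prop :=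
  ∀ α ∈ multiIdx k, HasBound w (((∑ i, α i : ℕ) : ℝ) - a) (pdAlpha Ω α T) N

variable {k k' k'' : ℕ} {a a' a'' : ℝ}

theorem KondBound.add {T T' : Distr Ω} {N N' : ℝ} (h : KondBound w k a T N)
    (h' : KondBound w k a T' N') : KondBound w k a (T + T') (N + N') := fun α hα => by
  rw [map_add]
  exact (h α hα).add (h' α hα)

theorem KondBound.le {T : Distr Ω} {N N' : ℝ} (h : KondBound w k a T N) (hN : N ≤ N') :
    KondBound w k a T N' := fun α hα => (h α hα).le hN

theorem KondBound.mono {T : Distr Ω} {N : ℝ} (h : KondBound w k a T N) (hk : k' ≤ k) :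
    KondBound w k' a T N := fun α hα => h α (mem_multiIdx.2 ((mem_multiIdx.1 hα).trans hk))

theorem KondBound.hasBound {T : Distr Ω} {N : ℝ} (h : KondBound w k a T N) :
    HasBound w (-a) T N := by
  simpa [pdAlpha_zero] using h 0 (mem_multiIdx.2 (by simp))

theorem KondBound.nonneg {T : Distr Ω} {N : ℝ} (h : KondBound w k a T N) : 0 ≤ N :=
  h.hasBound.nonneg

theorem KondBound.pd {T : Distr Ω} {N : ℝ} (h : KondBound w (k + 1) a T N) (j : Fin 3) :
    KondBound w k (a - 1) (pd Ω j T) N := fun α hα => by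
  have := h (α + Pi.single j 1) (mem_multiIdx.2 (by
    rw [sum_add_single]
    exact Nat.add_le_add_right (mem_multiIdx.1 hα) 1))
  rw [pdAlpha_add_single, sum_add_single, Module.End.mul_apply] at this
  convert this using 1
  push_cast
  ring

theorem KondBound.zero_of {T : Distr Ω} {N : ℝ} (h : HasBound w (-a) T N) :
    KondBound w 0 a T N := fun α hα => by
  have h0 : α = 0 := by
    ext i
    have := mem_multiIdx.1 hα
    exact Nat.le_zero.1 ((Finset.single_le_sum (fun i _ => Nat.zero_le (α i))
      (Finset.mem_univ i)).trans this)
  subst h0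
  simpa [pdAlpha_zero] using h

/-- A nonzero multi-index is `β + e_j`, and `|β| + 1 - a = |β| - (a - 1)`. With `KondBound.pd` this
trades one derivative for one unit of weight. -/
theorem KondBound.succ_of {T : Distr Ω} {N : ℝ} (h : HasBound w (-a) T N)
    (hj : ∀ j, KondBound w k (a - 1) (Kondratiev.pd Ω j T) N) :
    KondBound w (k + 1) a T N := fun α hα => by
  by_cases h0 : α = 0
  · subst h0
    simpa [pdAlpha_zero] using h
  · obtain ⟨β, j, rfl⟩ := exists_eq_add_single h0
    have hβ : β ∈ multiIdx k := by
      have := mem_multiIdx.1 hα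
      rw [sum_add_single] at this
      exact mem_multiIdx.2 (Nat.le_of_succ_le_succ this)
    have := hj j β hβ
    rw [pdAlpha_add_single, sum_add_single, Module.End.mul_apply]
    convert this using 1
    push_cast
    ring

/-- The norm is defined with chosen representatives of the derivatives; uniqueness almost everywhere
allows any other representative. -/
theorem Kond.eLpNorm_le (u : Kond Ω w k a) (α : multiIdx k) {g : E3 → ℂ}
    (hg : RepBy (pdAlpha Ω α (Kond.toDistr u)) g) :
    ‖Kond.jet u α‖ = (eLpNorm (weighted w a α g) 2 (volume.restrict (Ω : Set E3))).toReal := by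
  have h : weighted w a α (Kond.deriv u α) =ᵐ[volume.restrict (Ω : Set E3)] weighted w a α g := by
    filter_upwards [RepBy.unique (Kond.deriv_repBy u α) hg] with x hx
    simp [weighted, hx]
  rw [← eLpNorm_congr_ae h]
  exact Lp.norm_toLp _ (Kond.deriv_memLp u α)

theorem Kond.kondBound (u : Kond Ω w k a) : KondBound w k a (Kond.toDistr u) ‖u‖ := fun α hα => by
  refine ⟨_, Kond.deriv_repBy u ⟨α, hα⟩, Kond.deriv_memLp u ⟨α, hα⟩, ?_⟩
  have := Kond.eLpNorm_le u ⟨α, hα⟩ (Kond.deriv_repBy u ⟨α, hα⟩)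
  exact this.symm.le.trans (PiLp.norm_apply_le (Kond.jet u) ⟨α, hα⟩)

/-- The square root of the number of multi-indices comes from summing that many squares, each at
most `N²`. -/
theorem Kond.exists_of_kondBound {T : Distr Ω} {N : ℝ} (h : KondBound w k a T N) :
    ∃ u : Kond Ω w k a, Kond.toDistr u = T ∧ ‖u‖ ≤ Real.sqrt (multiIdx k).card * N := by
  have hT : T ∈ kondSubmodule Ω w k a := fun α hα => by
    obtain ⟨g, h1, h2, _⟩ := h α hα
    exact ⟨g, h1, h2⟩
  refine ⟨⟨T, hT⟩, rfl, ?_⟩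
  set u : Kond Ω w k a := ⟨T, hT⟩
  have h1 : ∀ α, ‖Kond.jet u α‖ ≤ N := fun α => by
    obtain ⟨g, h1, _, h3⟩ := h α.1 α.2
    rw [Kond.eLpNorm_le u α h1]
    exact h3
  change ‖Kond.jet u‖ ≤ _
  rw [PiLp.norm_eq_of_L2]
  refine Real.sqrt_le_iff.2 ⟨mul_nonneg (Real.sqrt_nonneg _) h.nonneg, ?_⟩
  rw [mul_pow, Real.sq_sqrt (by positivity)]
  calc _ ≤ ∑ _α : multiIdx k, N ^ 2 :=
        Finset.sum_le_sum fun α _ => pow_le_pow_left₀ (norm_nonneg _) (h1 α) 2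
    _ = _ := by simp

/-- `A` restricts to a bounded operator `𝒦^k_a → 𝒦^{k'}_{a'}`. -/
def IsBddOp (w : E3 → ℝ) (A : Module.End ℂ (Distr Ω)) (k : ℕ) (a : ℝ) (k' : ℕ) (a' : ℝ) : Prop :=
  ∃ M : ℝ, 0 ≤ M ∧ ∀ T N, KondBound w k a T N → KondBound w k' a' (A T) (M * N)

/-- Linearity is inherited from `A`, because an element of the space is determined by its
distribution. -/
theorem IsBddOp.exists_clm {A : Module.End ℂ (Distr Ω)} (h : IsBddOp w A k a k' a') :
    ∃ L : Kond Ω w k a →L[ℂ] Kond Ω w k' a',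
      ∀ u, Kond.toDistr (L u) = A (Kond.toDistr u) := by
  obtain ⟨M, hM, h⟩ := h
  choose v hv hv' using fun u : Kond Ω w k a => Kond.exists_of_kondBound (h _ _ u.kondBound)
  have hinj : Function.Injective (Kond.toDistr : Kond Ω w k' a' →ₗ[ℂ] Distr Ω) :=
    Subtype.val_injective
  refine ⟨LinearMap.mkContinuous
    { toFun := v
      map_add' := fun u u' => hinj (by simp [hv])
      map_smul' := fun c u => hinj (by simp [hv]) } (Real.sqrt (multiIdx k').card * M)
      fun u => (hv' u).trans_eq (by ring), hv⟩

/-- `A_λ`, `λ ∈ ℝ`, restricts to a continuous family of bounded operators `𝒦^k_a → 𝒦^{k'}_{a'}`. -/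
def IsContFamily (w : E3 → ℝ) (A : ℝ → Module.End ℂ (Distr Ω)) (k : ℕ) (a : ℝ) (k' : ℕ)
    (a' : ℝ) : Prop :=
  ∃ L : ℝ → (Kond Ω w k a →L[ℂ] Kond Ω w k' a'), Continuous L ∧
    ∀ lam u, Kond.toDistr (L lam u) = A lam (Kond.toDistr u)

variable {A B : ℝ → Module.End ℂ (Distr Ω)}

theorem IsBddOp.isContFamily {A : Module.End ℂ (Distr Ω)} (h : IsBddOp w A k a k' a') :
    IsContFamily w (fun _ => A) k a k' a' := by
  obtain ⟨L, hL⟩ := h.exists_clm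
  exact ⟨fun _ => L, continuous_const, fun _ => hL⟩

theorem IsContFamily.add (hA : IsContFamily w A k a k' a') (hB : IsContFamily w B k a k' a') :
    IsContFamily w (fun lam => A lam + B lam) k a k' a' := by
  obtain ⟨L, hL, h⟩ := hA
  obtain ⟨L', hL', h'⟩ := hB
  exact ⟨fun lam => L lam + L' lam, hL.add hL', fun lam u => by simp [h, h']⟩

theorem IsContFamily.smul {c : ℝ → ℂ} (hc : Continuous c) (hA : IsContFamily w A k a k' a') :
    IsContFamily w (fun lam => c lam • A lam) k a k' a' := by
  obtain ⟨L, hL, h⟩ := hA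
  exact ⟨fun lam => c lam • L lam, hc.smul hL, fun lam u => by simp [h]⟩

theorem IsContFamily.mul (hA : IsContFamily w A k' a' k'' a'') (hB : IsContFamily w B k a k' a') :
    IsContFamily w (fun lam => A lam * B lam) k a k'' a'' := by
  obtain ⟨L, hL, h⟩ := hA
  obtain ⟨L', hL', h'⟩ := hB
  exact ⟨fun lam => (L lam).comp (L' lam), hL.clm_comp hL', fun lam u => by simp [h, h']⟩

/-! ### Operator families graded by order and weight shift. -/

/-- A continuous family of operators of order at most `m`, which lower the weight by `s`. -/
def IsOpFamily (w : E3 → ℝ) (A : ℝ → Module.End ℂ (Distr Ω)) (m : ℕ) (s : ℝ) : Prop :=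
  ∀ k a, IsContFamily w A (k + m) a k (a - s)

variable {m m' : ℕ} {s s' : ℝ}

theorem IsOpFamily.add (hA : IsOpFamily w A m s) (hB : IsOpFamily w B m s) :
    IsOpFamily w (fun lam => A lam + B lam) m s := fun k a => (hA k a).add (hB k a)

theorem IsOpFamily.smul {c : ℝ → ℂ} (hc : Continuous c) (hA : IsOpFamily w A m s) :
    IsOpFamily w (fun lam => c lam • A lam) m s := fun k a => (hA k a).smul hc

/-- Orders and shifts add because a family is required to act for all `k` and `a`: `B` is used at
level `k + m`, and `A` at weight `a - s'`. -/
theorem IsOpFamily.mul (hA : IsOpFamily w A m s) (hB : IsOpFamily w B m' s') :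
    IsOpFamily w (fun lam => A lam * B lam) (m + m') (s + s') := fun k a => by
  have h1 := hB (k + m) a
  have h2 := hA k (a - s')
  rw [add_assoc] at h1
  rw [sub_sub, add_comm s'] at h2
  exact h2.mul h1

theorem IsOpFamily.one : IsOpFamily w (fun _ => (1 : Module.End ℂ (Distr Ω))) 0 0 := fun k a => by
  rw [sub_zero]
  exact IsBddOp.isContFamily ⟨1, zero_le_one, fun T N h => by simpa using h⟩

theorem IsOpFamily.pow (hA : IsOpFamily w A m s) (n : ℕ) :
    IsOpFamily w (fun lam => A lam ^ n) (n * m) (n * s) := by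
  induction n with
  | zero => simpa using IsOpFamily.one (w := w) (Ω := Ω)
  | succ n ih =>
    have := ih.mul hA
    simp only [← pow_succ] at this
    convert this using 1
    · ring
    · push_cast
      ring

/-- Precompose with the bounded inclusion of the space with more derivatives. -/
theorem IsOpFamily.order_le (hA : IsOpFamily w A m s) (h : m ≤ m') : IsOpFamily w A m' s :=
  fun k a => by
  obtain ⟨n, rfl⟩ := Nat.exists_eq_add_of_le' h
  have h1 : IsContFamily w (fun _ => (1 : Module.End ℂ (Distr Ω))) (k + (n + m)) a (k + m) a :=
    IsBddOp.isContFamily ⟨1, zero_le_one, fun T N h => by simpa using h.mono (by omega)⟩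
  simpa using (hA k a).mul h1

theorem IsOpFamily.zero : IsOpFamily w (fun _ => (0 : Module.End ℂ (Distr Ω))) m s := fun k a =>
  ⟨fun _ => 0, continuous_const, fun lam u => by simp⟩

theorem IsOpFamily.sum {ι : Type*} (t : Finset ι) {A : ι → ℝ → Module.End ℂ (Distr Ω)}
    (h : ∀ i ∈ t, IsOpFamily w (A i) m s) : IsOpFamily w (fun lam => ∑ i ∈ t, A i lam) m s := by
  classical
  induction t using Finset.induction_on with
  | empty => simpa using IsOpFamily.zero
  | insert i t hi ih =>
    simp only [Finset.sum_insert hi]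
    exact (h i (by simp)).add (ih fun j hj => h j (by simp [hj]))

end Bounded

/-! ### Symbols relative to an admissible weight -/

section Weight

variable {Ω : TopologicalSpace.Opens E3} {w : E3 → ℝ}

/-- A bounded positive smooth weight `w` with `|∂^α w| ≤ C_α w^{1-|α|}`. -/
structure IsWeight (Ω : TopologicalSpace.Opens E3) (w : E3 → ℝ) : Prop where
  pos : ∀ x ∈ Ω, 0 < w x
  bdd : ∃ C, ∀ x ∈ Ω, w x ≤ C
  symbol : SymbolOn (Ω : Set E3) w w w

/-- `|∂^α f| ≤ C_α w^{b-|α|}` on `Ω`. -/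
def IsSymb (Ω : TopologicalSpace.Opens E3) (w : E3 → ℝ) (b : ℝ) (f : E3 → ℂ) : Prop :=
  SymbolOn (Ω : Set E3) (fun x => w x ^ b) w f

variable {b b' : ℝ} {f g : E3 → ℂ}

theorem IsSymb.contDiffOn (hf : IsSymb Ω w b f) : ContDiffOn ℝ ∞ f Ω := fun x hx =>
  (hf.1 x hx).contDiffWithinAt

theorem IsSymb.mul (hw : IsWeight Ω w) (hf : IsSymb Ω w b f) (hg : IsSymb Ω w b' g) :
    IsSymb Ω w (b + b') fun x => f x * g x :=
  (SymbolOn.mul hf hg fun x hx => (hw.pos x hx).le).congr_fun fun x hx =>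
    (Real.rpow_add (hw.pos x hx) _ _).symm

theorem IsSymb.pderiv (hw : IsWeight Ω w) (hf : IsSymb Ω w b f) (j : Fin 3) :
    IsSymb Ω w (b - 1) (pderiv j f) :=
  ((SymbolOn.fderiv hf hw.pos).clm_comp
    (ContinuousLinearMap.apply ℝ ℂ (EuclideanSpace.single j (1 : ℝ)))
    fun x hx => (hw.pos x hx).le).congr_fun fun x hx => by
      rw [Real.rpow_sub (hw.pos x hx), Real.rpow_one]

theorem IsWeight.isSymb_rpow (hw : IsWeight Ω w) (b : ℝ) :
    IsSymb Ω w b fun x => ((w x ^ b : ℝ) : ℂ) :=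
  (hw.symbol.rpow hw.pos hw.pos b).clm_comp Complex.ofRealCLM fun x hx => (hw.pos x hx).le

theorem IsWeight.isSymb (hw : IsWeight Ω w) : IsSymb Ω w 1 fun x => (w x : ℂ) := by
  simpa using hw.isSymb_rpow 1

/-- Since `w` is bounded, the scale 1 may be lowered to `w`, and the constant 1 is at most a
multiple of `w ^ b` when `b ≤ 0`. -/
theorem IsSymb.of_bounded (hw : IsWeight Ω w) (hb : b ≤ 0)
    (hf : SymbolOn (Ω : Set E3) (fun _ => 1) (fun _ => 1) f) : IsSymb Ω w b f := by
  obtain ⟨C, hC⟩ := hw.bdd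
  have hpos := hw.pos
  refine (hf.rescale (d' := w) (C := C) (fun x hx => (hpos x hx).le)
    (fun x hx => by simpa using hC x hx) (by simp)).weaken (C := C ^ (-b) ⊔ 0) (by simp)
    fun x hx => ?_
  have hx0 := hpos x hx
  have h1 : (1 : ℝ) = w x ^ (-b) * w x ^ b := by
    rw [← Real.rpow_add hx0, neg_add_cancel, Real.rpow_zero]
  rw [h1]
  refine mul_le_mul_of_nonneg_right (le_sup_of_le_left ?_) (by positivity)
  exact Real.rpow_le_rpow hx0.le (hC x hx) (by linarith)

/-- Induction on `k` through `∂_j(fT) = f ∂_jT + (∂_jf) T`. In the first term `∂_jT` has weight `a -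
1` and `f` order `b`; in the second `T` has weight `a` and `∂_jf` order `b - 1`. Both land in weight
`a + b - 1`, so the induction must range over all weights, orders and symbols. -/
theorem IsSymb.isBddOp (hw : IsWeight Ω w) (k : ℕ) : ∀ {a b : ℝ} {f : E3 → ℂ}, IsSymb Ω w b f →
    IsBddOp w (mulOp Ω f) k a k (a + b) := by
  have h0 : ∀ {a b : ℝ} {f : E3 → ℂ}, IsSymb Ω w b f → ∃ M : ℝ, 0 ≤ M ∧ ∀ T N,
      HasBound w (-a) T N → HasBound w (-(a + b)) (mulOp Ω f T) (M * N) := by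
    intro a b f hf
    obtain ⟨M, hM, h⟩ := hf.2 0
    refine ⟨M, hM, fun T N hT => hT.mulOp hM hf.contDiffOn
      (fun x hx => (hw.symbol.1 x hx).continuousAt.continuousWithinAt) hw.pos fun x hx => ?_⟩
    have := h x hx
    have hx0 := hw.pos x hx
    simp only [norm_iteratedFDeriv_zero, pow_zero, mul_one] at this
    calc _ ≤ w x ^ (-(a + b)) * (M * w x ^ b) := by gcongr
      _ = M * (w x ^ (-(a + b)) * w x ^ b) := by ring
      _ = _ := by rw [← Real.rpow_add hx0]; ring_nf
  induction k with
  | zero =>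
    intro a b f hf
    obtain ⟨M, hM, h⟩ := h0 (a := a) hf
    exact ⟨M, hM, fun T N hT => KondBound.zero_of (h T N hT.hasBound)⟩
  | succ k ih =>
    intro a b f hf
    obtain ⟨M, hM, h⟩ := h0 (a := a) hf
    obtain ⟨M', hM', h'⟩ := ih (a := a - 1) hf
    choose M'' hM'' h'' using fun j => ih (a := a) (hf.pderiv hw j)
    have hs : 0 ≤ ∑ j, M'' j := Finset.sum_nonneg fun j _ => hM'' j
    refine ⟨M + M' + ∑ j, M'' j, by positivity, fun T N hT => ?_⟩
    have hN := hT.nonneg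
    refine KondBound.succ_of ((h T N hT.hasBound).le ?_) fun j => ?_
    · have : 0 ≤ (M' + ∑ j, M'' j) * N := by positivity
      linarith
    · have e := congrArg (fun A => A T) (pd_mul_mulOp hf.contDiffOn j)
      simp only [Module.End.mul_apply, LinearMap.add_apply] at e
      rw [e]
      have h1 := h' _ _ (hT.pd j)
      have h2 := h'' j _ _ (hT.mono (Nat.le_succ k))
      rw [show a - 1 + b = a + b - 1 by ring] at h1
      rw [show a + (b - 1) = a + b - 1 by ring] at h2
      refine (h1.add h2).le ?_
      have h3 : M'' j ≤ ∑ j, M'' j := Finset.single_le_sum (fun j _ => hM'' j) (Finset.mem_univ j)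
      nlinarith [mul_le_mul_of_nonneg_right h3 hN, mul_nonneg hM hN]

theorem IsSymb.isOpFamily (hw : IsWeight Ω w) (hf : IsSymb Ω w b f) :
    IsOpFamily w (fun _ => mulOp Ω f) 0 (-b) := fun k a => by
  rw [sub_neg_eq_add]
  exact (hf.isBddOp hw k).isContFamily

theorem isOpFamily_pd (j : Fin 3) : IsOpFamily w (fun _ => pd Ω j) 1 1 := fun k a =>
  IsBddOp.isContFamily ⟨1, zero_le_one, fun T N h => by simpa using h.pd j⟩

/-! ### Conjugation by powers of the weight. -/

/-- The conjugate `w^{-lam} A w^{lam}`. -/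
noncomputable def conjBy (Ω : TopologicalSpace.Opens E3) (w : E3 → ℝ) (A : Module.End ℂ (Distr Ω)) (lam : ℝ) :
    Module.End ℂ (Distr Ω) :=
  mulOp Ω (fun p => ((w p ^ (-lam) : ℝ) : ℂ)) * A * mulOp Ω (fun p => ((w p ^ lam : ℝ) : ℂ))

theorem mulOp_rpow_mul (hw : IsWeight Ω w) (s t : ℝ) :
    mulOp Ω (fun p => ((w p ^ s : ℝ) : ℂ)) * mulOp Ω (fun p => ((w p ^ t : ℝ) : ℂ)) =
      mulOp Ω (fun p => ((w p ^ (s + t) : ℝ) : ℂ)) := by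
  rw [mulOp_mul (hw.isSymb_rpow s).contDiffOn (hw.isSymb_rpow t).contDiffOn]
  refine mulOp_congr (hw.isSymb_rpow (s + t)).contDiffOn fun x hx => ?_
  rw [Real.rpow_add (hw.pos x hx), Complex.ofReal_mul]

theorem mulOp_rpow_zero : mulOp Ω (fun p => ((w p ^ (0 : ℝ) : ℝ) : ℂ)) = 1 := by
  simp only [Real.rpow_zero, Complex.ofReal_one]
  exact mulOp_one

variable {A B : Module.End ℂ (Distr Ω)}

theorem conjBy_zero_right : conjBy Ω w A 0 = A := by
  rw [conjBy, neg_zero, mulOp_rpow_zero, one_mul, mul_one]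

theorem conjBy_mul (hw : IsWeight Ω w) (lam : ℝ) :
    conjBy Ω w (A * B) lam = conjBy Ω w A lam * conjBy Ω w B lam := by
  have h := mulOp_rpow_mul hw lam (-lam)
  rw [add_neg_cancel, mulOp_rpow_zero] at h
  calc _ = mulOp Ω (fun p => ((w p ^ (-lam) : ℝ) : ℂ)) * A *
        (mulOp Ω (fun p => ((w p ^ lam : ℝ) : ℂ)) * mulOp Ω (fun p => ((w p ^ (-lam) : ℝ) : ℂ))) *
        B * mulOp Ω (fun p => ((w p ^ lam : ℝ) : ℂ)) := by
        rw [h, mul_one, conjBy]; simp only [mul_assoc]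
    _ = _ := by simp only [conjBy, mul_assoc]

theorem conjBy_mulOp (hw : IsWeight Ω w) (f : E3 → ℂ) (lam : ℝ) :
    conjBy Ω w (mulOp Ω f) lam = mulOp Ω f := by
  rw [conjBy, (mulOp_commute _ f).eq, mul_assoc, mulOp_rpow_mul hw, neg_add_cancel,
    mulOp_rpow_zero, mul_one]

theorem conjBy_one (hw : IsWeight Ω w) (lam : ℝ) :
    conjBy Ω w (1 : Module.End ℂ (Distr Ω)) lam = 1 := by
  rw [← mulOp_one, conjBy_mulOp hw]

theorem conjBy_pow (hw : IsWeight Ω w) (lam : ℝ) (n : ℕ) :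
    conjBy Ω w (A ^ n) lam = conjBy Ω w A lam ^ n := by
  induction n with
  | zero => simp [conjBy_one hw]
  | succ n ih => rw [pow_succ, conjBy_mul hw, ih, pow_succ]

theorem conjBy_sum {ι : Type*} (t : Finset ι) (A : ι → Module.End ℂ (Distr Ω)) (lam : ℝ) :
    conjBy Ω w (∑ i ∈ t, A i) lam = ∑ i ∈ t, conjBy Ω w (A i) lam := by
  simp only [conjBy, Finset.mul_sum, Finset.sum_mul]

theorem pderiv_rpow (hw : IsWeight Ω w) (lam : ℝ) (j : Fin 3) {x : E3} (hx : x ∈ Ω) :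
    pderiv j (fun p => ((w p ^ lam : ℝ) : ℂ)) x =
      ((w x ^ lam : ℝ) : ℂ) * (lam * (((w x ^ (-1 : ℝ) : ℝ) : ℂ) * pderiv j (fun p => (w p : ℂ)) x)) := by
  have hx0 := hw.pos x hx
  have hd : HasFDerivAt w (fderiv ℝ w x) x :=
    ((hw.symbol.1 x hx).differentiableAt (by simp)).hasFDerivAt
  have h1 : HasFDerivAt (fun p => (w p : ℂ)) _ x := Complex.ofRealCLM.hasFDerivAt.comp x hd
  have h2 : HasFDerivAt (fun p => ((w p ^ lam : ℝ) : ℂ)) _ x :=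
    Complex.ofRealCLM.hasFDerivAt.comp x (hd.rpow_const (p := lam) (Or.inl hx0.ne'))
  rw [pderiv, pderiv, h1.fderiv, h2.fderiv]
  simp [Real.rpow_sub hx0, Real.rpow_neg hx0.le]
  ring

/-- The conjugates of `∂_j` form an affine family. -/
theorem conjBy_pd (hw : IsWeight Ω w) (lam : ℝ) (j : Fin 3) :
    conjBy Ω w (pd Ω j) lam = pd Ω j + (lam : ℂ) • mulOp Ω
      (fun x => ((w x ^ (-1 : ℝ) : ℝ) : ℂ) * pderiv j (fun p => (w p : ℂ)) x) := by
  have hq : ContDiffOn ℝ ∞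
      (fun x => ((w x ^ (-1 : ℝ) : ℝ) : ℂ) * pderiv j (fun p => (w p : ℂ)) x) Ω :=
    ((hw.isSymb_rpow (-1)).mul hw (hw.isSymb.pderiv hw j)).contDiffOn
  have hl := (hw.isSymb_rpow lam).contDiffOn
  -- The derivative of `w ^ lam` is written with `w ^ lam` as a left factor, to be cancelled by `w ^
  -- (-lam)`.
  have e : mulOp Ω (pderiv j fun p => ((w p ^ lam : ℝ) : ℂ)) =
      mulOp Ω (fun p => ((w p ^ lam : ℝ) : ℂ)) * ((lam : ℂ) • mulOp Ω
      (fun x => ((w x ^ (-1 : ℝ) : ℝ) : ℂ) * pderiv j (fun p => (w p : ℂ)) x)) := by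
    rw [← mulOp_const_mul _ hq, mulOp_mul hl (contDiffOn_const.mul hq)]
    exact mulOp_congr (hl.mul (contDiffOn_const.mul hq)) fun x hx => pderiv_rpow hw lam j hx
  rw [conjBy, mul_assoc, pd_mul_mulOp hl, e, ← mul_add, ← mul_assoc, mulOp_rpow_mul hw,
    neg_add_cancel, mulOp_rpow_zero, one_mul]

/-- The logarithmic derivative `w⁻¹ ∂_j w` is a symbol of order -1, so multiplication by it lowers
the weight by one, exactly as `∂_j` does. -/
theorem isOpFamily_conjBy_pd (hw : IsWeight Ω w) (j : Fin 3) :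
    IsOpFamily w (conjBy Ω w (pd Ω j)) 1 1 := by
  have hq := ((hw.isSymb_rpow (-1)).mul hw (hw.isSymb.pderiv hw j)).isOpFamily hw
  have := (isOpFamily_pd (w := w) j).add
    ((hq.smul Complex.continuous_ofReal).order_le zero_le_one |> fun h => by simpa using h)
  simpa only [← conjBy_pd hw] using this

theorem isOpFamily_conjBy_pdAlpha (hw : IsWeight Ω w) (α : Fin 3 → ℕ) :
    IsOpFamily w (conjBy Ω w (pdAlpha Ω α)) (∑ i, α i) ((∑ i, α i : ℕ) : ℝ) := by
  have h := fun i => (isOpFamily_conjBy_pd hw i).pow (α i)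
  have := ((h 0).mul (h 1)).mul (h 2)
  simp only [← conjBy_pow hw, ← conjBy_mul hw] at this
  simpa [Fin.sum_univ_three, pdAlpha] using this

/-- The factor `w` has order 1 and restores the unit of weight lost by `∂_j`. -/
theorem isOpFamily_conjBy_rD (hw : IsWeight Ω w) (j : Fin 3) :
    IsOpFamily w (conjBy Ω w (mulOp Ω (fun p => (w p : ℂ)) * pd Ω j)) 1 0 := by
  have := (hw.isSymb.isOpFamily hw).mul (isOpFamily_conjBy_pd hw j)
  simpa [funext fun lam => conjBy_mul (A := mulOp Ω (fun p => (w p : ℂ))) (B := pd Ω j) hw lam,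
    conjBy_mulOp hw] using this

/-- The conclusion of the main theorem for one operator. -/
theorem IsOpFamily.conclusion {m k : ℕ} (hm : m ≤ k) {s : ℝ} (h : IsOpFamily w (conjBy Ω w A) m s)
    (a : ℝ) :
    (∃ T : Kond Ω w k a →L[ℂ] Kond Ω w (k - m) (a - s),
      ∀ u, Kond.toDistr (T u) = A (Kond.toDistr u)) ∧
    (∃ T : ℝ → (Kond Ω w k a →L[ℂ] Kond Ω w (k - m) (a - s)), Continuous T ∧
      ∀ lam u, Kond.toDistr (T lam u) = conjBy Ω w A lam (Kond.toDistr u)) := by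
  have := h (k - m) a
  rw [Nat.sub_add_cancel hm] at this
  obtain ⟨T, hT, hT'⟩ := this
  -- At parameter 0 the conjugate is the operator itself.
  exact ⟨⟨T 0, fun u => by rw [hT', conjBy_zero_right]⟩, T, hT, hT'⟩

end Weight

/-! ### Distances and angles relative to a segment -/

section Segment

variable {A B : E3}

/-- The distance to the line through `A` and `B`. -/
noncomputable def distLine (A B p : E3) : ℝ :=
  Metric.infDist p (affineSpan ℝ {A, B} : AffineSubspace ℝ E3)

/-- The projection onto the orthogonal complement of `u`. -/
noncomputable def orthProj (u : E3) : E3 →L[ℝ] E3 :=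
  ContinuousLinearMap.id ℝ E3 - (‖u‖ ^ 2)⁻¹ • (innerSL ℝ u).smulRight u

theorem orthProj_apply (u v : E3) : orthProj u v = v - ((‖u‖ ^ 2)⁻¹ * inner ℝ u v) • u := by
  simp [orthProj, smul_smul]

theorem orthProj_self (u : E3) : orthProj u u = 0 := by
  rw [orthProj_apply, real_inner_self_eq_norm_sq]
  rcases eq_or_ne u 0 with rfl | h
  · simp
  · rw [inv_mul_cancel₀ (by positivity), one_smul, sub_self]

theorem norm_orthProj_sq {u : E3} (hu : u ≠ 0) (v : E3) :
    ‖orthProj u v‖ ^ 2 = ‖v‖ ^ 2 - (inner ℝ u v / ‖u‖) ^ 2 := by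
  have : ‖u‖ ≠ 0 := norm_ne_zero_iff.2 hu
  rw [orthProj_apply, norm_sub_sq_real, inner_smul_right, norm_smul, mul_pow, real_inner_comm,
    Real.norm_eq_abs, sq_abs]
  field_simp
  ring

theorem norm_orthProj_le (u v : E3) : ‖orthProj u v‖ ≤ ‖v‖ := by
  rcases eq_or_ne u 0 with rfl | hu
  · simp [orthProj_apply]
  · refine (sq_le_sq₀ (norm_nonneg _) (norm_nonneg _)).1 ?_
    rw [norm_orthProj_sq hu]
    nlinarith [sq_nonneg (inner ℝ u v / ‖u‖)]

/-- The foot of the perpendicular lies on the line, giving one inequality; conversely the projection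
kills the direction of the line and does not increase norms. -/
theorem distLine_eq_norm (A B p : E3) : distLine A B p = ‖orthProj (B - A) (p - A)‖ := by
  refine le_antisymm ?_ ?_
  · rw [orthProj_apply]
    set t := (‖B - A‖ ^ 2)⁻¹ * inner ℝ (B - A) (p - A)
    have hm : A + t • (B - A) ∈ affineSpan ℝ {A, B} := by
      have := AffineMap.lineMap_mem_affineSpan_pair (k := ℝ) t A B
      rwa [AffineMap.lineMap_apply, vadd_eq_add, vsub_eq_sub, add_comm] at this
    refine (Metric.infDist_le_dist_of_mem hm).trans_eq ?_
    rw [dist_eq_norm, sub_add_eq_sub_sub]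
  · refine (Metric.le_infDist ⟨A, left_mem_affineSpan_pair ℝ A B⟩).2 fun y hy => ?_
    obtain ⟨t, rfl⟩ := mem_affineSpan_pair_iff_exists_lineMap_eq.1 hy
    have e : p - A = (p - AffineMap.lineMap A B t) + t • (B - A) := by
      rw [AffineMap.lineMap_apply, vadd_eq_add, vsub_eq_sub]
      abel
    rw [e, map_add, map_smul, orthProj_self, smul_zero, add_zero, dist_eq_norm]
    exact norm_orthProj_le _ _

theorem distLine_nonneg (A B p : E3) : 0 ≤ distLine A B p := Metric.infDist_nonneg

theorem distLine_comm (A B p : E3) : distLine A B p = distLine B A p := by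
  rw [distLine, distLine, pair_comm]

theorem distLine_le_left (A B p : E3) : distLine A B p ≤ dist p A := by
  rw [distLine_eq_norm, dist_eq_norm]
  exact norm_orthProj_le _ _

theorem distLine_le_right (A B p : E3) : distLine A B p ≤ dist p B := by
  rw [distLine_comm]
  exact distLine_le_left B A p

theorem inner_eq_cos (hAB : A ≠ B) (p : E3) :
    inner ℝ (B - A) (p - A) / ‖B - A‖ = dist p A * Real.cos (EuclideanGeometry.angle p A B) := by
  have hu : ‖B - A‖ ≠ 0 := norm_ne_zero_iff.2 (sub_ne_zero.2 hAB.symm)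
  have := InnerProductGeometry.cos_angle_mul_norm_mul_norm (p - A) (B - A)
  rw [EuclideanGeometry.angle, vsub_eq_sub, vsub_eq_sub, dist_eq_norm, real_inner_comm, ← this]
  field_simp

theorem sin_angle_nonneg (p A B : E3) : 0 ≤ Real.sin (EuclideanGeometry.angle p A B) :=
  Real.sin_nonneg_of_nonneg_of_le_pi (EuclideanGeometry.angle_nonneg _ _ _)
    (EuclideanGeometry.angle_le_pi _ _ _)

theorem distLine_eq_sin (hAB : A ≠ B) (p : E3) :
    distLine A B p = dist p A * Real.sin (EuclideanGeometry.angle p A B) := by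
  refine (sq_eq_sq₀ (distLine_nonneg _ _ _) (mul_nonneg dist_nonneg (sin_angle_nonneg _ _ _))).1 ?_
  rw [distLine_eq_norm, norm_orthProj_sq (sub_ne_zero.2 hAB.symm), inner_eq_cos hAB, mul_pow,
    mul_pow, Real.sin_sq, ← dist_eq_norm]
  ring

theorem dist_mul_sin_le (hAB : A ≠ B) {p : E3} {s : ℝ} (hs : 0 ≤ s)
    (h1 : s ≤ EuclideanGeometry.angle p A B) (h2 : EuclideanGeometry.angle p A B ≤ Real.pi - s) :
    dist p A * Real.sin s ≤ distLine A B p := by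
  rw [distLine_eq_sin hAB]
  refine mul_le_mul_of_nonneg_left ?_ dist_nonneg
  set φ := EuclideanGeometry.angle p A B
  rcases le_total φ (Real.pi / 2) with h | h
  · exact Real.sin_le_sin_of_le_of_le_pi_div_two (by linarith [Real.pi_pos]) h h1
  · rw [← Real.sin_pi_sub φ]
    exact Real.sin_le_sin_of_le_of_le_pi_div_two (by linarith [Real.pi_pos]) (by linarith)
      (by linarith)

/-- The distance to the second vertex is bounded below outside a cone at the first one. -/
theorem dist_mul_sin_le_dist (hAB : A ≠ B) {p : E3} {s : ℝ} (hs : 0 ≤ s) (hs' : s ≤ Real.pi / 2)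
    (h1 : s ≤ EuclideanGeometry.angle p A B) : dist p A * Real.sin s ≤ dist p B := by
  rcases le_total (EuclideanGeometry.angle p A B) (Real.pi - s) with h | h
  · exact (dist_mul_sin_le hAB hs h1 h).trans (distLine_le_right A B p)
  -- Here the angle is at least `π/2`, so its cosine is nonpositive and the law of cosines gives
  -- `dist p A ≤ dist p B`.
  · refine (mul_le_of_le_one_right dist_nonneg (Real.sin_le_one s)).trans ?_
    have h2 := EuclideanGeometry.law_cos p A B
    have h3 : Real.cos (EuclideanGeometry.angle p A B) ≤ 0 :=
      Real.cos_nonpos_of_pi_div_two_le_of_le (by linarith)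
        (by linarith [EuclideanGeometry.angle_le_pi p A B, Real.pi_pos])
    refine (sq_le_sq₀ dist_nonneg dist_nonneg).1 ?_
    have h4 : dist p A * dist B A * Real.cos (EuclideanGeometry.angle p A B) ≤ 0 :=
      mul_nonpos_of_nonneg_of_nonpos (by positivity) h3
    nlinarith [sq_nonneg (dist B A)]

theorem mem_segment_of_angle_eq_zero {p : E3} (h1 : EuclideanGeometry.angle p A B = 0)
    (h2 : EuclideanGeometry.angle p B A = 0) : p ∈ segment ℝ A B := by
  obtain ⟨_, r, hr, e⟩ := InnerProductGeometry.angle_eq_zero_iff.1 h1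
  obtain ⟨_, r', hr', e'⟩ := InnerProductGeometry.angle_eq_zero_iff.1 h2
  simp only [vsub_eq_sub] at e e'
  have h : (r * r') • p = r' • (B - A) + (r * r') • A := by
    rw [e, smul_smul, mul_comm r', ← smul_add, sub_add_cancel]
  have h' : (r * r') • p = r • (A - B) + (r * r') • B := by
    rw [e', smul_smul, ← smul_add, sub_add_cancel]
  have h3 : (r * r' - r' - r) • (A - B) = 0 := by
    have := h.symm.trans h'
    have e2 : (r * r' - r' - r) • (A - B) = (r' • (B - A) + (r * r') • A) -
      (r • (A - B) + (r * r') • B) := by module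
    rw [e2, this, sub_self]
  have hAB : A - B ≠ 0 := fun h0 => by
    have : B - A = 0 := by rw [← neg_sub, h0, neg_zero]
    rw [this, eq_comm, smul_eq_zero] at e
    rcases e with e | e
    · exact hr.ne' e
    · simp_all
  -- From `B - A = r (p - A)` and `A - B = r' (p - B)` one gets `r r' = r + r'`, which makes `p = (r
  -- A + r' B) / (r r')` a convex combination.
  have h4 : r * r' = r' + r := by
    have := (smul_eq_zero.1 h3).resolve_right hAB
    linarith
  have hrr : r * r' ≠ 0 := by positivity
  refine ⟨r / (r * r'), r' / (r * r'), by positivity, by positivity, ?_, ?_⟩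
  · rw [← add_div, add_comm r, ← h4, div_self hrr]
  · have : p = (r * r')⁻¹ • ((r * r') • p) := by rw [smul_smul, inv_mul_cancel₀ hrr, one_smul]
    rw [this, h, h4, div_eq_inv_mul, div_eq_inv_mul, mul_smul, mul_smul, ← smul_add]
    congr 1
    module

theorem continuousAt_angle_left (hAB : A ≠ B) {p : E3} (hp : p ≠ A) :
    ContinuousAt (fun p => EuclideanGeometry.angle p A B) p := by
  have h := EuclideanGeometry.continuousAt_angle (x := (p, A, B)) hp hAB.symm
  have h2 : ContinuousAt (fun p : E3 => (p, A, B)) p := by fun_prop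
  exact ContinuousAt.comp (g := fun y : E3 × E3 × E3 => EuclideanGeometry.angle y.1 y.2.1 y.2.2)
    (f := fun p : E3 => (p, A, B)) h h2

/-! ### Symbol estimates for the basic coordinate functions -/

variable {S : Set E3}

theorem symbolOn_dist (h : ∀ p ∈ S, p ≠ A) :
    SymbolOn S (fun p => dist p A) (fun p => dist p A) (fun p => dist p A) := by
  have := SymbolOn.norm_affine (S := S) (ContinuousLinearMap.id ℝ E3) (-A)
    (fun x hx => by simpa [← sub_eq_add_neg, sub_eq_zero] using h x hx)
  simpa [← sub_eq_add_neg, ← dist_eq_norm] using this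

theorem symbolOn_distLine (h : ∀ p ∈ S, 0 < distLine A B p) :
    SymbolOn S (distLine A B) (distLine A B) (distLine A B) := by
  have e : distLine A B = fun x => ‖orthProj (B - A) x + -orthProj (B - A) A‖ := by
    ext1 p
    rw [distLine_eq_norm, map_sub, sub_eq_add_neg]
  rw [e]
  refine SymbolOn.norm_affine (S := S) (orthProj (B - A)) (-orthProj (B - A) A) fun x hx => ?_
  have := h x hx
  rw [distLine_eq_norm, map_sub, sub_eq_add_neg] at this
  exact norm_pos_iff.1 this

theorem ne_left_of_distLine_pos {p : E3} (h : 0 < distLine A B p) : p ≠ A := by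
  rintro rfl
  have := distLine_le_left p B p
  rw [dist_self] at this
  linarith

theorem isOpen_distLine_pos : IsOpen {p | 0 < distLine A B p} :=
  isOpen_lt continuous_const (Metric.continuous_infDist_pt _)

theorem angle_eq_arccos (p : E3) : EuclideanGeometry.angle p A B =
    Real.arccos (inner ℝ (B - A) (p - A) * (dist p A)⁻¹ * ‖B - A‖⁻¹) := by
  rw [EuclideanGeometry.angle, InnerProductGeometry.angle, vsub_eq_sub, vsub_eq_sub, dist_eq_norm,
    real_inner_comm, div_eq_mul_inv, mul_inv, mul_assoc]

/-- The cosine of the angle is homogeneous of degree 0 in `p - A` and smooth even on the line, so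
the scale is the distance to `A`. -/
theorem symbolOn_cos (h : ∀ p ∈ S, p ≠ A) : SymbolOn S (fun _ => 1) (fun p => dist p A)
    (fun p => inner ℝ (B - A) (p - A) * (dist p A)⁻¹ * ‖B - A‖⁻¹) := by
  have hpos : ∀ p ∈ S, 0 < dist p A := fun p hp => dist_pos.2 (h p hp)
  have h1 : SymbolOn S (fun p => dist p A) (fun p => dist p A)
      (fun p => inner ℝ (B - A) (p - A)) := by
    have := SymbolOn.affine (S := S) (m := fun p => dist p A) (d := fun p => dist p A)
      (L := innerSL ℝ (B - A)) (c := -inner ℝ (B - A) A) (C := ‖B - A‖ + 1) (by positivity)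
      (fun p hp => (hpos p hp).le) (fun p hp => by
        rw [innerSL_apply_apply, ← sub_eq_add_neg, ← inner_sub_right, dist_eq_norm]
        refine (norm_inner_le_norm _ _).trans ?_
        nlinarith [norm_nonneg (p - A)]) (fun p hp => by
        nlinarith [norm_nonneg (B - A), hpos p hp])
    simpa only [innerSL_apply_apply, ← sub_eq_add_neg, ← inner_sub_right] using this
  have h2 := (symbolOn_dist h).rpow hpos hpos (-1)
  simp only [Real.rpow_neg_one] at h2
  have h3 := (h1.mul h2 fun p hp => (hpos p hp).le).congr_fun (m' := fun _ => 1)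
    fun p hp => mul_inv_cancel₀ (hpos p hp).ne'
  have h4 := h3.clm_comp (ContinuousLinearMap.mul ℝ ℝ ‖B - A‖⁻¹) fun p hp => (hpos p hp).le
  simpa [mul_comm, mul_assoc, mul_left_comm] using h4

/-- With `ρ` the distance to `A` and `r` the distance to the line, `sin φ = r/ρ`, so `dφ = -(ρ/r)
d(cos φ)`. As `d(cos φ)` has size `1/ρ`, the product has size `1/r`, and `SymbolOn.of_fderiv`
applies at scale `r`. -/
theorem symbolOn_angle (hAB : A ≠ B) (h : ∀ p ∈ S, 0 < distLine A B p) :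
    SymbolOn S (fun _ => 1) (distLine A B) (fun p => EuclideanGeometry.angle p A B) := by
  set c : E3 → ℝ := fun p => inner ℝ (B - A) (p - A) * (dist p A)⁻¹ * ‖B - A‖⁻¹ with hc
  have hcs : ∀ {T : Set E3}, (∀ p ∈ T, p ≠ A) → SymbolOn T (fun _ => 1) (fun p => dist p A) c :=
    fun h => symbolOn_cos h
  have hne : ∀ p ∈ S, p ≠ A := fun p hp => ne_left_of_distLine_pos (h p hp)
  have hsin : ∀ p, 0 < distLine A B p →
      √(1 - c p ^ 2) = distLine A B p * (dist p A)⁻¹ := fun p hp => by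
    have hpA : 0 < dist p A := dist_pos.2 (ne_left_of_distLine_pos hp)
    rw [← Real.sin_arccos, ← angle_eq_arccos, distLine_eq_sin hAB]
    field_simp
  have hder : ∀ p, 0 < distLine A B p → HasFDerivAt (fun p => EuclideanGeometry.angle p A B)
      (-(dist p A * (distLine A B p)⁻¹) • fderiv ℝ c p) p := fun p hp => by
    have hpA : 0 < dist p A := dist_pos.2 (ne_left_of_distLine_pos hp)
    have h1 : HasFDerivAt c (fderiv ℝ c p) p :=
      (((hcs (T := {p}) (by simpa using ne_left_of_distLine_pos hp)).1 p
        rfl).differentiableAt (by simp)).hasFDerivAt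
    have hs : 0 < √(1 - c p ^ 2) := by rw [hsin p hp]; positivity
    have hs' := Real.sqrt_pos.1 hs
    have h2 := (Real.hasDerivAt_arccos (x := c p) (fun h0 => by rw [h0] at hs'; norm_num at hs')
      (fun h0 => by rw [h0] at hs'; norm_num at hs')).comp_hasFDerivAt p h1
    rw [hsin p hp] at h2
    have e : -(1 / (distLine A B p * (dist p A)⁻¹)) = -(dist p A * (distLine A B p)⁻¹) := by
      field_simp
    rw [e] at h2
    exact h2.congr_of_eventuallyEq (Filter.Eventually.of_forall fun q => angle_eq_arccos q)
  have hsm : ∀ p ∈ S, ContDiffAt ℝ ∞ (fun p => EuclideanGeometry.angle p A B) p := fun p hp => by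
    have hpA : 0 < dist p A := dist_pos.2 (hne p hp)
    have hs : 0 < √(1 - c p ^ 2) := by
      rw [hsin p (h p hp)]
      have := h p hp
      positivity
    have hs' := Real.sqrt_pos.1 hs
    have h2 := (Real.contDiffAt_arccos (n := ∞) (x := c p)
      (fun h0 => by rw [h0] at hs'; norm_num at hs')
      (fun h0 => by rw [h0] at hs'; norm_num at hs')).comp p ((hcs hne).1 p hp)
    exact h2.congr_of_eventuallyEq (Filter.Eventually.of_forall fun q => angle_eq_arccos q)
  have hd0 : ∀ p ∈ S, 0 ≤ distLine A B p := fun p hp => (h p hp).le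
  have hf' : SymbolOn S (fun p => 1 / distLine A B p) (distLine A B)
      (fun p => -(dist p A * (distLine A B p)⁻¹) • fderiv ℝ c p) := by
    have hρ : ∀ p ∈ S, 0 < dist p A := fun p hp => dist_pos.2 (hne p hp)
    have hle : ∀ p ∈ S, distLine A B p ≤ 1 * dist p A := fun p _ => by
      simpa using distLine_le_left A B p
    have s1 := (symbolOn_dist hne).rescale hd0 hle (fun p hp => (hρ p hp).le)
    have s2 := (symbolOn_distLine h).rpow h h (-1)
    have s3 := ((hcs hne).fderiv hρ).rescale hd0 hle (fun p hp => (hρ p hp).le)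
    simp only [Real.rpow_neg_one] at s2
    have s4 := ((s1.mul s2 hd0).clm_comp (-ContinuousLinearMap.id ℝ ℝ) hd0).smul s3 hd0
    refine (s4.congr_fun (m' := fun p => 1 / distLine A B p) fun p hp => ?_)
    have := hρ p hp
    field_simp
  refine SymbolOn.of_fderiv hsm (C := Real.pi) Real.pi_pos.le (fun p _ => ?_) h (fun p hp => ?_) hf'
  · rw [Real.norm_of_nonneg (EuclideanGeometry.angle_nonneg _ _ _), mul_one]
    exact EuclideanGeometry.angle_le_pi _ _ _
  · filter_upwards [isOpen_distLine_pos.mem_nhds (h p hp)] with q hq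
    exact (hder q hq).fderiv

end Segment

/-! ### The cylindrical angle -/

section Cylinder

/-- The argument of `z` in `[0, 2π)`. -/
noncomputable def posArg (z : ℂ) : ℝ := if 0 ≤ z.arg then z.arg else z.arg + 2 * Real.pi

theorem posArg_nonneg (z : ℂ) : 0 ≤ posArg z := by
  rw [posArg]
  split_ifs with h
  · exact h
  · linarith [Complex.neg_pi_lt_arg z, Real.pi_pos]

theorem posArg_le (z : ℂ) : posArg z ≤ 2 * Real.pi := by
  rw [posArg]
  split_ifs with h
  · linarith [Complex.arg_le_pi z, Real.pi_pos]
  · linarith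

/-- Replacing `z` by `-z` moves the cut of the logarithm to the nonnegative half-axis, where
`posArg` jumps. -/
theorem posArg_eq {z : ℂ} (h : -z ∈ Complex.slitPlane) :
    posArg z = (Complex.log (-z)).im + Real.pi := by
  rw [Complex.log_im, posArg]
  rcases lt_trichotomy z.im 0 with h0 | h0 | h0
  · rw [if_neg (not_le.2 (Complex.arg_neg_iff.2 h0)), Complex.arg_neg_eq_arg_add_pi_of_im_neg h0]
    ring
  · have hre : z.re < 0 := by
      rcases h with h | h
      · simpa using h
      · simp [h0] at h
    have e : z = ((z.re : ℝ) : ℂ) := Complex.ext rfl (by simp [h0])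
    rw [e, Complex.arg_ofReal_of_neg hre, if_pos Real.pi_pos.le, ← Complex.ofReal_neg,
      Complex.arg_ofReal_of_nonneg (by linarith), zero_add]
  · rw [if_pos (Complex.arg_nonneg_iff.2 h0.le), Complex.arg_neg_eq_arg_sub_pi_of_im_pos h0]
    ring

theorem neg_mem_slitPlane_of_posArg_ne_zero {z : ℂ} (h : posArg z ≠ 0) :
    -z ∈ Complex.slitPlane := by
  by_contra h1
  simp only [Complex.mem_slitPlane_iff, Complex.neg_re, Complex.neg_im, not_or, not_lt, ne_eq,
    neg_eq_zero, not_not] at h1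
  have e : z = ((z.re : ℝ) : ℂ) := Complex.ext rfl (by simp [h1.2])
  refine h ?_
  rw [e, posArg, Complex.arg_ofReal_of_nonneg (by linarith), if_pos le_rfl]

/-- The complex coordinate in the plane spanned by `ν` and `n`. -/
noncomputable def cplx (A ν n p : E3) : ℂ := ⟨inner ℝ (p - A) ν, inner ℝ (p - A) n⟩

theorem cplx_eq (A ν n p : E3) : cplx A ν n p =
    (Complex.ofRealCLM.comp (innerSL ℝ ν) + (Complex.I • Complex.ofRealCLM).comp (innerSL ℝ n)) p +
      -(Complex.ofRealCLM.comp (innerSL ℝ ν) +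
        (Complex.I • Complex.ofRealCLM).comp (innerSL ℝ n)) A := by
  apply Complex.ext <;> simp [cplx, real_inner_comm, inner_sub_left, ← sub_eq_add_neg]

theorem norm_cplx_sq (A ν n p : E3) :
    ‖cplx A ν n p‖ ^ 2 = inner ℝ (p - A) ν ^ 2 + inner ℝ (p - A) n ^ 2 := by
  rw [Complex.sq_norm, Complex.normSq_apply, cplx]
  ring

variable {A B ν n : E3}

theorem exists_orthonormalBasis_edge (hAB : A ≠ B) (hν : ‖ν‖ = 1) (hn : ‖n‖ = 1)
    (h1 : inner ℝ ν n = (0 : ℝ)) (h2 : inner ℝ (B - A) ν = (0 : ℝ))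
    (h3 : inner ℝ (B - A) n = (0 : ℝ)) :
    ∃ b : OrthonormalBasis (Fin 3) ℝ E3, b 0 = ‖B - A‖⁻¹ • (B - A) ∧ b 1 = ν ∧ b 2 = n := by
  have hu : ‖B - A‖ ≠ 0 := norm_ne_zero_iff.2 (sub_ne_zero.2 hAB.symm)
  have ho : Orthonormal ℝ ![‖B - A‖⁻¹ • (B - A), ν, n] := by
    constructor
    · intro i
      fin_cases i
      · simp [norm_smul, hu]
      · simpa using hν
      · simpa using hn
    · intro i j hij
      have h1' : inner ℝ n ν = (0 : ℝ) := by rw [real_inner_comm]; exact h1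
      have h2' : inner ℝ ν (B - A) = (0 : ℝ) := by rw [real_inner_comm]; exact h2
      have h3' : inner ℝ n (B - A) = (0 : ℝ) := by rw [real_inner_comm]; exact h3
      fin_cases i <;> fin_cases j <;>
        simp_all [real_inner_smul_left, real_inner_smul_right]
  have hcard : Fintype.card (Fin 3) = Module.finrank ℝ E3 := by simp
  refine ⟨(basisOfOrthonormalOfCardEqFinrank ho hcard).toOrthonormalBasis (by simpa using ho), ?_⟩
  simp

/-- Parseval's identity in the basis formed by the edge direction, `ν` and `n`: removing the
component along the edge leaves the distance to its line. -/
theorem norm_cplx (hAB : A ≠ B) (hν : ‖ν‖ = 1) (hn : ‖n‖ = 1)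
    (h1 : inner ℝ ν n = (0 : ℝ)) (h2 : inner ℝ (B - A) ν = (0 : ℝ))
    (h3 : inner ℝ (B - A) n = (0 : ℝ)) (p : E3) : ‖cplx A ν n p‖ = distLine A B p := by
  obtain ⟨b, b0, b1, b2⟩ := exists_orthonormalBasis_edge hAB hν hn h1 h2 h3
  refine (sq_eq_sq₀ (norm_nonneg _) (distLine_nonneg _ _ _)).1 ?_
  have := b.sum_sq_norm_inner_left (p - A)
  rw [norm_cplx_sq, distLine_eq_norm, norm_orthProj_sq (sub_ne_zero.2 hAB.symm), ← this,
    Fin.sum_univ_three, b0, b1, b2]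
  simp only [real_inner_smul_right, Real.norm_eq_abs, sq_abs, real_inner_comm (p - A) (B - A)]
  ring

variable {S : Set E3}

/-- The differential of the argument is `Im (dz/z) = (Re z dn - Im z dν)/|z|²`. It is built from
`z`, its norm and constant covectors, and has size `1/|z|`. -/
theorem symbolOn_posArg (h : ∀ p ∈ S, -cplx A ν n p ∈ Complex.slitPlane) :
    SymbolOn S (fun _ => 1) (fun p => ‖cplx A ν n p‖) (fun p => posArg (cplx A ν n p)) := by
  set L := Complex.ofRealCLM.comp (innerSL ℝ ν) + (Complex.I • Complex.ofRealCLM).comp (innerSL ℝ n)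
    with hL
  set z := cplx A ν n with hz
  have hzL : z = fun p => L p + -L A := by
    ext1 p
    exact cplx_eq A ν n p
  have hzd : ∀ p, HasFDerivAt z L p := fun p => by
    rw [hzL]
    exact L.hasFDerivAt.add_const _
  have hzc : Continuous z := by rw [hzL]; fun_prop
  have hopen : IsOpen {p | -z p ∈ Complex.slitPlane} :=
    Complex.isOpen_slitPlane.preimage hzc.neg
  have hz0 : ∀ p, -z p ∈ Complex.slitPlane → 0 < ‖z p‖ := fun p hp => by
    rw [← norm_neg]
    exact norm_pos_iff.2 (Complex.slitPlane_ne_zero hp)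
  have hpos : ∀ p ∈ S, 0 < ‖z p‖ := fun p hp => hz0 p (h p hp)
  have hd0 : ∀ p ∈ S, 0 ≤ ‖z p‖ := fun p hp => (hpos p hp).le
  set f' : E3 → E3 →L[ℝ] ℝ := fun p => ‖z p‖ ^ (-2 : ℝ) •
    ((z p).re • innerSL ℝ n - (z p).im • innerSL ℝ ν) with hf'
  have hloc : ∀ p, -z p ∈ Complex.slitPlane → (fun p => posArg (z p)) =ᶠ[𝓝 p]
      fun p => Complex.imCLM (Complex.log (-z p)) + Real.pi := fun p hp => by
    filter_upwards [hopen.mem_nhds hp] with q hq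
    exact posArg_eq hq
  have hder : ∀ p, -z p ∈ Complex.slitPlane →
      HasFDerivAt (fun p => posArg (z p)) (f' p) p := fun p hp => by
    have h0 : HasFDerivAt (fun p => Complex.log (-z p)) ((-z p)⁻¹ • -L) p :=
      (Complex.hasStrictDerivAt_log hp).hasDerivAt.comp_hasFDerivAt_of_eq p (hzd p).neg rfl
    have h1 := (Complex.imCLM.hasFDerivAt.comp p h0).add_const Real.pi
    have h2 := h1.congr_of_eventuallyEq (hloc p hp)
    have e : f' p = Complex.imCLM.comp ((-z p)⁻¹ • -L) := by
      have hzp := hz0 p hp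
      ext v
      have hL1 : L v = (inner ℝ ν v : ℝ) + Complex.I * (inner ℝ n v : ℝ) := by simp [hL]
      simp only [hf', Real.rpow_neg hzp.le, Real.rpow_two, Complex.sq_norm]
      simp only [_root_.smul_apply, _root_.sub_apply, smul_eq_mul,
        innerSL_apply_apply, ContinuousLinearMap.comp_apply, _root_.neg_apply, hL1,
        inv_neg, neg_mul_neg, Complex.imCLM_apply]
      simp [Complex.inv_re, Complex.inv_im]
      ring
    rw [e]
    exact h2
  refine SymbolOn.of_fderiv (fun p hp => ?_) (C := 2 * Real.pi) (by positivity) (fun p _ => ?_)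
    hpos (fun p hp => ?_) (f' := f') ?_
  · refine ContDiffAt.congr_of_eventuallyEq ?_ (hloc p (h p hp))
    have h1 : ContDiffAt ℝ ∞ (fun p => -z p) p := by
      rw [hzL]
      fun_prop
    have h2 : ContDiffAt ℝ ∞ Complex.log (-z p) :=
      (Complex.contDiffAt_log (n := ∞) (h p hp)).restrict_scalars ℝ
    exact (Complex.imCLM.contDiff.contDiffAt.comp p (h2.comp p h1)).add contDiffAt_const
  · rw [Real.norm_of_nonneg (posArg_nonneg _), mul_one]
    exact posArg_le _
  · filter_upwards [hopen.mem_nhds (h p hp)] with q hq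
    exact (hder q hq).fderiv
  · have s0 : SymbolOn S (fun p => ‖z p‖) (fun p => ‖z p‖) z := by
      have := SymbolOn.affine (S := S) (m := fun p => ‖z p‖) (d := fun p => ‖z p‖) (L := L)
        (c := -L A) zero_le_one hd0 (fun p _ => by simp [hzL]) (fun p _ => by simp)
      rwa [← hzL] at this
    have s1 : SymbolOn S (fun p => ‖z p‖) (fun p => ‖z p‖) (fun p => ‖z p‖) := by
      have := SymbolOn.norm_affine (S := S) L (-L A) fun p hp => by
        have := norm_pos_iff.1 (hpos p hp)
        rwa [hzL] at this
      rw [hzL]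
      exact this
    have s2 := s1.rpow hpos hpos (-2)
    have s3 := s0.clm_comp Complex.reCLM hd0
    have s4 := s0.clm_comp (-Complex.imCLM) hd0
    have c1 : ∀ T : E3 →L[ℝ] ℝ, SymbolOn S (fun _ => 1) (fun p => ‖z p‖) fun _ => T := fun T =>
      SymbolOn.const T (norm_nonneg T) (by simp) (by simp)
    have s5 := s2.smul ((s3.smul (c1 (innerSL ℝ n)) hd0).add (s4.smul (c1 (innerSL ℝ ν)) hd0) hd0)
      hd0
    refine (s5.congr_fun (m' := fun p => 1 / ‖z p‖) fun p hp => ?_).congr fun p hp =>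
      Filter.Eventually.of_forall fun q => ?_
    · have := hpos p hp
      rw [Real.rpow_neg this.le, Real.rpow_two]
      field_simp
    · simp [hf', sub_eq_add_neg]

end Cylinder

/-! ### The modified distance to an edge -/

section ModRad

variable {A B : E3} {ψ : ℝ → ℝ} {α : ℝ} {S : Set E3}

theorem angle_mem_Icc (p A B : E3) : EuclideanGeometry.angle p A B ∈ Icc 0 Real.pi :=
  ⟨EuclideanGeometry.angle_nonneg _ _ _, EuclideanGeometry.angle_le_pi _ _ _⟩

/-- A smooth cut-off function of an angle. -/
structure IsAngleCutoff (ψ : ℝ → ℝ) (α : ℝ) : Prop where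
  pos : 0 < α
  lt : 2 * α < Real.pi
  smooth : ContDiff ℝ ∞ ψ
  mapsTo : MapsTo ψ (Icc 0 Real.pi) (Icc 0 1)
  eq_one : ∀ x ∈ Icc 0 α, ψ x = 1
  eq_zero : ∀ x ∈ Icc (2 * α) Real.pi, ψ x = 0

theorem symbolOn_comp_angle (hAB : A ≠ B) (hψ : ContDiff ℝ ∞ ψ)
    (h : ∀ p ∈ S, 0 < distLine A B p) :
    SymbolOn S (fun _ => 1) (distLine A B) (fun p => ψ (EuclideanGeometry.angle p A B)) :=
  (symbolOn_angle hAB h).comp h isCompact_Icc (fun p _ => angle_mem_Icc p A B)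
    fun _ _ => hψ.contDiffAt

theorem IsAngleCutoff.nonneg (hψ : IsAngleCutoff ψ α) (p A B : E3) :
    0 ≤ ψ (EuclideanGeometry.angle p A B) := (hψ.mapsTo (angle_mem_Icc p A B)).1

theorem IsAngleCutoff.le_one (hψ : IsAngleCutoff ψ α) (p A B : E3) :
    ψ (EuclideanGeometry.angle p A B) ≤ 1 := (hψ.mapsTo (angle_mem_Icc p A B)).2

theorem IsAngleCutoff.eq_one_of_lt (hψ : IsAngleCutoff ψ α) {p : E3}
    (h : EuclideanGeometry.angle p A B < α) : ψ (EuclideanGeometry.angle p A B) = 1 :=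
  hψ.eq_one _ ⟨EuclideanGeometry.angle_nonneg _ _ _, h.le⟩

theorem IsAngleCutoff.eq_zero_of_lt (hψ : IsAngleCutoff ψ α) {p : E3}
    (h : 2 * α < EuclideanGeometry.angle p A B) : ψ (EuclideanGeometry.angle p A B) = 0 :=
  hψ.eq_zero _ ⟨h.le, EuclideanGeometry.angle_le_pi _ _ _⟩

theorem IsAngleCutoff.eventually_eq_one (hψ : IsAngleCutoff ψ α) (hAB : A ≠ B) {p : E3}
    (hp : p ≠ A) (h : EuclideanGeometry.angle p A B < α) :
    ∀ᶠ q in 𝓝 p, ψ (EuclideanGeometry.angle q A B) = 1 := by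
  filter_upwards [(continuousAt_angle_left hAB hp).eventually (gt_mem_nhds h)] with q hq
  exact hψ.eq_one_of_lt hq

theorem IsAngleCutoff.eventually_eq_zero (hψ : IsAngleCutoff ψ α) (hAB : A ≠ B) {p : E3}
    (hp : p ≠ A) (h : 2 * α < EuclideanGeometry.angle p A B) :
    ∀ᶠ q in 𝓝 p, ψ (EuclideanGeometry.angle q A B) = 0 := by
  filter_upwards [(continuousAt_angle_left hAB hp).eventually (lt_mem_nhds h)] with q hq
  exact hψ.eq_zero_of_lt hq

/-- A bound for the distance to a vertex in the transition region of the cut-off function. -/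
theorem IsAngleCutoff.exists_dist_le (hψ : IsAngleCutoff ψ α) (hAB : A ≠ B) :
    ∃ C : ℝ, 0 ≤ C ∧ ∀ p, α ≤ EuclideanGeometry.angle p A B →
      EuclideanGeometry.angle p A B ≤ 2 * α → dist p A ≤ C * distLine A B p := by
  -- Chosen so that the transition interval `[α, 2α]` lies in `[s, π - s]`, where the sine is at
  -- least `sin s`.
  set s := min α (Real.pi - 2 * α)
  have hs : 0 < s := lt_min hψ.pos (by linarith [hψ.lt])
  have hsin : 0 < Real.sin s :=
    Real.sin_pos_of_pos_of_lt_pi hs ((min_le_left _ _).trans_lt (by linarith [hψ.lt, hψ.pos]))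
  refine ⟨(Real.sin s)⁻¹, by positivity, fun p h1 h2 => ?_⟩
  rw [inv_mul_eq_div, le_div_iff₀ hsin]
  exact dist_mul_sin_le hAB hs.le ((min_le_left _ _).trans h1)
    (by linarith [min_le_right α (Real.pi - 2 * α)])

/-- The angle is singular on the line, but the cut-off is locally constant near angles 0 and `π`. In
the transition region the distance to the line is comparable with that to `A`, so the estimate for
the angle may be used. -/
theorem IsAngleCutoff.symbolOn (hψ : IsAngleCutoff ψ α) (hAB : A ≠ B) (hS : ∀ p ∈ S, p ≠ A) :
    SymbolOn S (fun _ => 1) (fun p => dist p A) (fun p => ψ (EuclideanGeometry.angle p A B)) := by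
  obtain ⟨C, hC, hC'⟩ := hψ.exists_dist_le hAB
  set φ := fun p => EuclideanGeometry.angle p A B
  have h1 : SymbolOn {p ∈ S | φ p < α} (fun _ => 1) (fun p => dist p A) (fun p => ψ (φ p)) :=
    (SymbolOn.const (1 : ℝ) zero_le_one (by simp) (by simp)).congr fun p hp =>
      hψ.eventually_eq_one hAB (hS p hp.1) hp.2
  have h2 : SymbolOn {p ∈ S | 2 * α < φ p} (fun _ => 1) (fun p => dist p A) (fun p => ψ (φ p)) :=
    SymbolOn.zero_of_eventuallyEq (fun p hp => hψ.eventually_eq_zero hAB (hS p hp.1) hp.2) (by simp)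
  have hpos : ∀ p ∈ {p ∈ S | α ≤ φ p ∧ φ p ≤ 2 * α}, 0 < distLine A B p := fun p hp => by
    have := hC' p hp.2.1 hp.2.2
    have h0 : 0 < dist p A := dist_pos.2 (hS p hp.1)
    exact pos_of_mul_pos_right (h0.trans_le this) hC
  have h3 : SymbolOn {p ∈ S | α ≤ φ p ∧ φ p ≤ 2 * α} (fun _ => 1) (fun p => dist p A)
      (fun p => ψ (φ p)) :=
    (symbolOn_comp_angle hAB hψ.smooth hpos).rescale (fun _ _ => dist_nonneg)
      (fun p hp => hC' p hp.2.1 hp.2.2) fun p hp => (hpos p hp).le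
  refine ((h1.union h2 (by simp)).union h3 (by simp)).mono_set fun p hp => ?_
  rcases lt_or_ge (φ p) α with h | h
  · exact Or.inl (Or.inl ⟨hp, h⟩)
  · rcases lt_or_ge (2 * α) (φ p) with h' | h'
    · exact Or.inl (Or.inr ⟨hp, h'⟩)
    · exact Or.inr ⟨hp, h, h'⟩

/-- The modified distance to the edge `[AB]`. -/
noncomputable def modRad (ψ : ℝ → ℝ) (A B p : E3) : ℝ :=
  ψ (EuclideanGeometry.angle p A B) * ψ (EuclideanGeometry.angle p B A) * distLine A B p +
    (1 - ψ (EuclideanGeometry.angle p A B)) * dist p A +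
    (1 - ψ (EuclideanGeometry.angle p B A)) * dist p B

theorem modRad_comm (ψ : ℝ → ℝ) (A B p : E3) : modRad ψ A B p = modRad ψ B A p := by
  rw [modRad, modRad, distLine_comm]
  ring

theorem IsAngleCutoff.modRad_nonneg (hψ : IsAngleCutoff ψ α) (p : E3) : 0 ≤ modRad ψ A B p := by
  have h1 := hψ.nonneg p A B
  have h2 := hψ.nonneg p B A
  have h3 := sub_nonneg.2 (hψ.le_one p A B)
  have h4 := sub_nonneg.2 (hψ.le_one p B A)
  have h5 := distLine_nonneg A B p
  rw [modRad]
  positivity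

theorem IsAngleCutoff.le_modRad_left (hψ : IsAngleCutoff ψ α) (p : E3) :
    (1 - ψ (EuclideanGeometry.angle p A B)) * dist p A ≤ modRad ψ A B p := by
  have h1 := hψ.nonneg p A B
  have h2 := hψ.nonneg p B A
  have h4 := sub_nonneg.2 (hψ.le_one p B A)
  have h5 := distLine_nonneg A B p
  have h6 : 0 ≤ ψ (EuclideanGeometry.angle p A B) * ψ (EuclideanGeometry.angle p B A) *
    distLine A B p := by positivity
  have h7 : 0 ≤ (1 - ψ (EuclideanGeometry.angle p B A)) * dist p B := by positivity
  rw [modRad]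
  linarith

/-- If one cut-off is at most 1/2, the corresponding vertex term is at least half the distance to
the vertex; otherwise the product of the cut-offs is at least 1/4. -/
theorem IsAngleCutoff.distLine_le_modRad (hψ : IsAngleCutoff ψ α) (p : E3) :
    distLine A B p ≤ 4 * modRad ψ A B p := by
  have h1 := hψ.nonneg p A B
  have h2 := hψ.nonneg p B A
  have h5 := distLine_nonneg A B p
  rcases le_total (ψ (EuclideanGeometry.angle p A B)) (1 / 2) with h | h
  · have := hψ.le_modRad_left (A := A) (B := B) p
    nlinarith [distLine_le_left A B p, dist_nonneg (x := p) (y := A)]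
  · rcases le_total (ψ (EuclideanGeometry.angle p B A)) (1 / 2) with h' | h'
    · have := hψ.le_modRad_left (A := B) (B := A) p
      rw [modRad_comm]
      nlinarith [distLine_le_right A B p, dist_nonneg (x := p) (y := B)]
    · have h3 := sub_nonneg.2 (hψ.le_one p A B)
      have h4 := sub_nonneg.2 (hψ.le_one p B A)
      have h6 : 0 ≤ (1 - ψ (EuclideanGeometry.angle p A B)) * dist p A := by positivity
      have h7 : 0 ≤ (1 - ψ (EuclideanGeometry.angle p B A)) * dist p B := by positivity
      have h8 : 1 / 2 * (1 / 2) ≤ ψ (EuclideanGeometry.angle p A B) *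
        ψ (EuclideanGeometry.angle p B A) := mul_le_mul h h' (by norm_num) h1
      rw [modRad]
      nlinarith [mul_le_mul_of_nonneg_right h8 h5]

theorem IsAngleCutoff.mul_distLine_le (hψ : IsAngleCutoff ψ α) (p : E3) :
    ψ (EuclideanGeometry.angle p A B) * ψ (EuclideanGeometry.angle p B A) * distLine A B p ≤
      distLine A B p :=
  mul_le_of_le_one_left (distLine_nonneg _ _ _)
    (mul_le_one₀ (hψ.le_one p A B) (hψ.nonneg p B A) (hψ.le_one p B A))

/-- The term with `dist p B` is present only where the angle at `B` is at least `α`, and there `dist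
p B` is bounded by a multiple of `dist p A`. -/
theorem IsAngleCutoff.exists_modRad_le_dist (hψ : IsAngleCutoff ψ α) (hAB : A ≠ B) :
    ∃ C : ℝ, 0 ≤ C ∧ ∀ p, modRad ψ A B p ≤ C * dist p A := by
  have hsin : 0 < Real.sin α :=
    Real.sin_pos_of_pos_of_lt_pi hψ.pos (by linarith [hψ.lt, hψ.pos])
  refine ⟨2 + (Real.sin α)⁻¹, by positivity, fun p => ?_⟩
  have h1 := hψ.mul_distLine_le (A := A) (B := B) p
  have h2 := distLine_le_left A B p
  have h3 : (1 - ψ (EuclideanGeometry.angle p A B)) * dist p A ≤ dist p A :=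
    mul_le_of_le_one_left dist_nonneg (by linarith [hψ.nonneg p A B])
  have h4 : (1 - ψ (EuclideanGeometry.angle p B A)) * dist p B ≤ (Real.sin α)⁻¹ * dist p A := by
    rcases lt_or_ge (EuclideanGeometry.angle p B A) α with h | h
    · rw [hψ.eq_one_of_lt h, sub_self, zero_mul]
      positivity
    · refine (mul_le_of_le_one_left dist_nonneg (by linarith [hψ.nonneg p B A])).trans ?_
      rw [inv_mul_eq_div, le_div_iff₀ hsin]
      exact dist_mul_sin_le_dist hAB.symm hψ.pos.le (by linarith [hψ.lt]) h
  rw [modRad]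
  linarith

/-- Away from the parts of the line outside the edge, the modified distance is bounded by the
distance to the line. -/
theorem IsAngleCutoff.exists_modRad_le_distLine (hψ : IsAngleCutoff ψ α) (hAB : A ≠ B) {s : ℝ}
    (hs : 0 < s) : ∃ C : ℝ, 0 ≤ C ∧ ∀ p, EuclideanGeometry.angle p A B ≤ Real.pi - s →
      EuclideanGeometry.angle p B A ≤ Real.pi - s → modRad ψ A B p ≤ C * distLine A B p := by
  set t := min s α
  have ht : 0 < t := lt_min hs hψ.pos
  have hsin : 0 < Real.sin t := Real.sin_pos_of_pos_of_lt_pi ht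
    ((min_le_right _ _).trans_lt (by linarith [hψ.lt, hψ.pos]))
  have key : ∀ {A B : E3}, A ≠ B → ∀ p, EuclideanGeometry.angle p A B ≤ Real.pi - s →
      (1 - ψ (EuclideanGeometry.angle p A B)) * dist p A ≤ (Real.sin t)⁻¹ * distLine A B p := by
    intro A B hAB p hp
    have h0 := distLine_nonneg A B p
    rcases lt_or_ge (EuclideanGeometry.angle p A B) α with h | h
    · rw [hψ.eq_one_of_lt h, sub_self, zero_mul]
      positivity
    · refine (mul_le_of_le_one_left dist_nonneg (by linarith [hψ.nonneg p A B])).trans ?_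
      rw [inv_mul_eq_div, le_div_iff₀ hsin]
      exact dist_mul_sin_le hAB ht.le ((min_le_right _ _).trans h)
        (by linarith [min_le_left s α])
  refine ⟨1 + 2 * (Real.sin t)⁻¹, by positivity, fun p hA hB => ?_⟩
  have h1 := hψ.mul_distLine_le (A := A) (B := B) p
  have h2 := key hAB p hA
  have h3 := key hAB.symm p hB
  rw [distLine_comm] at h3
  rw [modRad]
  linarith

/-- Off the line use the distance to it. On the line outside the segment one of the two angles is
`π`; its cut-off vanishes and the distance to that vertex survives. -/
theorem IsAngleCutoff.modRad_pos (hψ : IsAngleCutoff ψ α) (hAB : A ≠ B) {p : E3}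
    (hp : p ∉ segment ℝ A B) : 0 < modRad ψ A B p := by
  have hA : 0 < dist p A := dist_pos.2 fun h => hp (h ▸ left_mem_segment ℝ A B)
  have hB : 0 < dist p B := dist_pos.2 fun h => hp (h ▸ right_mem_segment ℝ A B)
  rcases (distLine_nonneg A B p).lt_or_eq with h | h
  · linarith [hψ.distLine_le_modRad (A := A) (B := B) p]
  · have key : ∀ {A B : E3}, A ≠ B → 0 < dist p A → 0 = distLine A B p →
        EuclideanGeometry.angle p A B ≠ 0 → 0 < modRad ψ A B p := by
      intro A B hAB hA h h0
      rw [distLine_eq_sin hAB, eq_comm, mul_eq_zero] at h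
      have h1 : EuclideanGeometry.angle p A B = Real.pi := by
        by_contra h2
        refine (Real.sin_pos_of_pos_of_lt_pi
          ((EuclideanGeometry.angle_nonneg p A B).lt_of_ne' h0)
          ((EuclideanGeometry.angle_le_pi p A B).lt_of_ne h2)).ne' (h.resolve_left hA.ne')
      have h3 := hψ.le_modRad_left (A := A) (B := B) p
      rw [hψ.eq_zero_of_lt (by rw [h1]; exact hψ.lt), sub_zero, one_mul] at h3
      linarith
    by_cases h0 : EuclideanGeometry.angle p A B = 0
    · rw [modRad_comm]
      refine key hAB.symm hB (by rwa [distLine_comm]) fun h1 => ?_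
      exact hp (mem_segment_of_angle_eq_zero h0 h1)
    · exact key hAB hA h h0

/-- Each summand is estimated separately. A vertex term vanishes near points with angle below `α`;
above `2α` it is the full distance, hence at most the sum, and in between that distance is
controlled by the distance to the line. The edge term vanishes near points where either angle
exceeds `2α`; elsewhere the distance to the line is comparable with the sum. -/
theorem IsAngleCutoff.symbolOn_modRad (hψ : IsAngleCutoff ψ α) (hAB : A ≠ B) {w : E3 → ℝ} {C : ℝ}
    (hC : 0 ≤ C) (hS : ∀ p ∈ S, p ∉ segment ℝ A B) (hw : ∀ p ∈ S, 0 ≤ w p)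
    (hwC : ∀ p ∈ S, w p ≤ C * modRad ψ A B p) :
    SymbolOn S (modRad ψ A B) w (modRad ψ A B) := by
  have hnA : ∀ p ∈ S, p ≠ A := fun p hp h => hS p hp (h ▸ left_mem_segment ℝ A B)
  have hnB : ∀ p ∈ S, p ≠ B := fun p hp h => hS p hp (h ▸ right_mem_segment ℝ A B)
  have hR0 : ∀ p, 0 ≤ modRad ψ A B p := hψ.modRad_nonneg
  have cut : ∀ {A B : E3}, A ≠ B → (∀ p ∈ S, p ≠ A) → (∀ p ∈ S, w p ≤ C * modRad ψ A B p) →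
      SymbolOn S (fun _ => 1) w (fun p => ψ (EuclideanGeometry.angle p A B)) ∧
      SymbolOn S (fun p => dist p A) w (fun p => dist p A) := by
    intro A B hAB hA hw'
    obtain ⟨C', hC', h⟩ := hψ.exists_modRad_le_dist hAB
    have hle : ∀ p ∈ S, w p ≤ (C * C') * dist p A := fun p hp => by
      rw [mul_assoc]
      exact (hw' p hp).trans (mul_le_mul_of_nonneg_left (h p) hC)
    exact ⟨(hψ.symbolOn hAB hA).rescale hw hle fun _ _ => dist_nonneg,
      (symbolOn_dist hA).rescale hw hle fun _ _ => dist_nonneg⟩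
  have vert : ∀ {A B : E3}, A ≠ B → (∀ p ∈ S, p ≠ A) → (∀ p ∈ S, w p ≤ C * modRad ψ A B p) →
      SymbolOn S (modRad ψ A B) w
        (fun p => (1 - ψ (EuclideanGeometry.angle p A B)) * dist p A) := by
    intro A B hAB hA hw'
    obtain ⟨s1, s2⟩ := cut hAB hA hw'
    obtain ⟨C', hC', h⟩ := hψ.exists_dist_le hAB
    have t1 : SymbolOn {p ∈ S | EuclideanGeometry.angle p A B < α} (modRad ψ A B) w
        (fun p => (1 - ψ (EuclideanGeometry.angle p A B)) * dist p A) := by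
      refine SymbolOn.zero_of_eventuallyEq (fun p hp => ?_) fun p _ => hψ.modRad_nonneg p
      filter_upwards [hψ.eventually_eq_one hAB (hA p hp.1) hp.2] with q hq
      rw [hq, sub_self, zero_mul]
    have s3 : SymbolOn S (fun _ => 1) w (fun p => 1 + -ψ (EuclideanGeometry.angle p A B)) :=
      (SymbolOn.const (1 : ℝ) zero_le_one (by simp) (by simp)).add
        (s1.clm_comp (-ContinuousLinearMap.id ℝ ℝ) hw) hw
    have t2 : SymbolOn {p ∈ S | α ≤ EuclideanGeometry.angle p A B} (modRad ψ A B) w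
        (fun p => (1 - ψ (EuclideanGeometry.angle p A B)) * dist p A) := by
      simp only [sub_eq_add_neg]
      refine ((s3.mul s2 hw).mono_set (sep_subset _ _)).weaken (C := 1 + 4 * C') (by positivity)
        fun p hp => ?_
      have hR := hψ.modRad_nonneg (A := A) (B := B) p
      rw [one_mul]
      rcases lt_or_ge (2 * α) (EuclideanGeometry.angle p A B) with h' | h'
      · have h3 := hψ.le_modRad_left (A := A) (B := B) p
        rw [hψ.eq_zero_of_lt h', sub_zero, one_mul] at h3
        nlinarith [mul_nonneg hC' hR]
      · have h3 := h p hp.2 h'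
        nlinarith [mul_le_mul_of_nonneg_left (hψ.distLine_le_modRad (A := A) (B := B) p) hC']
    refine (t1.union t2 fun p _ => hψ.modRad_nonneg p).mono_set fun p hp => ?_
    rcases lt_or_ge (EuclideanGeometry.angle p A B) α with h | h
    · exact Or.inl ⟨hp, h⟩
    · exact Or.inr ⟨hp, h⟩
  have hcomm : modRad ψ B A = modRad ψ A B := funext fun p => modRad_comm ψ B A p
  have hwC' : ∀ p ∈ S, w p ≤ C * modRad ψ B A p := by rwa [hcomm]
  have v1 := vert hAB hnA hwC
  have v2 := vert hAB.symm hnB hwC'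
  rw [hcomm] at v2
  have v3 : SymbolOn S (modRad ψ A B) w (fun p => ψ (EuclideanGeometry.angle p A B) *
      ψ (EuclideanGeometry.angle p B A) * distLine A B p) := by
    have e1 : SymbolOn {p ∈ S | 2 * α < EuclideanGeometry.angle p A B} (modRad ψ A B) w (fun p =>
        ψ (EuclideanGeometry.angle p A B) * ψ (EuclideanGeometry.angle p B A) *
          distLine A B p) := by
      refine SymbolOn.zero_of_eventuallyEq (fun p hp => ?_) fun p _ => hR0 p
      filter_upwards [hψ.eventually_eq_zero hAB (hnA p hp.1) hp.2] with q hq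
      rw [hq, zero_mul, zero_mul]
    have e2 : SymbolOn {p ∈ S | 2 * α < EuclideanGeometry.angle p B A} (modRad ψ A B) w (fun p =>
        ψ (EuclideanGeometry.angle p A B) * ψ (EuclideanGeometry.angle p B A) *
          distLine A B p) := by
      refine SymbolOn.zero_of_eventuallyEq (fun p hp => ?_) fun p _ => hR0 p
      filter_upwards [hψ.eventually_eq_zero hAB.symm (hnB p hp.1) hp.2] with q hq
      rw [hq, mul_zero, zero_mul]
    set T := {p ∈ S | EuclideanGeometry.angle p A B ≤ 2 * α ∧ EuclideanGeometry.angle p B A ≤ 2 * α}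
    have hTS : T ⊆ S := sep_subset _ _
    obtain ⟨C', hC', h⟩ := hψ.exists_modRad_le_distLine hAB (s := Real.pi - 2 * α)
      (by linarith [hψ.lt])
    have hle : ∀ p ∈ T, modRad ψ A B p ≤ C' * distLine A B p := fun p hp =>
      h p (by linarith [hp.2.1]) (by linarith [hp.2.2])
    have hpos : ∀ p ∈ T, 0 < distLine A B p := fun p hp =>
      pos_of_mul_pos_right ((hψ.modRad_pos hAB (hS p hp.1)).trans_le (hle p hp)) hC'
    have hwT : ∀ p ∈ T, 0 ≤ w p := fun p hp => hw p hp.1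
    have e3 : SymbolOn T (modRad ψ A B) w (fun p => ψ (EuclideanGeometry.angle p A B) *
        ψ (EuclideanGeometry.angle p B A) * distLine A B p) := by
      have s := (symbolOn_distLine hpos).rescale hwT (C := C * C') (fun p hp => by
        rw [mul_assoc]
        exact (hwC p hp.1).trans (mul_le_mul_of_nonneg_left (hle p hp) hC)) fun p hp =>
          (hpos p hp).le
      refine ((((cut hAB hnA hwC).1.mono_set hTS).mul ((cut hAB.symm hnB hwC').1.mono_set hTS)
        hwT).mul s hwT).weaken (C := 4) (by norm_num) fun p _ => ?_
      rw [one_mul, one_mul]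
      exact hψ.distLine_le_modRad p
    refine ((e1.union e2 fun p _ => hR0 p).union e3 fun p _ => hR0 p).mono_set fun p hp => ?_
    rcases lt_or_ge (2 * α) (EuclideanGeometry.angle p A B) with h1 | h1
    · exact Or.inl (Or.inl ⟨hp, h1⟩)
    · rcases lt_or_ge (2 * α) (EuclideanGeometry.angle p B A) with h2 | h2
      · exact Or.inl (Or.inr ⟨hp, h2⟩)
      · exact Or.inr ⟨hp, h1, h2⟩
  exact (v3.add v1 hw).add v2 hw

end ModRad

namespace PolyhedralDomain

variable {P : PolyhedralDomain}

/-! ### Elementary geometry of polyhedral domains -/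

theorem notMem_frontier {p : E3} (hp : p ∈ P.dom) : p ∉ frontier (P.dom : Set E3) := by
  rw [P.dom.isOpen.frontier_eq]
  exact fun h => h.2 hp

theorem face_subset_frontier (j : Fin P.numFaces) :
    closure (P.face j) ⊆ frontier (P.dom : Set E3) := by
  rw [P.frontier_eq]
  exact subset_iUnion (fun j => closure (P.face j)) j

theorem segment_subset_closure_face {j : Fin P.numFaces} {i : Fin P.numEdges}
    (hi : i ∈ P.sides j) : segment ℝ (P.edge i).1 (P.edge i).2 ⊆ closure (P.face j) := by
  obtain ⟨Q, _, _, _, _, h, _⟩ := P.isPolygon j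
  exact fun x hx => (h.symm.subset (mem_biUnion hi hx)).1

theorem segment_subset_frontier (i : Fin P.numEdges) :
    segment ℝ (P.edge i).1 (P.edge i).2 ⊆ frontier (P.dom : Set E3) := by
  obtain ⟨j, hj⟩ := nonempty_of_ncard_ne_zero (by rw [P.side_of_two i]; norm_num :
    {j | i ∈ P.sides j}.ncard ≠ 0)
  exact (segment_subset_closure_face hj).trans (face_subset_frontier j)

theorem notMem_segment {p : E3} (hp : p ∈ P.dom) (i : Fin P.numEdges) :
    p ∉ segment ℝ (P.edge i).1 (P.edge i).2 := fun h =>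
  notMem_frontier hp (segment_subset_frontier i h)

theorem ne_fst {p : E3} (hp : p ∈ P.dom) (i : Fin P.numEdges) : p ≠ (P.edge i).1 := fun h =>
  notMem_segment hp i (h ▸ left_mem_segment ℝ _ _)

theorem ne_snd {p : E3} (hp : p ∈ P.dom) (i : Fin P.numEdges) : p ≠ (P.edge i).2 := fun h =>
  notMem_segment hp i (h ▸ right_mem_segment ℝ _ _)

theorem fst_mem_vertices (i : Fin P.numEdges) : (P.edge i).1 ∈ P.vertices := by
  simp [vertices]

theorem snd_mem_vertices (i : Fin P.numEdges) : (P.edge i).2 ∈ P.vertices := by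
  simp [vertices]

theorem ne_vertex {p v : E3} (hp : p ∈ P.dom) (hv : v ∈ P.vertices) : p ≠ v := by
  simp only [vertices, Finset.mem_union, Finset.mem_image, Finset.mem_univ, true_and] at hv
  rcases hv with ⟨i, rfl⟩ | ⟨i, rfl⟩
  · exact ne_fst hp i
  · exact ne_snd hp i

theorem exists_dist_le (P : PolyhedralDomain) (v : E3) :
    ∃ D : ℝ, 0 ≤ D ∧ ∀ p ∈ P.dom, dist p v ≤ D := by
  obtain ⟨r, hr⟩ := P.isBounded.subset_closedBall v
  exact ⟨r ⊔ 0, le_sup_right, fun p hp => le_sup_of_le_left (hr hp)⟩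

/-! ### The weight -/

variable {C : P.Coordinates}

/-- Positivity and upper bounds for the functions `r_e`. -/
structure Coordinates.RadBounds (C : P.Coordinates) : Prop where
  pos : ∀ i, ∀ p ∈ P.dom, 0 < C.rad i p
  le_fst : ∀ i, ∃ M : ℝ, 0 ≤ M ∧ ∀ p ∈ P.dom, C.rad i p ≤ M * dist p (P.edge i).1
  le_snd : ∀ i, ∃ M : ℝ, 0 ≤ M ∧ ∀ p ∈ P.dom, C.rad i p ≤ M * dist p (P.edge i).2

theorem exists_prod_le {ι : Type*} {S : Set E3} (s : Finset ι) (f : ι → E3 → ℝ)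
    (h0 : ∀ i ∈ s, ∀ p ∈ S, 0 ≤ f i p) (h : ∀ i ∈ s, ∃ M : ℝ, 0 ≤ M ∧ ∀ p ∈ S, f i p ≤ M) :
    ∃ M : ℝ, 0 ≤ M ∧ ∀ p ∈ S, ∏ i ∈ s, f i p ≤ M := by
  classical
  choose! M hM hM' using h
  exact ⟨∏ i ∈ s, M i, Finset.prod_nonneg hM, fun p hp =>
    Finset.prod_le_prod (fun i hi => h0 i hi p hp) fun i hi => hM' i hi p hp⟩

namespace Coordinates.RadBounds

variable (h : C.RadBounds)
include h

theorem quot_pos (i : Fin P.numEdges) {p : E3} (hp : p ∈ P.dom) :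
    0 < C.rad i p / (dist p (P.edge i).1 * dist p (P.edge i).2) :=
  div_pos (h.pos i p hp)
    (mul_pos (dist_pos.2 (ne_fst hp i)) (dist_pos.2 (ne_snd hp i)))

/-- Since `|AB| ≤ ρ_A + ρ_B`, multiply by `r_e` and bound `r_e` by a multiple of the other distance
in each term. -/
theorem exists_quot_le (i : Fin P.numEdges) : ∃ M : ℝ, 0 ≤ M ∧ ∀ p ∈ P.dom,
    C.rad i p / (dist p (P.edge i).1 * dist p (P.edge i).2) ≤ M := by
  obtain ⟨M, hM, h1⟩ := h.le_fst i
  obtain ⟨N, hN, h2⟩ := h.le_snd i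
  have hL : 0 < dist (P.edge i).1 (P.edge i).2 := dist_pos.2 (P.edge_ne i)
  set L := dist (P.edge i).1 (P.edge i).2
  refine ⟨2 * (M + N) / L, by positivity, fun p hp => ?_⟩
  have hA := dist_pos.2 (ne_fst hp i)
  have hB := dist_pos.2 (ne_snd hp i)
  rw [div_le_div_iff₀ (by positivity) hL]
  have h3 : L ≤ dist p (P.edge i).1 + dist p (P.edge i).2 := dist_triangle_left _ _ _
  have h1' := h1 p hp
  have h2' := h2 p hp
  have h0 := h.pos i p hp
  calc C.rad i p * L ≤ C.rad i p * (dist p (P.edge i).1 + dist p (P.edge i).2) := by gcongr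
    _ = C.rad i p * dist p (P.edge i).1 + C.rad i p * dist p (P.edge i).2 := by ring
    _ ≤ N * dist p (P.edge i).2 * dist p (P.edge i).1 +
        M * dist p (P.edge i).1 * dist p (P.edge i).2 := by gcongr
    _ = (M + N) * (dist p (P.edge i).1 * dist p (P.edge i).2) := by ring
    _ ≤ _ := by
        have : 0 ≤ (M + N) * (dist p (P.edge i).1 * dist p (P.edge i).2) := by positivity
        linarith

theorem rP_pos {p : E3} (hp : p ∈ P.dom) : 0 < C.rP p :=
  mul_pos (Finset.prod_pos fun i _ => h.quot_pos i hp)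
    (Finset.prod_pos fun _ hv => dist_pos.2 (ne_vertex hp hv))

theorem exists_rP_le : ∃ M : ℝ, 0 ≤ M ∧ ∀ p ∈ P.dom, C.rP p ≤ M := by
  obtain ⟨M, hM, h1⟩ := exists_prod_le (S := P.dom) Finset.univ
    (fun i p => C.rad i p / (dist p (P.edge i).1 * dist p (P.edge i).2))
    (fun i _ p hp => (h.quot_pos i hp).le) fun i _ => h.exists_quot_le i
  obtain ⟨N, hN, h2⟩ := exists_prod_le (S := P.dom) P.vertices (fun v p => dist p v)
    (fun _ _ _ _ => dist_nonneg) fun v _ => P.exists_dist_le v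
  exact ⟨M * N, by positivity, fun p hp => mul_le_mul (h1 p hp) (h2 p hp)
    (Finset.prod_nonneg fun _ _ => dist_nonneg) hM⟩

/-- Split off the factor of `v`; all remaining factors are bounded on the bounded domain. -/
theorem exists_rP_le_dist {v : E3} (hv : v ∈ P.vertices) :
    ∃ M : ℝ, 0 ≤ M ∧ ∀ p ∈ P.dom, C.rP p ≤ M * dist p v := by
  classical
  obtain ⟨M, hM, h1⟩ := exists_prod_le (S := P.dom) Finset.univ
    (fun i p => C.rad i p / (dist p (P.edge i).1 * dist p (P.edge i).2))
    (fun i _ p hp => (h.quot_pos i hp).le) fun i _ => h.exists_quot_le i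
  obtain ⟨N, hN, h2⟩ := exists_prod_le (S := P.dom) (P.vertices.erase v) (fun v p => dist p v)
    (fun _ _ _ _ => dist_nonneg) fun v _ => P.exists_dist_le v
  refine ⟨M * N, by positivity, fun p hp => ?_⟩
  rw [rP, ← Finset.prod_erase_mul _ _ hv, ← mul_assoc]
  exact mul_le_mul_of_nonneg_right (mul_le_mul (h1 p hp) (h2 p hp)
    (Finset.prod_nonneg fun _ _ => dist_nonneg) hM) dist_nonneg

/-- The denominator `ρ_A ρ_B` cancels against two factors of the vertex product, which are distinct
since `A ≠ B`. -/
theorem exists_rP_le_rad (i : Fin P.numEdges) :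
    ∃ M : ℝ, 0 ≤ M ∧ ∀ p ∈ P.dom, C.rP p ≤ M * C.rad i p := by
  classical
  obtain ⟨M, hM, h1⟩ := exists_prod_le (S := P.dom) (Finset.univ.erase i)
    (fun i p => C.rad i p / (dist p (P.edge i).1 * dist p (P.edge i).2))
    (fun i _ p hp => (h.quot_pos i hp).le) fun i _ => h.exists_quot_le i
  obtain ⟨N, hN, h2⟩ := exists_prod_le (S := P.dom)
    ((P.vertices.erase (P.edge i).1).erase (P.edge i).2) (fun v p => dist p v)
    (fun _ _ _ _ => dist_nonneg) fun v _ => P.exists_dist_le v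
  refine ⟨M * N, by positivity, fun p hp => ?_⟩
  have hA := dist_pos.2 (ne_fst hp i)
  have hB := dist_pos.2 (ne_snd hp i)
  have hB' : (P.edge i).2 ∈ P.vertices.erase (P.edge i).1 :=
    Finset.mem_erase.2 ⟨(P.edge_ne i).symm, snd_mem_vertices i⟩
  rw [rP, ← Finset.prod_erase_mul _ _ (fst_mem_vertices i), ← Finset.prod_erase_mul _ _ hB',
    ← Finset.prod_erase_mul _ _ (Finset.mem_univ i)]
  have h3 := mul_le_mul_of_nonneg_right (mul_le_mul (h1 p hp) (h2 p hp)
    (Finset.prod_nonneg fun _ _ => dist_nonneg) hM) (h.pos i p hp).le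
  refine le_trans (le_of_eq ?_) h3
  field_simp

/-- Every factor is a symbol of its own size at scale `r_P`, as `r_P` is bounded by a multiple of
each vertex distance; the product rule does the rest. -/
theorem isWeight (hsym : ∀ i, SymbolOn (P.dom : Set E3) (C.rad i) C.rP (C.rad i)) :
    IsWeight P.dom C.rP := by
  have hpos : ∀ p ∈ (P.dom : Set E3), 0 < C.rP p := fun p hp => h.rP_pos hp
  have hd : ∀ p ∈ (P.dom : Set E3), 0 ≤ C.rP p := fun p hp => (hpos p hp).le
  obtain ⟨M, _, hM⟩ := h.exists_rP_le
  refine ⟨fun p hp => h.rP_pos hp, ⟨M, hM⟩, ?_⟩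
  have hv : ∀ v ∈ P.vertices, SymbolOn (P.dom : Set E3) (fun p => dist p v) C.rP
      (fun p => dist p v) := fun v hv => by
    obtain ⟨N, _, hN⟩ := h.exists_rP_le_dist hv
    exact (symbolOn_dist fun p hp => ne_vertex hp hv).rescale hd hN fun _ _ => dist_nonneg
  have hvi : ∀ v ∈ P.vertices, SymbolOn (P.dom : Set E3) (fun p => (dist p v)⁻¹) C.rP
      (fun p => (dist p v)⁻¹) := fun v hv' => by
    have := (hv v hv').rpow hpos (fun p hp => dist_pos.2 (ne_vertex hp hv')) (-1)
    simpa only [Real.rpow_neg_one] using this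
  have hq : ∀ i ∈ (Finset.univ : Finset (Fin P.numEdges)), SymbolOn (P.dom : Set E3)
      (fun p => C.rad i p / (dist p (P.edge i).1 * dist p (P.edge i).2)) C.rP
      (fun p => C.rad i p / (dist p (P.edge i).1 * dist p (P.edge i).2)) := fun i _ => by
    simp only [div_eq_mul_inv, mul_inv]
    exact (hsym i).mul ((hvi _ (fst_mem_vertices i)).mul (hvi _ (snd_mem_vertices i)) hd) hd
  exact (SymbolOn.prod _ hq hd).mul (SymbolOn.prod _ hv hd) hd

end Coordinates.RadBounds

/-- The functions in `C^∞(ΣP)` are symbols of order zero. -/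
theorem Coordinates.isSymb_of_mem_smoothSigma (hw : IsWeight P.dom C.rP)
    (hang : ∀ c, SymbolOn (P.dom : Set E3) (fun _ => 1) C.rP (C.ang c)) {u : E3 → ℂ}
    (hu : u ∈ C.smoothSigma) : IsSymb P.dom C.rP 0 u := by
  have hd : ∀ p ∈ (P.dom : Set E3), 0 ≤ C.rP p := fun p hp => (hw.pos p hp).le
  obtain ⟨W, hW⟩ := hw.bdd
  obtain ⟨D, hD, hD'⟩ := P.exists_dist_le 0
  have hid : SymbolOn (P.dom : Set E3) (fun _ => 1) C.rP (fun p => p) := by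
    have := SymbolOn.affine (S := (P.dom : Set E3)) (m := fun _ => 1) (d := C.rP)
      (L := ContinuousLinearMap.id ℝ E3) (c := 0) (C := D + |W|) (by positivity) (by simp)
      (fun p hp => by
        have := hD' p hp
        rw [dist_zero_right] at this
        simp only [ContinuousLinearMap.id_apply, add_zero, mul_one]
        linarith [abs_nonneg W])
      (fun p hp => by
        have := hW p hp
        linarith [le_abs_self W])
    simpa using this
  have hG : SymbolOn (P.dom : Set E3) (fun _ => 1) C.rP (fun p => (p, fun c => C.ang c p)) :=
    hid.prodMk (SymbolOn.pi hang hd (by simp)) hd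
  have hopen : IsOpen ((P.dom : Set E3) ×ˢ (univ : Set (C.ι → ℝ))) :=
    P.dom.isOpen.prod isOpen_univ
  have hloc : ∀ f : E3 × (C.ι → ℝ) → ℂ, (∀ p ∈ P.dom, u p = f (p, fun c => C.ang c p)) →
      ∀ p ∈ P.dom, u =ᶠ[𝓝 p] fun p => f (p, fun c => C.ang c p) := fun f hf p hp => by
    filter_upwards [P.dom.isOpen.mem_nhds hp] with q hq
    exact hf q hq
  -- The function representing `u` may depend on the number of derivatives, so smoothness and
  -- estimates are proved one order at a time.
  refine ⟨fun p hp => contDiffAt_infty.2 fun n => ?_, fun n => ?_⟩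
  · obtain ⟨f, hf, _, hfu⟩ := hu n
    refine ContDiffAt.congr_of_eventuallyEq ?_ (hloc f hfu p hp)
    have h1 : ContDiffAt ℝ n f (p, fun c => C.ang c p) :=
      hf.contDiffAt (hopen.mem_nhds ⟨hp, mem_univ _⟩)
    exact ContDiffAt.comp (f := fun p => (p, fun c => C.ang c p)) p h1
      ((hG.1 p hp).of_le (by exact_mod_cast le_top))
  · obtain ⟨f, hf, ⟨M, hM⟩, hfu⟩ := hu n
    obtain ⟨N, hN, hN'⟩ := hG.exists_pow_bound hw.pos zero_le_one (fun _ _ => le_rfl) n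
    refine ⟨n.factorial * |M| * N ^ n, by positivity, fun p hp => ?_⟩
    have hp0 := hw.pos p hp
    have h1 : ContDiffAt ℝ n f (p, fun c => C.ang c p) :=
      hf.contDiffAt (hopen.mem_nhds ⟨hp, mem_univ _⟩)
    have h2 := norm_iteratedFDeriv_comp_le_at (f := fun p => (p, fun c => C.ang c p)) (x := p) h1
      ((hG.1 p hp).of_le (by exact_mod_cast le_top)) (C := |M|) (D := N / C.rP p)
      (fun i hi => (hM i hi _ ⟨hp, mem_univ _⟩).trans (le_abs_self M)) (hN' p hp)
    simp only [Real.rpow_zero, mul_one]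
    rw [((hloc f hfu p hp).iteratedFDeriv ℝ n).eq_of_nhds]
    rwa [div_pow, mul_div_assoc', le_div_iff₀ (by positivity)] at h2

/-! ### Operators on a polyhedral domain -/

/-- On a generator conjugation acts factor by factor, each `r_P ∂_j` contributing order one and no
weight shift; the span is handled by linearity. -/
theorem Coordinates.isOpFamily_conj_of_mem_diffOp (hw : IsWeight P.dom C.rP)
    (hang : ∀ c, SymbolOn (P.dom : Set E3) (fun _ => 1) C.rP (C.ang c)) {m : ℕ}
    {A : Module.End ℂ (Distr P.dom)} (hA : A ∈ C.diffOp m) :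
    IsOpFamily C.rP (conjBy P.dom C.rP A) m 0 := by
  induction hA using Submodule.span_induction with
  | mem A hA =>
    obtain ⟨u, hu, α, hα, rfl⟩ := hA
    have h0 := (isSymb_of_mem_smoothSigma hw hang hu).isOpFamily hw
    have h : ∀ i, IsOpFamily C.rP (fun lam => conjBy P.dom C.rP (C.rD i) lam ^ α i) (α i * 1)
        (α i * 0) := fun i => (isOpFamily_conjBy_rD hw i).pow (α i)
    have h1 := h0.mul (((h 0).mul (h 1)).mul (h 2))
    have e : ∀ lam, conjBy P.dom C.rP
        (mulOp P.dom u * (C.rD 0 ^ α 0 * C.rD 1 ^ α 1 * C.rD 2 ^ α 2)) lam = _ := fun lam => by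
      rw [conjBy_mul hw, conjBy_mul hw, conjBy_mul hw, conjBy_pow hw, conjBy_pow hw, conjBy_pow hw,
        conjBy_mulOp hw]
    have hle := mem_multiIdx.1 hα
    rw [Fin.sum_univ_three] at hle
    have h2 := h1.order_le (m' := m) (by omega)
    rw [show conjBy P.dom C.rP (mulOp P.dom u * (C.rD 0 ^ α 0 * C.rD 1 ^ α 1 * C.rD 2 ^ α 2)) = _
      from funext e]
    convert h2 using 1
    simp
  | zero =>
    rw [show conjBy P.dom C.rP 0 = fun _ => 0 from funext fun lam => by simp [conjBy]]
    exact IsOpFamily.zero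
  | add A B _ _ hA hB =>
    rw [show conjBy P.dom C.rP (A + B) = fun lam => conjBy P.dom C.rP A lam + conjBy P.dom C.rP B lam
      from funext fun lam => by simp [conjBy, mul_add, add_mul]]
    exact hA.add hB
  | smul c A _ hA =>
    rw [show conjBy P.dom C.rP (c • A) = fun lam => c • conjBy P.dom C.rP A lam
      from funext fun lam => by simp [conjBy]]
    exact hA.smul continuous_const

/-- The coefficient of `∂^α` is regarded as a symbol of order `|α| - m ≤ 0`, so that every term has
the same total shift `m`. -/
theorem isOpFamily_conjBy_of_isSmoothDiffOp {w : E3 → ℝ} (hw : IsWeight P.dom w) {m : ℕ}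
    {A : Module.End ℂ (Distr P.dom)} (hA : P.IsSmoothDiffOp m A) :
    IsOpFamily w (conjBy P.dom w A) m m := by
  obtain ⟨c, hc, rfl⟩ := hA
  have h : ∀ α ∈ multiIdx m,
      IsOpFamily w (conjBy P.dom w (mulOp P.dom (c α) * pdAlpha P.dom α)) m m := fun α hα => by
    have hle := mem_multiIdx.1 hα
    have hs : SymbolOn (P.dom : Set E3) (fun _ => 1) (fun _ => 1) (c α) := by
      refine ⟨fun p hp => (hc α hα).1.contDiffAt (P.dom.isOpen.mem_nhds hp), fun n => ?_⟩
      obtain ⟨M, hM⟩ := (hc α hα).2 n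
      exact ⟨|M|, abs_nonneg M, fun p hp => by simpa using (hM p hp).trans (le_abs_self M)⟩
    have hb : ((∑ i, α i : ℕ) : ℝ) - m ≤ 0 := by
      have : ((∑ i, α i : ℕ) : ℝ) ≤ m := by exact_mod_cast hle
      linarith
    have h1 := ((IsSymb.of_bounded hw hb hs).isOpFamily hw).mul (isOpFamily_conjBy_pdAlpha hw α)
    have h2 := h1.order_le (m' := m) (by simpa using hle)
    rw [show conjBy P.dom w (mulOp P.dom (c α) * pdAlpha P.dom α) = _ from
      funext fun lam => by rw [conjBy_mul hw, conjBy_mulOp hw]]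
    convert h2 using 1
    ring
  have := IsOpFamily.sum (multiIdx m) h
  rwa [show conjBy P.dom w (∑ α ∈ multiIdx m, mulOp P.dom (c α) * pdAlpha P.dom α) = _ from
    funext fun lam => conjBy_sum _ _ lam]

variable {P : PolyhedralDomain} {S : Set E3}

/-! ### Convex polyhedral domains -/

theorem mem_of_mem_openSegment (hP : Convex ℝ (P.dom : Set E3)) {x y z : E3} (hx : x ∈ P.dom)
    (hy : y ∈ frontier (P.dom : Set E3)) (hz : z ∈ openSegment ℝ x y) : z ∈ P.dom := by
  have := hP.openSegment_interior_closure_subset_interior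
    (by rwa [P.dom.isOpen.interior_eq]) (frontier_subset_closure hy) hz
  rwa [P.dom.isOpen.interior_eq] at this

/-- Edges lie in the boundary, so a point of the domain on the line would lie beyond an end point.
That end point would be strictly between it and the other end point, hence in the domain by
convexity. -/
theorem distLine_pos_of_convex (hP : Convex ℝ (P.dom : Set E3)) (i : Fin P.numEdges) {p : E3}
    (hp : p ∈ P.dom) : 0 < distLine (P.edge i).1 (P.edge i).2 p := by
  set A := (P.edge i).1
  set B := (P.edge i).2
  refine (distLine_nonneg A B p).lt_of_ne' fun h0 => ?_
  have hA : A ∈ frontier (P.dom : Set E3) :=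
    segment_subset_frontier i (left_mem_segment ℝ _ _)
  have hB : B ∈ frontier (P.dom : Set E3) :=
    segment_subset_frontier i (right_mem_segment ℝ _ _)
  rw [distLine_eq_norm, norm_eq_zero, orthProj_apply, sub_eq_zero] at h0
  obtain ⟨t, hpt⟩ : ∃ t : ℝ, p = A + t • (B - A) := ⟨_, by rw [← h0]; abel⟩
  rcases lt_or_ge t 0 with ht | ht
  · have h1 : (0 : ℝ) < 1 - t := by linarith
    refine notMem_frontier (mem_of_mem_openSegment hP hp hB
      (z := A) ⟨1 / (1 - t), -t / (1 - t), by positivity, div_pos (by linarith) h1, ?_, ?_⟩) hA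
    · field_simp
      ring
    · rw [hpt]
      have e : A = (1 - t)⁻¹ • ((1 - t) • A) := by rw [smul_smul, inv_mul_cancel₀ h1.ne', one_smul]
      conv_rhs => rw [e]
      rw [div_eq_inv_mul, div_eq_inv_mul, mul_smul, mul_smul, ← smul_add]
      congr 1
      module
  · rcases le_or_gt t 1 with ht1 | ht1
    · exact notMem_segment hp i ⟨1 - t, t, by linarith, ht, by ring, by rw [hpt]; module⟩
    · have h1 : 0 < t := by linarith
      refine notMem_frontier (mem_of_mem_openSegment hP hp hA
        (z := B) ⟨1 / t, (t - 1) / t, by positivity, div_pos (by linarith) h1, ?_, ?_⟩) hB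
      · field_simp
        ring
      · rw [hpt]
        have e : B = t⁻¹ • (t • B) := by rw [smul_smul, inv_mul_cancel₀ h1.ne', one_smul]
        conv_rhs => rw [e]
        rw [div_eq_inv_mul, div_eq_inv_mul, mul_smul, mul_smul, ← smul_add]
        congr 1
        module

/-- A convex polyhedral domain does not meet the plane of a face. -/
theorem notMem_plane_of_convex (hP : Convex ℝ (P.dom : Set E3)) {D U : Set E3}
    {Q : AffineSubspace ℝ E3} (hU : IsOpen U) (hD : D = U ∩ Q) {d p : E3} (hd : d ∈ D)
    (hDP : closure D ⊆ frontier (P.dom : Set E3)) (hp : p ∈ P.dom) : p ∉ Q := by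
  intro hpQ
  have hdQ : d ∈ Q := (hD.subset hd).2
  -- The face is relatively open, so one can move from `d` slightly away from `p` inside it; then
  -- `d` is strictly between `p` and a boundary point.
  have hcont : ContinuousAt (fun t : ℝ => d + t • (d - p)) 0 := by fun_prop
  have hev : ∀ᶠ t in 𝓝 (0 : ℝ), d + t • (d - p) ∈ U := by
    refine hcont.eventually_mem (hU.mem_nhds ?_)
    simpa using (hD.subset hd).1
  obtain ⟨t, ht, ht0⟩ := ((hev.filter_mono nhdsWithin_le_nhds).and
    (self_mem_nhdsWithin (s := Ioi (0 : ℝ)))).exists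
  have ht0 : 0 < t := ht0
  have heQ : d + t • (d - p) ∈ Q := by
    have := AffineMap.lineMap_mem (1 + t) hpQ hdQ
    rw [AffineMap.lineMap_apply, vsub_eq_sub, vadd_eq_add] at this
    convert this using 1
    module
  have heD : d + t • (d - p) ∈ D := hD.superset ⟨ht, heQ⟩
  refine notMem_frontier (mem_of_mem_openSegment hP hp (hDP (subset_closure heD))
    (z := d) ⟨t / (1 + t), 1 / (1 + t), by positivity, by positivity, ?_, ?_⟩)
    (hDP (subset_closure hd))
  · field_simp
    ring
  · have h1 : 1 + t ≠ 0 := by positivity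
    have e : d = (1 + t)⁻¹ • ((1 + t) • d) := by rw [smul_smul, inv_mul_cancel₀ h1, one_smul]
    conv_rhs => rw [e]
    rw [div_eq_inv_mul, div_eq_inv_mul, mul_smul, mul_smul, ← smul_add]
    congr 1
    module

/-! ### Cylindrical angles and the plain coordinates of a convex domain. -/

variable (F : P.Frames)

theorem Frames.norm_cplx {j : Fin P.numFaces} {i : Fin P.numEdges} (hi : i ∈ P.sides j) (p : E3) :
    ‖cplx (P.edge i).1 (F.ν j i) (F.n j i) p‖ = distLine (P.edge i).1 (P.edge i).2 p :=
  Kondratiev.norm_cplx (P.edge_ne i) (F.norm_ν j i hi) (F.norm_n j i hi) (F.inner_ν_n j i hi)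
    (F.inner_edge_ν j i hi) (F.inner_edge_n j i hi) p

theorem Frames.theta_eq (j : Fin P.numFaces) (i : Fin P.numEdges) (p : E3) :
    F.theta j i p = posArg (cplx (P.edge i).1 (F.ν j i) (F.n j i) p) := rfl

theorem Frames.symbolOn_theta {j : Fin P.numFaces} {i : Fin P.numEdges} (hi : i ∈ P.sides j)
    (h : ∀ p ∈ S, F.theta j i p ≠ 0) :
    SymbolOn S (fun _ => 1) (distLine (P.edge i).1 (P.edge i).2) (F.theta j i) := by
  have := symbolOn_posArg (S := S) (A := (P.edge i).1) (ν := F.ν j i) (n := F.n j i)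
    fun p hp => neg_mem_slitPlane_of_posArg_ne_zero (h p hp)
  rwa [funext (F.norm_cplx hi)] at this

/-- The edge direction and `ν`, which points into the face, span the plane of the face. A point with
zero normal component would lie in that plane, which a convex domain does not meet. -/
theorem Frames.inner_n_ne_zero_of_convex (hP : Convex ℝ (P.dom : Set E3)) {j : Fin P.numFaces}
    {i : Fin P.numEdges} (hi : i ∈ P.sides j) {p : E3} (hp : p ∈ P.dom) :
    inner ℝ (p - (P.edge i).1) (F.n j i) ≠ (0 : ℝ) := by
  intro h0
  set A := (P.edge i).1
  set B := (P.edge i).2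
  obtain ⟨b, b0, b1, b2⟩ := exists_orthonormalBasis_edge (P.edge_ne i) (F.norm_ν j i hi)
    (F.norm_n j i hi) (F.inner_ν_n j i hi) (F.inner_edge_ν j i hi) (F.inner_edge_n j i hi)
  obtain ⟨Q, _, hDQ, ⟨U, hU, hD⟩, _⟩ := P.isPolygon j
  have hclQ : closure (P.face j) ⊆ Q :=
    closure_minimal hDQ (AffineSubspace.closed_of_finiteDimensional Q)
  have hA : A ∈ Q := hclQ (segment_subset_closure_face hi (left_mem_segment ℝ _ _))
  have hB : B ∈ Q := hclQ (segment_subset_closure_face hi (right_mem_segment ℝ _ _))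
  have hx : midpoint ℝ A B ∈ openSegment ℝ A B :=
    ⟨1 / 2, 1 / 2, by norm_num, by norm_num, by norm_num, by
      rw [midpoint_eq_smul_add, smul_add]; norm_num⟩
  have hxQ : midpoint ℝ A B ∈ Q :=
    hclQ (segment_subset_closure_face hi (openSegment_subset_segment ℝ _ _ hx))
  obtain ⟨s, hs, hs0⟩ := ((F.into_face j i hi _ hx).and
    (self_mem_nhdsWithin (s := Ioi (0 : ℝ)))).exists
  have hs0 : 0 < s := hs0
  have hν : F.ν j i ∈ Q.direction := by
    have := AffineSubspace.vsub_mem_direction (hDQ hs) hxQ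
    rw [vsub_eq_sub, add_sub_cancel_left] at this
    exact (Submodule.smul_mem_iff _ hs0.ne').1 this
  have hu : B - A ∈ Q.direction := AffineSubspace.vsub_mem_direction hB hA
  have hpQ : p ∈ Q := by
    have e := b.sum_repr' (p - A)
    rw [Fin.sum_univ_three, b0, b1, b2, real_inner_comm (p - A) (F.n j i), h0, zero_smul,
      add_zero] at e
    have h1 : p - A ∈ Q.direction := by
      rw [← e]
      exact Q.direction.add_mem (Q.direction.smul_mem _ (Q.direction.smul_mem _ hu))
        (Q.direction.smul_mem _ hν)
    have := AffineSubspace.vadd_mem_of_mem_direction h1 hA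
    rwa [vadd_eq_add, sub_add_cancel] at this
  exact notMem_plane_of_convex hP hU hD hs (face_subset_frontier j) hp hpQ

theorem Frames.theta_ne_zero_of_convex (hP : Convex ℝ (P.dom : Set E3)) {j : Fin P.numFaces}
    {i : Fin P.numEdges} (hi : i ∈ P.sides j) {p : E3} (hp : p ∈ P.dom) : F.theta j i p ≠ 0 := by
  have h := F.inner_n_ne_zero_of_convex hP hi hp
  rw [F.theta_eq, posArg_eq (Or.inr (by simpa [cplx] using h)), Complex.log_im]
  have h1 : -Real.pi < (-cplx (P.edge i).1 (F.ν j i) (F.n j i) p).arg := Complex.neg_pi_lt_arg _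
  linarith

theorem Frames.radBounds_plain (hP : Convex ℝ (P.dom : Set E3)) : F.plain.RadBounds where
  pos i _ hp := distLine_pos_of_convex hP i hp
  le_fst _ := ⟨1, zero_le_one, fun p _ => (distLine_le_left _ _ p).trans_eq (one_mul _).symm⟩
  le_snd _ := ⟨1, zero_le_one, fun p _ => (distLine_le_right _ _ p).trans_eq (one_mul _).symm⟩

theorem Frames.isWeight_plain (hP : Convex ℝ (P.dom : Set E3)) : IsWeight P.dom F.plain.rP := by
  refine (F.radBounds_plain hP).isWeight fun i => ?_
  obtain ⟨M, _, hM⟩ := (F.radBounds_plain hP).exists_rP_le_rad i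
  exact (symbolOn_distLine fun p hp => distLine_pos_of_convex hP i hp).rescale
    (fun p hp => ((F.radBounds_plain hP).rP_pos hp).le) hM fun _ _ => distLine_nonneg _ _ _

theorem Frames.symbolOn_ang_plain (hP : Convex ℝ (P.dom : Set E3)) (c : F.plain.ι) :
    SymbolOn (P.dom : Set E3) (fun _ => 1) F.plain.rP (F.plain.ang c) := by
  have key : ∀ (i : Fin P.numEdges) (f : E3 → ℝ), SymbolOn (P.dom : Set E3) (fun _ => 1)
      (distLine (P.edge i).1 (P.edge i).2) f →
      SymbolOn (P.dom : Set E3) (fun _ => 1) F.plain.rP f := fun i f hf => by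
    obtain ⟨M, _, hM⟩ := (F.radBounds_plain hP).exists_rP_le_rad i
    exact hf.rescale (fun p hp => ((F.radBounds_plain hP).rP_pos hp).le) hM
      fun _ _ => distLine_nonneg _ _ _
  have hpos : ∀ i, ∀ p ∈ (P.dom : Set E3), 0 < distLine (P.edge i).1 (P.edge i).2 p :=
    fun i p hp => distLine_pos_of_convex hP i hp
  rcases c with i | i | i
  · exact key i _ (F.symbolOn_theta (F.mem_sides i) fun p hp =>
      F.theta_ne_zero_of_convex hP (F.mem_sides i) hp)
  · exact key i _ (symbolOn_angle (P.edge_ne i) (hpos i))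
  · refine key i _ ?_
    have e : distLine (P.edge i).1 (P.edge i).2 = distLine (P.edge i).2 (P.edge i).1 :=
      funext fun p => distLine_comm _ _ p
    rw [e]
    refine symbolOn_angle (P.edge_ne i).symm ?_
    rw [← e]
    exact hpos i

end PolyhedralDomain

/-! ### The modified coordinate functions -/

/-- Where both angles stay away from `π`, the distance to the line dominates the modified distance
and hence `w`; estimates at its scale therefore carry over to `w`. -/
theorem IsAngleCutoff.rescale_distLine {ψ : ℝ → ℝ} {α : ℝ} (hψ : IsAngleCutoff ψ α) {A B : E3}
    (hAB : A ≠ B) {S : Set E3} {w : E3 → ℝ} {C s : ℝ} (hC : 0 ≤ C) (hs : 0 < s)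
    (hS : ∀ p ∈ S, p ∉ segment ℝ A B) (hw : ∀ p ∈ S, 0 ≤ w p)
    (hwC : ∀ p ∈ S, w p ≤ C * modRad ψ A B p)
    (hA : ∀ p ∈ S, EuclideanGeometry.angle p A B ≤ Real.pi - s)
    (hB : ∀ p ∈ S, EuclideanGeometry.angle p B A ≤ Real.pi - s) :
    (∀ p ∈ S, 0 < distLine A B p) ∧ ∀ {m f : E3 → ℝ}, SymbolOn S m (distLine A B) f →
      SymbolOn S m w f := by
  obtain ⟨C', hC', h⟩ := hψ.exists_modRad_le_distLine hAB hs
  refine ⟨fun p hp => pos_of_mul_pos_right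
    ((hψ.modRad_pos hAB (hS p hp)).trans_le (h p (hA p hp) (hB p hp))) hC', fun hf => ?_⟩
  refine hf.rescale hw (C := C * C') (fun p hp => ?_) fun _ _ => distLine_nonneg _ _ _
  rw [mul_assoc]
  exact (hwC p hp).trans (mul_le_mul_of_nonneg_left (h p (hA p hp) (hB p hp)) hC)

/-- A smooth function of a bounded positive function which is a symbol with respect to itself. -/
theorem SymbolOn.comp_self {S : Set E3} {f : E3 → ℝ} {ψ : ℝ → ℝ} {D : ℝ}
    (hf : SymbolOn S f f f) (hψ : ContDiff ℝ ∞ ψ) (hpos : ∀ p ∈ S, 0 < f p) (hD : 0 ≤ D)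
    (hfD : ∀ p ∈ S, f p ≤ D) : SymbolOn S (fun _ => 1) f (fun p => ψ (f p)) :=
  (hf.weaken (m' := fun _ => 1) hD fun p hp => by simpa using hfD p hp).comp hpos
    (isCompact_Icc (a := 0) (b := D)) (fun p hp => ⟨(hpos p hp).le, hfD p hp⟩)
    fun _ _ => hψ.contDiffAt

/-- An obtuse angle at `B` would make `pA` the longest side of the triangle. -/
theorem angle_le_pi_div_two_of_dist_lt {p A B : E3} (h : dist p A < dist B A) :
    EuclideanGeometry.angle p B A ≤ Real.pi / 2 := by
  by_contra! h1
  have h2 := Real.cos_neg_of_pi_div_two_lt_of_lt h1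
    (by linarith [EuclideanGeometry.angle_le_pi p B A, Real.pi_pos])
  have h3 := EuclideanGeometry.law_cos p B A
  have h4 : dist p B * dist A B * Real.cos (EuclideanGeometry.angle p B A) ≤ 0 :=
    mul_nonpos_of_nonneg_of_nonpos (by positivity) h2.le
  rw [dist_comm B A] at h
  nlinarith [sq_nonneg (dist p B), dist_nonneg (x := p) (y := A)]

namespace PolyhedralDomain

namespace Cutoffs

variable {P : PolyhedralDomain} {F : P.Frames} (χ : Cutoffs F)

theorem isAngleCutoff : IsAngleCutoff χ.ψ₃ χ.α :=
  ⟨χ.α_pos, χ.α_lt, χ.ψ₃_smooth, χ.ψ₃_mapsTo, χ.ψ₃_eq_one, χ.ψ₃_eq_zero⟩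

theorem rad_modified (i : Fin P.numEdges) :
    χ.modified.rad i = modRad χ.ψ₃ (P.edge i).1 (P.edge i).2 := rfl

theorem radBounds : χ.modified.RadBounds where
  pos i _ hp := χ.isAngleCutoff.modRad_pos (P.edge_ne i) (notMem_segment hp i)
  le_fst i := by
    obtain ⟨M, hM, h⟩ := χ.isAngleCutoff.exists_modRad_le_dist (P.edge_ne i)
    exact ⟨M, hM, fun p _ => h p⟩
  le_snd i := by
    obtain ⟨M, hM, h⟩ := χ.isAngleCutoff.exists_modRad_le_dist (P.edge_ne i).symm
    refine ⟨M, hM, fun p _ => ?_⟩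
    rw [rad_modified, modRad_comm]
    exact h p

theorem rP_nonneg : ∀ p ∈ (P.dom : Set E3), 0 ≤ χ.modified.rP p :=
  fun _ hp => (χ.radBounds.rP_pos hp).le

theorem isWeight : IsWeight P.dom χ.modified.rP := by
  refine χ.radBounds.isWeight fun i => ?_
  obtain ⟨M, hM, h⟩ := χ.radBounds.exists_rP_le_rad i
  exact χ.isAngleCutoff.symbolOn_modRad (P.edge_ne i) hM (fun p hp => notMem_segment hp i)
    χ.rP_nonneg h

/-- Where either angle exceeds `2α` the function vanishes locally. On the rest `α_small` keeps the
domain off the half-plane where `θ` jumps, and both angles are at most `2α < π`. -/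
theorem symbolOn_theta (i : Fin P.numEdges) :
    SymbolOn (P.dom : Set E3) (fun _ => 1) χ.modified.rP
      (fun p => χ.ψ₃ (P.phiA i p) * χ.ψ₃ (P.phiB i p) * χ.ψ₂ (P.lineDist i p) *
        F.theta (F.chosenFace i) i p) := by
  have hψ := χ.isAngleCutoff
  obtain ⟨M, hM, h⟩ := χ.radBounds.exists_rP_le_rad i
  have e1 : SymbolOn {p ∈ (P.dom : Set E3) | 2 * χ.α < P.phiA i p} (fun _ => 1) χ.modified.rP
      (fun p => χ.ψ₃ (P.phiA i p) * χ.ψ₃ (P.phiB i p) * χ.ψ₂ (P.lineDist i p) *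
        F.theta (F.chosenFace i) i p) := by
    refine SymbolOn.zero_of_eventuallyEq (fun p hp => ?_) (by simp)
    filter_upwards [hψ.eventually_eq_zero (P.edge_ne i) (ne_fst hp.1 i) hp.2] with q hq
    rw [show χ.ψ₃ (P.phiA i q) = 0 from hq, zero_mul, zero_mul, zero_mul]
  have e2 : SymbolOn {p ∈ (P.dom : Set E3) | 2 * χ.α < P.phiB i p} (fun _ => 1) χ.modified.rP
      (fun p => χ.ψ₃ (P.phiA i p) * χ.ψ₃ (P.phiB i p) * χ.ψ₂ (P.lineDist i p) *
        F.theta (F.chosenFace i) i p) := by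
    refine SymbolOn.zero_of_eventuallyEq (fun p hp => ?_) (by simp)
    filter_upwards [hψ.eventually_eq_zero (P.edge_ne i).symm (ne_snd hp.1 i) hp.2] with q hq
    rw [show χ.ψ₃ (P.phiB i q) = 0 from hq, mul_zero, zero_mul, zero_mul]
  set T := {p ∈ (P.dom : Set E3) | P.phiA i p ≤ 2 * χ.α ∧ P.phiB i p ≤ 2 * χ.α}
  have hTP : ∀ p ∈ T, p ∈ P.dom := fun p hp => hp.1
  obtain ⟨hpos, hre⟩ := hψ.rescale_distLine (P.edge_ne i) (S := T) hM
    (s := Real.pi - 2 * χ.α) (by linarith [χ.α_lt]) (fun p hp => notMem_segment hp.1 i)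
    (fun p hp => χ.rP_nonneg p hp.1) (fun p hp => h p hp.1)
    (fun p hp => by rw [sub_sub_cancel]; exact hp.2.1)
    (fun p hp => by rw [sub_sub_cancel]; exact hp.2.2)
  obtain ⟨D, hD, hD'⟩ := P.exists_dist_le (P.edge i).1
  have hd0 : ∀ p ∈ T, 0 ≤ distLine (P.edge i).1 (P.edge i).2 p := fun p hp => (hpos p hp).le
  have s1 := symbolOn_comp_angle (P.edge_ne i) χ.ψ₃_smooth hpos
  have s2 := symbolOn_comp_angle (P.edge_ne i).symm χ.ψ₃_smooth (S := T)
    (fun p hp => by rw [distLine_comm]; exact hpos p hp)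
  rw [show distLine (P.edge i).2 (P.edge i).1 = distLine (P.edge i).1 (P.edge i).2 from
    funext fun p => distLine_comm _ _ p] at s2
  have s3 := (symbolOn_distLine hpos).comp_self χ.ψ₂_smooth hpos hD
    fun p hp => (distLine_le_left _ _ p).trans (hD' p hp.1)
  have s4 := F.symbolOn_theta (F.mem_sides i) (S := T) fun p hp =>
    χ.α_small i p hp.1 hp.2.1 hp.2.2
  have e3 := hre ((((s1.mul s2 hd0).mul s3 hd0).mul s4 hd0).congr_fun (m' := fun _ => 1)
    (by simp))
  refine ((e1.union e2 (by simp)).union e3 (by simp)).mono_set fun p hp => ?_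
  rcases lt_or_ge (2 * χ.α) (P.phiA i p) with h1 | h1
  · exact Or.inl (Or.inl ⟨hp, h1⟩)
  · rcases lt_or_ge (2 * χ.α) (P.phiB i p) with h2 | h2
    · exact Or.inl (Or.inr ⟨hp, h2⟩)
    · exact Or.inr ⟨hp, h1, h2⟩

theorem eventually_ψ₄_two_angle {p A B : E3} (hAB : A ≠ B) (hp : p ≠ A)
    (h : 2 * EuclideanGeometry.angle p A B ∉ Icc χ.ε (2 * Real.pi - χ.ε)) :
    ∀ᶠ q in 𝓝 p, χ.ψ₄ (2 * EuclideanGeometry.angle q A B) = 0 := by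
  have hc : ContinuousAt (fun q => 2 * EuclideanGeometry.angle q A B) p :=
    continuousAt_const.mul (continuousAt_angle_left hAB hp)
  filter_upwards [hc.eventually_mem (isClosed_Icc.isOpen_compl.mem_nhds h)] with q hq
  have h1 := angle_mem_Icc q A B
  refine χ.ψ₄_eq_zero _ ?_
  rcases lt_or_ge (2 * EuclideanGeometry.angle q A B) χ.ε with h2 | h2
  · exact Or.inl ⟨by linarith [h1.1], h2.le⟩
  · refine Or.inr ⟨?_, by linarith [h1.2]⟩
    by_contra! h3
    exact hq ⟨h2, h3.le⟩

/-- Across its half-plane `θ` jumps between 0 and `2π`; `ψ₄` vanishes near both values, so the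
composite vanishes near such points. -/
theorem eventually_ψ₄_theta {j : Fin P.numFaces} {i : Fin P.numEdges} (hi : i ∈ P.sides j) {p : E3}
    (hp : 0 < distLine (P.edge i).1 (P.edge i).2 p) (h : F.theta j i p = 0) :
    ∀ᶠ q in 𝓝 p, χ.ψ₄ (F.theta j i q) = 0 := by
  have hz0 : cplx (P.edge i).1 (F.ν j i) (F.n j i) p ≠ 0 := by
    rw [← norm_pos_iff, F.norm_cplx hi]
    exact hp
  have harg : (cplx (P.edge i).1 (F.ν j i) (F.n j i) p).arg = 0 := by
    rw [F.theta_eq, posArg] at h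
    split_ifs at h with h1
    · exact h
    · linarith [Complex.neg_pi_lt_arg (cplx (P.edge i).1 (F.ν j i) (F.n j i) p), Real.pi_pos]
  have hsl : cplx (P.edge i).1 (F.ν j i) (F.n j i) p ∈ Complex.slitPlane := by
    rw [Complex.mem_slitPlane_iff_arg, harg]
    exact ⟨Real.pi_pos.ne, hz0⟩
  have hzc : ContinuousAt (cplx (P.edge i).1 (F.ν j i) (F.n j i)) p := by
    rw [funext (cplx_eq (P.edge i).1 (F.ν j i) (F.n j i))]
    fun_prop
  have hac : ContinuousAt (fun q => (cplx (P.edge i).1 (F.ν j i) (F.n j i) q).arg) p :=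
    ContinuousAt.comp (f := cplx (P.edge i).1 (F.ν j i) (F.n j i)) (Complex.continuousAt_arg hsl) hzc
  have hmem : Ioo (-χ.ε) χ.ε ∈ 𝓝 (cplx (P.edge i).1 (F.ν j i) (F.n j i) p).arg := by
    rw [harg]
    exact Ioo_mem_nhds (by linarith [χ.ε_pos]) χ.ε_pos
  filter_upwards [hac.eventually_mem hmem] with q hq
  refine χ.ψ₄_eq_zero _ ?_
  rw [F.theta_eq, posArg]
  split_ifs with h1
  · exact Or.inl ⟨h1, hq.2.le⟩
  · exact Or.inr ⟨by linarith [hq.1], by linarith⟩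

theorem symbolOn_cutoff_theta {j : Fin P.numFaces} {i : Fin P.numEdges} (hi : i ∈ P.sides j) :
    SymbolOn (P.dom : Set E3) (fun _ => 1) χ.modified.rP
      (fun p => χ.ψ₄ (F.theta j i p) * χ.ψ₄ (2 * P.phiA i p) * χ.ψ₄ (2 * P.phiB i p)) := by
  set f := fun p => χ.ψ₄ (F.theta j i p) * χ.ψ₄ (2 * P.phiA i p) * χ.ψ₄ (2 * P.phiB i p)
  obtain ⟨M, hM, h⟩ := χ.radBounds.exists_rP_le_rad i
  have e1 : SymbolOn {p ∈ (P.dom : Set E3) | 2 * P.phiA i p ∉ Icc χ.ε (2 * Real.pi - χ.ε)}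
      (fun _ => 1) χ.modified.rP f := by
    refine SymbolOn.zero_of_eventuallyEq (fun p hp => ?_) (by simp)
    filter_upwards [χ.eventually_ψ₄_two_angle (P.edge_ne i) (ne_fst hp.1 i) hp.2] with q hq
    simp only [f]
    rw [show χ.ψ₄ (2 * P.phiA i q) = 0 from hq, mul_zero, zero_mul]
  have e2 : SymbolOn {p ∈ (P.dom : Set E3) | 2 * P.phiB i p ∉ Icc χ.ε (2 * Real.pi - χ.ε)}
      (fun _ => 1) χ.modified.rP f := by
    refine SymbolOn.zero_of_eventuallyEq (fun p hp => ?_) (by simp)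
    filter_upwards [χ.eventually_ψ₄_two_angle (P.edge_ne i).symm (ne_snd hp.1 i) hp.2] with q hq
    simp only [f]
    rw [show χ.ψ₄ (2 * P.phiB i q) = 0 from hq, mul_zero]
  set T := {p ∈ (P.dom : Set E3) | 2 * P.phiA i p ∈ Icc χ.ε (2 * Real.pi - χ.ε) ∧
    2 * P.phiB i p ∈ Icc χ.ε (2 * Real.pi - χ.ε)}
  -- The bound `2φ ≤ 2π - ε` gives `φ ≤ π - ε/2`, hence the choice of `s`.
  obtain ⟨hpos, hre⟩ := χ.isAngleCutoff.rescale_distLine (P.edge_ne i) (S := T) hM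
    (s := χ.ε / 2) (by linarith [χ.ε_pos]) (fun p hp => notMem_segment hp.1 i)
    (fun p hp => χ.rP_nonneg p hp.1) (fun p hp => h p hp.1)
    (fun p hp => by have := hp.2.1.2; rw [phiA] at this; linarith)
    (fun p hp => by have := hp.2.2.2; rw [phiB] at this; linarith)
  have e3 : SymbolOn {p ∈ T | F.theta j i p = 0} (fun _ => 1)
      (distLine (P.edge i).1 (P.edge i).2) f := by
    refine SymbolOn.zero_of_eventuallyEq (fun p hp => ?_) (by simp)
    filter_upwards [χ.eventually_ψ₄_theta hi (hpos p hp.1) hp.2] with q hq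
    simp only [f]
    rw [hq, zero_mul, zero_mul]
  have e4 : SymbolOn {p ∈ T | F.theta j i p ≠ 0} (fun _ => 1)
      (distLine (P.edge i).1 (P.edge i).2) f := by
    have hpos' : ∀ p ∈ {p ∈ T | F.theta j i p ≠ 0}, 0 < distLine (P.edge i).1 (P.edge i).2 p :=
      fun p hp => hpos p hp.1
    have hd0 : ∀ p ∈ {p ∈ T | F.theta j i p ≠ 0}, 0 ≤ distLine (P.edge i).1 (P.edge i).2 p :=
      fun p hp => (hpos p hp.1).le
    have hψ : ContDiff ℝ ∞ fun t => χ.ψ₄ (2 * t) :=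
      χ.ψ₄_smooth.comp (contDiff_const.mul contDiff_id)
    have s0 := (F.symbolOn_theta hi (S := {p ∈ T | F.theta j i p ≠ 0}) fun p hp => hp.2).comp hpos'
      (isCompact_Icc (a := 0) (b := 2 * Real.pi))
      (fun p _ => ⟨posArg_nonneg _, posArg_le _⟩) fun t _ => χ.ψ₄_smooth.contDiffAt (x := t)
    have s1 := symbolOn_comp_angle (P.edge_ne i) hψ hpos'
    have s2 := symbolOn_comp_angle (P.edge_ne i).symm hψ (S := {p ∈ T | F.theta j i p ≠ 0})
      (fun p hp => by rw [distLine_comm]; exact hpos' p hp)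
    rw [show distLine (P.edge i).2 (P.edge i).1 = distLine (P.edge i).1 (P.edge i).2 from
      funext fun p => distLine_comm _ _ p] at s2
    exact ((s0.mul s1 hd0).mul s2 hd0).congr_fun (by simp)
  have e5 : SymbolOn T (fun _ => 1) χ.modified.rP f := by
    refine hre ((e3.union e4 (by simp)).mono_set fun p hp => ?_)
    by_cases h0 : F.theta j i p = 0
    · exact Or.inl ⟨hp, h0⟩
    · exact Or.inr ⟨hp, h0⟩
  refine ((e1.union e2 (by simp)).union e5 (by simp)).mono_set fun p hp => ?_
  by_cases h1 : 2 * P.phiA i p ∈ Icc χ.ε (2 * Real.pi - χ.ε)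
  · by_cases h2 : 2 * P.phiB i p ∈ Icc χ.ε (2 * Real.pi - χ.ε)
    · exact Or.inr ⟨hp, h1, h2⟩
    · exact Or.inl (Or.inr ⟨hp, h2⟩)
  · exact Or.inl (Or.inl ⟨hp, h1⟩)

/-- The function vanishes where `ρ_A > 2ℓ`, and `ψ₁` is constant where the angle at `A` exceeds `π -
δ`. In the remaining region `ρ_A ≤ 2ℓ < |AB|`, so the angle at `B` is at most `π/2` and both angles
are away from `π`. -/
theorem symbolOn_phi {A B : E3} (hAB : A ≠ B) (hℓ : 4 * χ.ℓ ≤ dist B A) {M N : ℝ} (hM : 0 ≤ M)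
    (hseg : ∀ p ∈ P.dom, p ∉ segment ℝ A B)
    (hwM : ∀ p ∈ P.dom, χ.modified.rP p ≤ M * modRad χ.ψ₃ A B p)
    (hwN : ∀ p ∈ P.dom, χ.modified.rP p ≤ N * dist p A) :
    SymbolOn (P.dom : Set E3) (fun _ => 1) χ.modified.rP
      (fun p => χ.ψ₁ (EuclideanGeometry.angle p A B) * χ.ψ₂ (dist p A)) := by
  have hne : ∀ p ∈ P.dom, p ≠ A := fun p hp h => hseg p hp (h ▸ left_mem_segment ℝ A B)
  obtain ⟨D, hD, hD'⟩ := P.exists_dist_le A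
  have s2 : SymbolOn (P.dom : Set E3) (fun _ => 1) χ.modified.rP (fun p => χ.ψ₂ (dist p A)) :=
    ((symbolOn_dist hne).comp_self χ.ψ₂_smooth (fun p hp => dist_pos.2 (hne p hp)) hD
      hD').rescale χ.rP_nonneg hwN fun _ _ => dist_nonneg
  have e1 : SymbolOn {p ∈ (P.dom : Set E3) | 2 * χ.ℓ < dist p A} (fun _ => 1) χ.modified.rP
      (fun p => χ.ψ₁ (EuclideanGeometry.angle p A B) * χ.ψ₂ (dist p A)) := by
    refine SymbolOn.zero_of_eventuallyEq (fun p hp => ?_) (by simp)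
    have hc : Continuous fun q => dist q A := by fun_prop
    filter_upwards [(isOpen_lt continuous_const hc).mem_nhds hp.2] with q hq
    rw [χ.ψ₂_eq_zero _ (le_of_lt hq), mul_zero]
  have e2 : SymbolOn {p ∈ (P.dom : Set E3) | Real.pi - χ.δ < EuclideanGeometry.angle p A B}
      (fun _ => 1) χ.modified.rP (fun p => χ.ψ₁ (EuclideanGeometry.angle p A B)) := by
    refine (SymbolOn.const (Real.pi - χ.δ) (C := ‖Real.pi - χ.δ‖) (norm_nonneg _) (by simp) (by simp)).congr
      fun p hp => ?_
    filter_upwards [(continuousAt_angle_left hAB (hne p hp.1)).eventually (lt_mem_nhds hp.2)]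
      with q hq
    exact χ.ψ₁_eq_const _ ⟨hq.le, EuclideanGeometry.angle_le_pi _ _ _⟩
  set T := {p ∈ (P.dom : Set E3) | EuclideanGeometry.angle p A B ≤ Real.pi - χ.δ ∧
    dist p A ≤ 2 * χ.ℓ}
  obtain ⟨hpos, hre⟩ := χ.isAngleCutoff.rescale_distLine hAB (S := T) hM
    (s := min χ.δ (Real.pi / 2)) (lt_min χ.δ_pos (by positivity)) (fun p hp => hseg p hp.1)
    (fun p hp => χ.rP_nonneg p hp.1) (fun p hp => hwM p hp.1)
    (fun p hp => by linarith [hp.2.1, min_le_left χ.δ (Real.pi / 2)])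
    (fun p hp => by
      have := angle_le_pi_div_two_of_dist_lt (p := p) (A := A) (B := B)
        (by linarith [hp.2.2, χ.ℓ_pos])
      linarith [min_le_right χ.δ (Real.pi / 2)])
  have e3 := hre (symbolOn_comp_angle hAB χ.ψ₁_smooth hpos)
  have e4 := ((e2.union e3 (by simp)).mul (s2.mono_set (union_subset (sep_subset _ _)
    (sep_subset _ _))) fun p hp => χ.rP_nonneg p (hp.elim (fun h => h.1) fun h => h.1)).congr_fun
    (m' := fun _ => 1) (by simp)
  refine (e1.union e4 (by simp)).mono_set fun p hp => ?_
  rcases lt_or_ge (2 * χ.ℓ) (dist p A) with h1 | h1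
  · exact Or.inl ⟨hp, h1⟩
  · rcases lt_or_ge (Real.pi - χ.δ) (EuclideanGeometry.angle p A B) with h2 | h2
    · exact Or.inr (Or.inl ⟨hp, h2⟩)
    · exact Or.inr (Or.inr ⟨hp, h2, h1⟩)

theorem symbolOn_ang (c : χ.modified.ι) :
    SymbolOn (P.dom : Set E3) (fun _ => 1) χ.modified.rP (χ.modified.ang c) := by
  rcases c with i | x | i | i
  · exact χ.symbolOn_theta i
  · exact χ.symbolOn_cutoff_theta x.2
  · obtain ⟨M, hM, h⟩ := χ.radBounds.exists_rP_le_rad i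
    obtain ⟨N, _, h'⟩ := χ.radBounds.exists_rP_le_dist (fst_mem_vertices i)
    exact χ.symbolOn_phi (P.edge_ne i) (by rw [dist_comm]; exact χ.ℓ_le i) hM
      (fun p hp => notMem_segment hp i) h h'
  · obtain ⟨M, hM, h⟩ := χ.radBounds.exists_rP_le_rad i
    obtain ⟨N, _, h'⟩ := χ.radBounds.exists_rP_le_dist (snd_mem_vertices i)
    refine χ.symbolOn_phi (P.edge_ne i).symm (χ.ℓ_le i) hM
      (fun p hp => by rw [segment_symm]; exact notMem_segment hp i) (fun p hp => ?_) h'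
    rw [modRad_comm]
    exact h p hp

end Cutoffs

/-! ### Admissible coordinates of either kind, and the proposition. -/

theorem Coordinates.IsAdmissible.isWeight {P : PolyhedralDomain} {C : P.Coordinates}
    (hC : C.IsAdmissible) : IsWeight P.dom C.rP := by
  cases hC with
  | plain F h => exact F.isWeight_plain h
  | modified F χ => exact χ.isWeight

theorem Coordinates.IsAdmissible.symbolOn_ang {P : PolyhedralDomain} {C : P.Coordinates}
    (hC : C.IsAdmissible) (c : C.ι) :
    SymbolOn (P.dom : Set E3) (fun _ => 1) C.rP (C.ang c) := by
  cases hC with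
  | plain F h => exact F.symbolOn_ang_plain h c
  | modified F χ => exact χ.symbolOn_ang c

end PolyhedralDomain

end Kondratiev

theorem mainTheorem4 (P : Kondratiev.PolyhedralDomain) (C : P.Coordinates)
    (hC : C.IsAdmissible) (k m : ℕ) (hm : m ≤ k) (a : ℝ) :
    (∀ A ∈ C.diffOp m,
      (∃ T : C.K k a →L[ℂ] C.K (k - m) a,
        ∀ u, Kondratiev.Kond.toDistr (T u) = A (Kondratiev.Kond.toDistr u)) ∧
      (∃ T : ℝ → (C.K k a →L[ℂ] C.K (k - m) a), Continuous T ∧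
        ∀ lam u, Kondratiev.Kond.toDistr (T lam u) = C.conj A lam (Kondratiev.Kond.toDistr u))) ∧
    (∀ A, P.IsSmoothDiffOp m A →
      (∃ T : C.K k a →L[ℂ] C.K (k - m) (a - m),
        ∀ u, Kondratiev.Kond.toDistr (T u) = A (Kondratiev.Kond.toDistr u)) ∧
      (∃ T : ℝ → (C.K k a →L[ℂ] C.K (k - m) (a - m)), Continuous T ∧
        ∀ lam u, Kondratiev.Kond.toDistr (T lam u) = C.conj A lam (Kondratiev.Kond.toDistr u))) := by
  refine ⟨fun A hA => ?_, fun A hA => ?_⟩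
  · have := (Kondratiev.PolyhedralDomain.Coordinates.isOpFamily_conj_of_mem_diffOp hC.isWeight
      hC.symbolOn_ang hA).conclusion hm a
    rw [sub_zero] at this
    exact this
  · exact (Kondratiev.PolyhedralDomain.isOpFamily_conjBy_of_isSmoothDiffOp hC.isWeight
      hA).conclusion hm a
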